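/- Let $B=(B_t)_{t\ge 0}$ be a standard Brownian motion on a probability space $(\Omega,\mathcal F,\mathbb P)$ and, for every $\lambda>0$, let $N=N^{\lambda}$ be a Poisson process with intensity $\lambda$ on the same space, independent of $B$. For $x\in\mathbb R$, $\theta\in\mathbb R$, $\sigma>0$ and $\lambda>0$ put $$X_t^{\theta,\sigma,\lambda}=x+\theta t+\sigma B_t+N^{\lambda}_t-\lambda t,\qquad t\ge 0.$$ Let $(\Delta_n)$ be a sequence in $(0,1]$ with $n\Delta_n\to\infty$ and $\Delta_n\to0$ as $n\to\infty$. For each $(\theta,\sigma,\lambda)$ the vector of observations $(X^{\theta,\sigma,\lambda}_{k\Delta_n})_{0\le k\le n}$ has a density $p(\cdot;(\theta,\sigma,\lambda))$ with respect to $\delta_x\otimes\mathrm{Leb}^{n}$ (the first observation being the deterministic point $x$), which is positive almost everywhere. Fix $(\theta,\sigma,\lambda)\in\mathbb R\times(0,\infty)\times(0,\infty)$, write $X^n=(X^{\theta,\sigma,\lambda}_{k\Delta_n})_{0\le k\le n}$, and for $z=(u,v,w)\in\mathbb R^3$ set $$\theta_n=\theta+\frac{u}{\sqrt{n\Delta_n}},\qquad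 \sigma_n=\sigma+\frac{v}{\sqrt n},\qquad \lambda_n=\lambda+\frac{w}{\sqrt{n\Delta_n}},$$ so that $\sigma_n>0$ and $\lambda_n>0$ for all large $n$. Then the LAN property holds at $(\theta,\sigma,\lambda)$ with rate of convergence $(\sqrt{n\Delta_n},\sqrt n,\sqrt{n\Delta_n})$ and asymptotic Fisher information matrix $$\Gamma(\theta,\sigma,\lambda)=\frac1{\sigma^2}\begin{pmatrix}1&0&-1\\0&2&0\\-1&0&1+\frac{\sigma^2}{\lambda}\end{pmatrix},$$ that is, for every $z=(u,v,w)\in\mathbb R^3$, as $n\to\infty$, $$\log\frac{p\left(X^{n};(\theta_n,\sigma_n,\lambda_n)\right)}{p\left(X^{n};(\theta,\sigma,\lambda)\right)}\;\longrightarrow\; z^{\mathsf T}\mathcal N\left(0,\Gamma(\theta,\sigma,\lambda)\right)-\frac12 z^{\mathsf T}\Gamma(\theta,\sigma,\lambda)z$$ in law (with $X^n$ distributed under the parameter $(\theta,\sigma,\lambda)$), where $\mathcal N(0,\Gamma(\theta,\sigma,\lambda))$ is a centered Gaussian vector in $\mathbb R^3$ with covariance matrix $\Gamma(\theta,\sigma,\lambda)$.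 -/

import Mathlib

open MeasureTheory ProbabilityTheory Filter Topology
open scoped NNReal ENNReal Matrix

noncomputable section

namespace LinearJump

/-- `N` is a Poisson process with intensity `r` under `P`: it starts at `0`, has independent
increments, `N t - N s` is Poisson distributed with parameter `r * (t - s)` for `s ≤ t`, and
almost all of its paths are right-continuous with left limits. -/
structure IsPoissonProcess {Ω : Type*} [MeasurableSpace Ω] (r : ℝ≥0) (N : ℝ≥0 → Ω → ℝ)
    (P : Measure Ω) : Prop where
  start_zero : ∀ᵐ ω ∂P, N 0 ω = 0
  indep_increments : HasIndepIncrements N P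
  increments_law : ∀ s t : ℝ≥0, s ≤ t →
    HasLaw (fun ω => N t ω - N s ω)
      ((poissonMeasure (r * (t - s))).map (Nat.cast : ℕ → ℝ)) P
  cadlag : ∀ᵐ ω ∂P, ∀ t : ℝ≥0,
    ContinuousWithinAt (fun s => N s ω) (Set.Ici t) t ∧
      ∃ a : ℝ, Tendsto (fun s => N s ω) (𝓝[<] t) (𝓝 a)

/-- The process `X_t = x + θ t + σ B_t + N_t - lam t`, where `N lam` is the Poisson process
that is used for the intensity `lam`. -/
def process {Ω : Type*} (B : ℝ≥0 → Ω → ℝ) (N : ℝ → ℝ≥0 → Ω → ℝ) (x θ σ lam : ℝ)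
    (t : ℝ≥0) (ω : Ω) : ℝ :=
  x + θ * t + σ * B t ω + N lam t ω - lam * t

/-- The observation `(X_0, X_δ, …, X_{nδ})`. -/
def observation {Ω : Type*} (B : ℝ≥0 → Ω → ℝ) (N : ℝ → ℝ≥0 → Ω → ℝ) (x θ σ lam : ℝ)
    (n : ℕ) (δ : ℝ≥0) (ω : Ω) : Fin (n + 1) → ℝ :=
  fun k => process B N x θ σ lam ((k : ℕ) * δ) ω

/-- The dominating measure for the observation: the first coordinate is the deterministic
starting point `x`, so it is the Dirac mass at `x` times Lebesgue measure in the other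
`n` coordinates. -/
def refMeasure (n : ℕ) (x : ℝ) : Measure (Fin (n + 1) → ℝ) :=
  Measure.pi (fun k : Fin (n + 1) => if k = 0 then Measure.dirac x else volume)

/-- The density `p(·; (θ, σ, lam))` of the observation. -/
def density {Ω : Type*} [MeasurableSpace Ω] (P : Measure Ω)
    (B : ℝ≥0 → Ω → ℝ) (N : ℝ → ℝ≥0 → Ω → ℝ) (x : ℝ) (n : ℕ) (δ : ℝ≥0) (θ σ lam : ℝ) :
    (Fin (n + 1) → ℝ) → ℝ≥0∞ :=
  pdf (observation B N x θ σ lam n δ) P (refMeasure n x)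

/-- The log-likelihood ratio `log (p(y; (θ', σ', lam')) / p(y; (θ, σ, lam)))` at
`y = (X_0, X_δ, …, X_{nδ})`, where `X` has the parameters `(θ, σ, lam)`. -/
def logLikelihoodRatio {Ω : Type*} [MeasurableSpace Ω] (P : Measure Ω)
    (B : ℝ≥0 → Ω → ℝ) (N : ℝ → ℝ≥0 → Ω → ℝ) (x : ℝ) (n : ℕ) (δ : ℝ≥0)
    (θ' σ' lam' θ σ lam : ℝ) (ω : Ω) : ℝ :=
  Real.log
    ((density P B N x n δ θ' σ' lam' (observation B N x θ σ lam n δ ω)).toReal /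
      (density P B N x n δ θ σ lam (observation B N x θ σ lam n δ ω)).toReal)

/-- The asymptotic Fisher information matrix. -/
def fisherInfo (σ lam : ℝ) : Matrix (Fin 3) (Fin 3) ℝ :=
  (1 / σ ^ 2) • !![1, 0, -1; 0, 2, 0; -1, 0, 1 + σ ^ 2 / lam]

end LinearJump

end

/-! The increments over the grid are independent and identically distributed, so the log-likelihood
ratio is a sum of `2 log q`, where `q` is the square root of the likelihood ratio of one increment.
Le Cam's method (`tendstoInDistribution_sum_log_one_add`) never differentiates log densities. Put `T
= q - 1`. It suffices to find a centred array `ξ` with `n E ξ² → τ`, `n E ξ⁴ → 0` and `n E (2T - ξ)²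
→ 0`. Indeed `2 log (1 + T) = 2T - T² + O(T³)`. The sum of `ξ` is asymptotically `N(0, τ)`. The sum
of `2T - ξ` concentrates at `-τ/4`, because `E T = -E T² / 2`, and the sum of `T²` tends to `τ/4`.
Altogether the limit is `N(0, τ) - τ/2`.

The density of an increment is a mixture of Gaussians over the unknown number of jumps, so `q` is
awkward to expand directly. Consider the complete experiment, in which the normalized Brownian
increment and the number of jumps are both seen. It is the product of a Gaussian location-scale
model and a Poisson model, and its likelihood ratio is explicit. A change of parameters shifts the
Gaussian by `α h`, rescales it by `1 + β h` and multiplies the Poisson rate by `1 + κ`. Here `h =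
1/√n`, `κ = c/√(n Δ_n)`, `α = (u - w)/σ`, `β = v/σ` and `c = w/λ`. The compensator `-λ t` couples
drift and intensity, which produces the off-diagonal entries `-1`. The information of the complete
experiment is `τ = α² + 2β² + λ c² = zᵀ Γ z`. Both factors are Hellinger differentiable
(`tendsto_integral_gaussian_remainder`, `integral_poisson_remainder_le`), hence so is the product
(`integral_prod_remainder_le`).

It remains to return to the increment alone, a function `p` of the complete data. Its squared
root-likelihood-ratio `R²` is the conditional mean of the complete one, so `R` dominates the
conditional mean of the complete square root. Therefore `R` is at least as close in `L²` as the
complete square root to any nonnegative function of `p` (`integral_sub_comp_sq_le`). Consequently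
the complete score still expands `R`, provided that it is `L²`-close to a function of `p`
(`integral_marginal_score_sq_le`). It is: rounding the increment recovers the number of jumps unless
the continuous part, of size `√Δ_n`, reaches `1/2`. The summed squared error is `O(Δ_n)`
(`memLp_integral_fullScore_sub_roundedScore`). So nothing is lost in the limit, and the score `ξ`
may be kept as a function of the hidden noise. -/

namespace LinearJump

/-! ### Limit theorems for triangular arrays with identically distributed rows -/

section RowLimits

/-- If `F n ≤ η * A n + b n / η` for every `η > 0`, where `A` converges and `b` tends to zero,
then the nonnegative sequence `F` tends to zero. -/
lemma tendsto_zero_of_forall_le_mul_add_div {F A b : ℕ → ℝ} {a : ℝ} (hF : ∀ n, 0 ≤ F n)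
    (hA : Tendsto A atTop (𝓝 a)) (hb : Tendsto b atTop (𝓝 0)) (hb0 : ∀ n, 0 ≤ b n)
    (h : ∀ᶠ n in atTop, ∀ η : ℝ, 0 < η → F n ≤ η * A n + b n / η) :
    Tendsto F atTop (𝓝 0) := by
  -- Taking `η` about `√b` makes both terms vanish, as `b / η ≤ η`. The summand `1 / (n + 1)` keeps
  -- `η` positive where `b` is zero.
  set η : ℕ → ℝ := fun n => √(b n + 1 / ((n : ℝ) + 1)) with hη
  have hηpos : ∀ n, 0 < η n := fun n =>
    Real.sqrt_pos.2 (add_pos_of_nonneg_of_pos (hb0 n) (by positivity))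
  have hη0 : Tendsto η atTop (𝓝 0) := by
    have := (hb.add (tendsto_one_div_add_atTop_nhds_zero_nat (𝕜 := ℝ))).sqrt
    simpa [hη] using this
  have hlim : Tendsto (fun n => η n * A n + η n) atTop (𝓝 0) := by
    simpa using (hη0.mul hA).add hη0
  refine tendsto_of_tendsto_of_tendsto_of_le_of_le' tendsto_const_nhds hlim
    (Eventually.of_forall hF) ?_
  filter_upwards [h] with n hn
  refine (hn (η n) (hηpos n)).trans ?_
  gcongr
  rw [div_le_iff₀ (hηpos n), hη, Real.mul_self_sqrt (add_nonneg (hb0 n) (by positivity))]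
  have : (0 : ℝ) < 1 / ((n : ℝ) + 1) := by positivity
  linarith

/-- Taylor's formula for `|x| ≤ 1`; for `|x| ≥ 1` every term is dominated by `|x| ^ 3`. Being
global, the bound integrates against a third moment without truncation. -/
lemma norm_cexp_mul_I_sub_le (x : ℝ) :
    ‖Complex.exp (x * Complex.I) - (1 + x * Complex.I - (x : ℂ) ^ 2 / 2)‖ ≤ 4 * |x| ^ 3 := by
  rcases le_total |x| 1 with h | h
  · have hn : ‖(x : ℂ) * Complex.I‖ = |x| := by simp
    have := Complex.exp_bound (x := x * Complex.I) (by rw [hn]; exact h) (n := 3) (by norm_num)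
    rw [hn] at this
    have e : ∑ m ∈ Finset.range 3, ((x : ℂ) * Complex.I) ^ m / (m.factorial : ℂ)
        = 1 + x * Complex.I - (x : ℂ) ^ 2 / 2 := by
      simp [Finset.sum_range_succ, mul_pow, Complex.I_sq]
      ring
    rw [e] at this
    refine this.trans ?_
    have h3 : 0 ≤ |x| ^ 3 := by positivity
    norm_num [Nat.factorial]
    linarith
  · have h1 : ‖Complex.exp (x * Complex.I)‖ = 1 := Complex.norm_exp_ofReal_mul_I x
    have h2 : ‖1 + x * Complex.I - (x : ℂ) ^ 2 / 2‖ ≤ 1 + |x| + |x| ^ 2 / 2 := by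
      refine (norm_sub_le _ _).trans (add_le_add ((norm_add_le _ _).trans ?_) ?_)
      · simp
      · simp
    have h3 : 1 ≤ |x| ^ 3 := one_le_pow₀ h
    have h4 : |x| ≤ |x| ^ 3 := le_self_pow₀ h (by norm_num)
    have h5 : |x| ^ 2 ≤ |x| ^ 3 := pow_le_pow_right₀ h (by norm_num)
    refine (norm_sub_le _ _).trans ?_
    rw [h1]
    linarith

variable {Ω E : Type*} [MeasurableSpace Ω] [MeasurableSpace E] {P : Measure Ω}
  {μ : ℕ → Measure E} {Z : (n : ℕ) → Fin n → Ω → E}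

lemma memLp_comp_of_hasLaw {m : Measure E} {X : Ω → E} (h : HasLaw X m P) {f : E → ℝ} {p : ℝ≥0∞}
    (hf : MemLp f p m) : MemLp (fun ω => f (X ω)) p P := by
  rw [← h.map_eq] at hf
  exact hf.comp_of_map h.aemeasurable

lemma integral_comp_of_hasLaw {m : Measure E} {X : Ω → E} (h : HasLaw X m P) {f : E → ℝ}
    (hf : AEStronglyMeasurable f m) : ∫ ω, f (X ω) ∂P = ∫ e, f e ∂m :=
  h.integral_comp hf

variable [IsProbabilityMeasure P]

/-- Weak law of large numbers for the rows of a triangular array. -/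
lemma tendstoInMeasure_row_sum (hlaw : ∀ n k, HasLaw (Z n k) (μ n) P)
    (hind : ∀ n, iIndepFun (Z n) P) {ζ : ℕ → E → ℝ} {c : ℝ} (hm : ∀ n, Measurable (ζ n))
    (hζ : ∀ᶠ n in atTop, MemLp (ζ n) 2 (μ n))
    (h2 : Tendsto (fun n : ℕ => n * ∫ e, ζ n e ^ 2 ∂μ n) atTop (𝓝 0))
    (h1 : Tendsto (fun n : ℕ => n * ∫ e, ζ n e ∂μ n) atTop (𝓝 c)) :
    TendstoInMeasure P (fun n ω => ∑ k, ζ n (Z n k ω)) atTop (fun _ => c) := by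
  rw [tendstoInMeasure_iff_norm]
  intro ε hε
  have hup : Tendsto (fun n : ℕ => ENNReal.ofReal ((n * ∫ e, ζ n e ^ 2 ∂μ n) / (ε / 2) ^ 2)) atTop
      (𝓝 0) := by
    have := (h2.div_const ((ε / 2) ^ 2))
    rw [zero_div] at this
    simpa using ENNReal.tendsto_ofReal this
  refine tendsto_of_tendsto_of_tendsto_of_le_of_le' tendsto_const_nhds hup
    (Eventually.of_forall fun _ => zero_le) ?_
  have hc : ∀ᶠ n : ℕ in atTop, |n * ∫ e, ζ n e ∂μ n - c| < ε / 2 := by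
    have := h1.eventually (Metric.ball_mem_nhds c (half_pos hε))
    filter_upwards [this] with n hn
    simpa [Real.dist_eq] using hn
  filter_upwards [hζ, hc] with n hn hcn
  have hL : ∀ k, MemLp (fun ω => ζ n (Z n k ω)) 2 P := fun k => memLp_comp_of_hasLaw (hlaw n k) hn
  set S : Ω → ℝ := fun ω => ∑ k, ζ n (Z n k ω) with hS
  have hSL : MemLp S 2 P := memLp_finsetSum _ fun k _ => hL k
  have hES : ∫ ω, S ω ∂P = n * ∫ e, ζ n e ∂μ n := by
    rw [hS, integral_finsetSum _ fun k _ => (hL k).integrable (by norm_num)]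
    simp [integral_comp_of_hasLaw (hlaw n _) hn.1]
  have hV : Var[S; P] ≤ n * ∫ e, ζ n e ^ 2 ∂μ n := by
    have hS' : S = ∑ k, fun ω => ζ n (Z n k ω) := by
      ext ω; simp [hS]
    rw [hS', IndepFun.variance_sum (fun k _ => hL k)]
    · calc ∑ k, Var[fun ω => ζ n (Z n k ω); P] ≤ ∑ _k : Fin n, ∫ e, ζ n e ^ 2 ∂μ n := by
            refine Finset.sum_le_sum fun k _ => ?_
            refine (variance_le_expectation_sq (hL k).1).trans_eq ?_
            exact integral_comp_of_hasLaw (hlaw n k) (f := fun e => ζ n e ^ 2) (hn.1.pow 2)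
        _ = _ := by simp
    · intro i _ j _ hij
      exact ((hind n).comp (fun _ => ζ n) fun _ => hm n).indepFun hij
  refine (measure_mono ?_).trans ((meas_ge_le_variance_div_sq hSL (half_pos hε)).trans ?_)
  · intro ω hω
    simp only [Set.mem_ofPred_eq, Real.norm_eq_abs] at hω ⊢
    rw [hES]
    have := abs_sub_le (S ω) (n * ∫ e, ζ n e ∂μ n) c
    have hω' : ε ≤ |S ω - c| := hω
    linarith
  · gcongr

/-- Markov's inequality for row sums. -/
lemma measure_one_le_row_sum_le (hlaw : ∀ n k, HasLaw (Z n k) (μ n) P) {n : ℕ} {φ : E → ℝ}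
    (h0 : ∀ e, 0 ≤ φ e) (hi : Integrable φ (μ n)) :
    P {ω | 1 ≤ ∑ k, φ (Z n k ω)} ≤ ENNReal.ofReal (n * ∫ e, φ e ∂μ n) := by
  have hint : ∀ k, Integrable (fun ω => φ (Z n k ω)) P := fun k =>
    memLp_one_iff_integrable.1 (memLp_comp_of_hasLaw (hlaw n k) (memLp_one_iff_integrable.2 hi))
  have := mul_meas_ge_le_integral_of_nonneg (μ := P) (f := fun ω => ∑ k, φ (Z n k ω))
    (ae_of_all _ fun ω => Finset.sum_nonneg fun k _ => h0 _)
    (integrable_finsetSum _ fun k _ => hint k) 1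
  rw [one_mul, integral_finsetSum _ fun k _ => hint k] at this
  simp only [integral_comp_of_hasLaw (hlaw n _) hi.1, Finset.sum_const, Finset.card_univ,
    Fintype.card_fin, nsmul_eq_mul] at this
  rw [← ofReal_measureReal (measure_ne_top _ _)]
  exact ENNReal.ofReal_le_ofReal this

/-- Row sums tend to zero in probability when, outside events of vanishing total probability,
their absolute values are dominated by functions with vanishing total expectation. -/
lemma tendstoInMeasure_row_sum_of_abs_le (hlaw : ∀ n k, HasLaw (Z n k) (μ n) P)
    {ζ φ ψ : ℕ → E → ℝ} (hφ : ∀ᶠ n in atTop, Integrable (φ n) (μ n))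
    (hψ : ∀ᶠ n in atTop, Integrable (ψ n) (μ n)) (hφ0 : ∀ n e, 0 ≤ φ n e) (hψ0 : ∀ n e, 0 ≤ ψ n e)
    (hle : ∀ n e, ψ n e < 1 → |ζ n e| ≤ φ n e)
    (h1 : Tendsto (fun n : ℕ => n * ∫ e, φ n e ∂μ n) atTop (𝓝 0))
    (h2 : Tendsto (fun n : ℕ => n * ∫ e, ψ n e ∂μ n) atTop (𝓝 0)) :
    TendstoInMeasure P (fun n ω => ∑ k, ζ n (Z n k ω)) atTop (fun _ => 0) := by
  rw [tendstoInMeasure_iff_norm]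
  intro ε hε
  have hup : Tendsto (fun n : ℕ => ENNReal.ofReal (n * ∫ e, φ n e / ε ∂μ n)
      + ENNReal.ofReal (n * ∫ e, ψ n e ∂μ n)) atTop (𝓝 0) := by
    have := h1.div_const ε
    rw [zero_div] at this
    simpa [integral_div, mul_div_assoc] using
      (ENNReal.tendsto_ofReal this).add (ENNReal.tendsto_ofReal h2)
  refine tendsto_of_tendsto_of_tendsto_of_le_of_le' tendsto_const_nhds hup
    (Eventually.of_forall fun _ => zero_le) ?_
  filter_upwards [hφ, hψ] with n hn hn'
  refine (measure_mono ?_).trans ((measure_union_le _ _).trans (add_le_add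
    (measure_one_le_row_sum_le hlaw (φ := fun e => φ n e / ε)
      (fun e => div_nonneg (hφ0 n e) hε.le) (hn.div_const ε))
    (measure_one_le_row_sum_le hlaw (hψ0 n) hn')))
  intro ω hω
  simp only [Set.mem_ofPred_eq, Real.norm_eq_abs, sub_zero, Set.mem_union] at hω ⊢
  -- If the `ψ`-sum is below one, so is each of its terms, and the domination by `φ` holds for the
  -- whole row at once.
  by_contra! hlt
  have hk : ∀ k, |ζ n (Z n k ω)| ≤ φ n (Z n k ω) := fun k => hle n _ <|
    (Finset.single_le_sum (f := fun k => ψ n (Z n k ω)) (fun k _ => hψ0 n _)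
      (Finset.mem_univ k)).trans_lt hlt.2
  have h3 := hlt.1
  rw [← Finset.sum_div, div_lt_one hε] at h3
  have := (Finset.abs_sum_le_sum_abs (fun k => ζ n (Z n k ω)) Finset.univ).trans
    (Finset.sum_le_sum fun k _ => hk k)
  linarith

/-- Weighted arithmetic-geometric mean. The free weight `η` is later sent to zero along the array.
-/
lemma abs_pow_three_le {η : ℝ} (hη : 0 < η) (x : ℝ) : |x| ^ 3 ≤ η * x ^ 2 + x ^ 4 / η := by
  have h : x ^ 4 / η = |x| ^ 4 / η := by rw [← Even.pow_abs (by decide : Even 4)]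
  rw [h, ← sq_abs x, ← sub_nonneg]
  have : η * |x| ^ 2 + |x| ^ 4 / η - |x| ^ 3
      = |x| ^ 2 / η * ((η - |x| / 2) ^ 2 + 3 / 4 * |x| ^ 2) := by
    field_simp; ring
  rw [this]; positivity

lemma abs_mul_le_add_div {η : ℝ} (hη : 0 < η) (x y : ℝ) : |x * y| ≤ η * x ^ 2 + y ^ 2 / η := by
  rw [abs_mul, ← sq_abs x, ← sq_abs y, ← sub_nonneg]
  have : η * |x| ^ 2 + |y| ^ 2 / η - |x| * |y|
      = 1 / η * ((η * |x| - |y| / 2) ^ 2 + 3 / 4 * |y| ^ 2) := by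
    field_simp; ring
  rw [this]; positivity

lemma memLp_two_sq {m : Measure E} {f : E → ℝ} (hf : MemLp f 4 m) :
    MemLp (fun e => f e ^ 2) 2 m := by
  refine (memLp_two_iff_integrable_sq (hf.1.pow 2)).2 ?_
  have := hf.integrable_norm_pow (p := 4) (by norm_num)
  refine this.congr (ae_of_all _ fun e => ?_)
  simp only [Real.norm_eq_abs, Pi.pow_apply]
  rw [Even.pow_abs (by decide)]; ring

lemma integrable_pow_four {m : Measure E} {f : E → ℝ} (hf : MemLp f 4 m) :
    Integrable (fun e => f e ^ 4) m := by
  refine (memLp_two_sq hf).integrable_sq.congr (ae_of_all _ fun e => ?_)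
  simp only; ring

lemma integrable_abs_pow_three {m : Measure E} [IsFiniteMeasure m] {f : E → ℝ}
    (hf : MemLp f 4 m) : Integrable (fun e => |f e| ^ 3) m := by
  have h2 : MemLp f 2 m := hf.mono_exponent (by norm_num)
  refine (h2.integrable_sq.add (integrable_pow_four hf)).mono' (hf.1.norm.pow 3) ?_
  refine ae_of_all _ fun e => ?_
  have := abs_pow_three_le one_pos (f e)
  simp only [Real.norm_eq_abs, Pi.add_apply]
  rw [abs_of_nonneg (by positivity)]
  linarith

/-- Interpolation between a bounded second and a vanishing fourth moment; the third-order Taylor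
remainders need it. -/
lemma tendsto_mul_integral_abs_pow_three [∀ n, IsProbabilityMeasure (μ n)] {ξ : ℕ → E → ℝ} {τ : ℝ}
    (hL : ∀ n, MemLp (ξ n) 4 (μ n))
    (h2 : Tendsto (fun n : ℕ => n * ∫ e, ξ n e ^ 2 ∂μ n) atTop (𝓝 τ))
    (h4 : Tendsto (fun n : ℕ => n * ∫ e, ξ n e ^ 4 ∂μ n) atTop (𝓝 0)) :
    Tendsto (fun n : ℕ => n * ∫ e, |ξ n e| ^ 3 ∂μ n) atTop (𝓝 0) := by
  refine tendsto_zero_of_forall_le_mul_add_div (fun n => ?_) h2 h4 (fun n => ?_)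
    (Eventually.of_forall fun n η hη => ?_)
  · exact mul_nonneg n.cast_nonneg (integral_nonneg fun e => by positivity)
  · exact mul_nonneg n.cast_nonneg (integral_nonneg fun e => by positivity)
  · have i2 : Integrable (fun e => ξ n e ^ 2) (μ n) :=
      ((hL n).mono_exponent (by norm_num : (2 : ℝ≥0∞) ≤ 4)).integrable_sq
    have i4 := integrable_pow_four (hL n)
    have : ∫ e, |ξ n e| ^ 3 ∂μ n ≤ η * ∫ e, ξ n e ^ 2 ∂μ n + (∫ e, ξ n e ^ 4 ∂μ n) / η := by
      rw [← integral_const_mul, ← integral_div, ← integral_add (i2.const_mul _) (i4.div_const _)]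
      exact integral_mono (integrable_abs_pow_three (hL n))
        ((i2.const_mul _).add (i4.div_const _)) fun e => abs_pow_three_le hη _
    calc (n : ℝ) * ∫ e, |ξ n e| ^ 3 ∂μ n
        ≤ n * (η * ∫ e, ξ n e ^ 2 ∂μ n + (∫ e, ξ n e ^ 4 ∂μ n) / η) := by gcongr
      _ = _ := by ring

/-- Lyapunov's central limit theorem for triangular arrays with identically distributed rows. -/
lemma tendstoInDistribution_row_sum [∀ n, IsProbabilityMeasure (μ n)] {Ω' : Type*} [MeasurableSpace Ω'] {P' : Measure Ω'}
    [IsProbabilityMeasure P'] (hlaw : ∀ n k, HasLaw (Z n k) (μ n) P)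
    (hind : ∀ n, iIndepFun (Z n) P) {ξ : ℕ → E → ℝ} {τ : ℝ≥0} (hm : ∀ n, Measurable (ξ n))
    (hL : ∀ n, MemLp (ξ n) 4 (μ n)) (h1 : ∀ n, ∫ e, ξ n e ∂μ n = 0)
    (h2 : Tendsto (fun n : ℕ => n * ∫ e, ξ n e ^ 2 ∂μ n) atTop (𝓝 τ))
    (h4 : Tendsto (fun n : ℕ => n * ∫ e, ξ n e ^ 4 ∂μ n) atTop (𝓝 0))
    {Y : Ω' → ℝ} (hY : HasLaw Y (gaussianReal 0 τ) P') :
    TendstoInDistribution (fun n ω => ∑ k, ξ n (Z n k ω)) atTop Y (fun _ => P) P' where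
  forall_aemeasurable n := Finset.aemeasurable_fun_sum _ fun k _ =>
    (hm n).comp_aemeasurable (hlaw n k).aemeasurable
  aemeasurable_limit := hY.aemeasurable
  tendsto := by
    refine ProbabilityMeasure.tendsto_iff_tendsto_charFun.2 fun t ↦ ?_
    rw! [hY.map_eq]
    have hchar : ∀ n : ℕ, charFun (P.map fun ω => ∑ k, ξ n (Z n k ω)) t
        = (1 + (∫ e, Complex.exp ((t * ξ n e : ℝ) * Complex.I) ∂μ n - 1)) ^ n := by
      intro n
      have hmk : ∀ k, AEMeasurable (fun ω => ξ n (Z n k ω)) P := fun k =>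
        (hm n).comp_aemeasurable (hlaw n k).aemeasurable
      rw [iIndepFun.charFun_map_fun_sum_eq_prod hmk
        ((hind n).comp (fun _ => ξ n) fun _ => hm n)]
      have hk : ∀ k, charFun (P.map fun ω => ξ n (Z n k ω)) t
          = ∫ e, Complex.exp ((t * ξ n e : ℝ) * Complex.I) ∂μ n := by
        intro k
        rw [charFun_apply_real, integral_map (hmk k) (by fun_prop), ← (hlaw n k).map_eq,
          integral_map (hlaw n k).aemeasurable]
        · simp
        · have := hm n
          exact (Measurable.aestronglyMeasurable (by fun_prop))
      simp [Finset.prod_apply, hk]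
    simp only [ProbabilityMeasure.coe_mk, hchar, charFun_gaussianReal]
    refine Complex.tendsto_one_add_pow_exp_of_tendsto ?_
    have h3 := tendsto_mul_integral_abs_pow_three hL h2 h4
    have hmain : Tendsto (fun n : ℕ => (((-(t ^ 2 / 2)) * (n * ∫ e, ξ n e ^ 2 ∂μ n) : ℝ) : ℂ)) atTop
        (𝓝 (t * (0 : ℝ) * Complex.I - τ * t ^ 2 / 2)) := by
      have := (Complex.continuous_ofReal.tendsto _).comp (h2.const_mul (-(t ^ 2 / 2)))
      have e : (t * (0 : ℝ) * Complex.I - τ * t ^ 2 / 2 : ℂ) = ((-(t ^ 2 / 2) * (τ : ℝ) : ℝ) : ℂ) := by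
        push_cast
        ring
      rw [e]
      exact this
    refine (tendsto_iff_of_dist ?_).1 hmain
    have hb : Tendsto (fun n : ℕ => 4 * |t| ^ 3 * (n * ∫ e, |ξ n e| ^ 3 ∂μ n)) atTop (𝓝 0) := by
      simpa using h3.const_mul (4 * |t| ^ 3)
    refine squeeze_zero (fun _ => dist_nonneg) (fun n => ?_) hb
    have i1 : Integrable (ξ n) (μ n) := (hL n).integrable (by norm_num)
    have i2 : Integrable (fun e => ξ n e ^ 2) (μ n) :=
      ((hL n).mono_exponent (by norm_num : (2 : ℝ≥0∞) ≤ 4)).integrable_sq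
    have i3 := integrable_abs_pow_three (hL n)
    have j1 : Integrable (fun e => ((ξ n e : ℝ) : ℂ)) (μ n) := i1.ofReal
    have j2 : Integrable (fun e => (((ξ n e) ^ 2 : ℝ) : ℂ)) (μ n) := i2.ofReal
    have j0 : Integrable (fun e => Complex.exp ((t * ξ n e : ℝ) * Complex.I)) (μ n) := by
      refine (integrable_const (1 : ℝ)).mono' ?_ (ae_of_all _ fun e => ?_)
      · have := hm n
        exact (Measurable.aestronglyMeasurable (by fun_prop))
      · rw [Complex.norm_exp_ofReal_mul_I]
    have ja : Integrable (fun e => (1 : ℂ) + t * (ξ n e : ℂ) * Complex.I) (μ n) :=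
      (integrable_const _).add ((j1.const_mul _).mul_const _)
    have jp : Integrable (fun e => (1 : ℂ) + t * (ξ n e : ℂ) * Complex.I
        - (t : ℂ) ^ 2 / 2 * ((ξ n e ^ 2 : ℝ) : ℂ)) (μ n) := ja.sub (j2.const_mul _)
    have hp : ∫ e, ((1 : ℂ) + t * (ξ n e : ℂ) * Complex.I
        - (t : ℂ) ^ 2 / 2 * ((ξ n e ^ 2 : ℝ) : ℂ)) ∂μ n
        = 1 - (t : ℂ) ^ 2 / 2 * ((∫ e, ξ n e ^ 2 ∂μ n : ℝ) : ℂ) := by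
      rw [integral_sub ja (j2.const_mul _),
        integral_add (integrable_const _) ((j1.const_mul _).mul_const _), integral_mul_const,
        integral_const_mul, integral_const_mul, integral_complex_ofReal, integral_complex_ofReal,
        h1 n]
      simp
    have hdiff : (n : ℂ) * (∫ e, Complex.exp ((t * ξ n e : ℝ) * Complex.I) ∂μ n - 1)
        - (((-(t ^ 2 / 2)) * (n * ∫ e, ξ n e ^ 2 ∂μ n) : ℝ) : ℂ)
        = n * ∫ e, (Complex.exp ((t * ξ n e : ℝ) * Complex.I) - ((1 : ℂ) + t * (ξ n e : ℂ) * Complex.I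
        - (t : ℂ) ^ 2 / 2 * ((ξ n e ^ 2 : ℝ) : ℂ))) ∂μ n := by
      rw [integral_sub j0 jp, hp]
      push_cast
      ring
    rw [dist_comm, dist_eq_norm, hdiff, norm_mul, Complex.norm_natCast]
    have : ‖∫ e, (Complex.exp ((t * ξ n e : ℝ) * Complex.I) - ((1 : ℂ) + t * (ξ n e : ℂ) * Complex.I
        - (t : ℂ) ^ 2 / 2 * ((ξ n e ^ 2 : ℝ) : ℂ))) ∂μ n‖ ≤ ∫ e, 4 * |t| ^ 3 * |ξ n e| ^ 3 ∂μ n := by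
      refine norm_integral_le_of_norm_le (i3.const_mul _) (ae_of_all _ fun e => ?_)
      have := norm_cexp_mul_I_sub_le (t * ξ n e)
      rw [abs_mul, mul_pow, ← mul_assoc] at this
      have e' : ((1 : ℂ) + t * (ξ n e : ℂ) * Complex.I - (t : ℂ) ^ 2 / 2 * ((ξ n e ^ 2 : ℝ) : ℂ))
          = 1 + (t * ξ n e : ℝ) * Complex.I - ((t * ξ n e : ℝ) : ℂ) ^ 2 / 2 := by
        push_cast
        ring
      rw [e']
      exact this
    rw [integral_const_mul] at this
    calc (n : ℝ) * _ ≤ n * (4 * |t| ^ 3 * ∫ e, |ξ n e| ^ 3 ∂μ n) := by gcongr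
      _ = _ := by ring

end RowLimits

/-! ### Le Cam's expansion of the log-likelihood ratio -/

lemma abs_two_mul_log_one_add_sub_le {x : ℝ} (hx : |x| ≤ 1 / 2) :
    |2 * Real.log (1 + x) - 2 * x + x ^ 2| ≤ 4 * |x| ^ 3 := by
  have h := Real.abs_log_sub_add_sum_range_le (x := -x) (by rw [abs_neg]; linarith) 2
  have e : ∑ i ∈ Finset.range 2, (-x) ^ (i + 1) / ((i : ℝ) + 1) + Real.log (1 - -x)
      = 1 / 2 * (2 * Real.log (1 + x) - 2 * x + x ^ 2) := by
    simp [Finset.sum_range_succ]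
    ring
  rw [e, abs_mul, abs_neg] at h
  have h2 : |x| ^ (2 + 1) / (1 - |x|) ≤ 2 * |x| ^ 3 := by
    rw [div_le_iff₀ (by linarith)]
    have : 0 ≤ |x| ^ 3 := by positivity
    norm_num
    nlinarith
  norm_num at h h2
  linarith

/-- The negligible part `d` is controlled only in `L²`, so it may enter only through its square.
When `|d| ≤ |x|` the cube is at most `|x| ^ 3`. Otherwise two factors are bounded by `|d|` and the
third by `1 / 2`. -/
lemma abs_pow_three_half_add_le {x d : ℝ} (h : |(x + d) / 2| ≤ 1 / 2) :
    |(x + d) / 2| ^ 3 ≤ |x| ^ 3 + d ^ 2 / 2 := by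
  have h1 : |(x + d) / 2| ≤ (|x| + |d|) / 2 := by
    rw [abs_div, abs_two]
    gcongr
    exact abs_add_le x d
  have h0 := abs_nonneg ((x + d) / 2)
  rcases le_total |d| |x| with hd | hd
  · have : |(x + d) / 2| ^ 3 ≤ |x| ^ 3 := pow_le_pow_left₀ h0 (by linarith) 3
    nlinarith [sq_nonneg d]
  · have h2 : |(x + d) / 2| ^ 2 ≤ d ^ 2 := by
      rw [← sq_abs d]
      exact pow_le_pow_left₀ h0 (by linarith) 2
    have : |(x + d) / 2| ^ 3 = |(x + d) / 2| ^ 2 * |(x + d) / 2| := by ring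
    rw [this]
    have h3 : 0 ≤ |x| ^ 3 := by positivity
    nlinarith [sq_nonneg |(x + d) / 2|]

/-- The constants are such that either `|x| > 1 / 2` or `|d| > 1 / 2` alone pushes the sum past one.
The sum has vanishing total expectation, so Markov's inequality discards the exceptional event. -/
lemma abs_half_add_le_of_lt_one {x d : ℝ} (h : 16 * x ^ 4 + 4 * d ^ 2 < 1) :
    |(x + d) / 2| ≤ 1 / 2 := by
  have hx : |x| ≤ 1 / 2 := by
    by_contra! hc
    have : (1 / 2) ^ 4 < |x| ^ 4 := by gcongr
    rw [Even.pow_abs (by decide)] at this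
    nlinarith [sq_nonneg d]
  have hd : |d| ≤ 1 / 2 := by
    by_contra! hc
    have : (1 / 2) ^ 2 < |d| ^ 2 := by gcongr
    rw [sq_abs] at this
    have : 0 ≤ x ^ 4 := by positivity
    nlinarith
  rw [abs_div, abs_two]
  linarith [abs_add_le x d]

section LocalAsymptoticNormality

variable {Ω E Ω' : Type*} [MeasurableSpace Ω] [MeasurableSpace E] [MeasurableSpace Ω']
  {P : Measure Ω} [IsProbabilityMeasure P] {P' : Measure Ω'} [IsProbabilityMeasure P']
  {μ : ℕ → Measure E} {Z : (n : ℕ) → Fin n → Ω → E}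

/-- The row sums of a function which is of third order at zero, evaluated at half the sum of a
Lyapunov array and a negligible array, tend to zero. -/
lemma tendstoInMeasure_row_sum_comp [∀ n, IsProbabilityMeasure (μ n)]
    (hlaw : ∀ n k, HasLaw (Z n k) (μ n) P)
    {ξ T : ℕ → E → ℝ} {τ C : ℝ} {g : ℝ → ℝ} (hC : 0 ≤ C)
    (hg : ∀ x, |x| ≤ 1 / 2 → |g x| ≤ C * |x| ^ 3)
    (hξL : ∀ n, MemLp (ξ n) 4 (μ n))
    (hξ2 : Tendsto (fun n : ℕ => (n : ℝ) * ∫ e, ξ n e ^ 2 ∂μ n) atTop (𝓝 τ))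
    (hξ4 : Tendsto (fun n : ℕ => (n : ℝ) * ∫ e, ξ n e ^ 4 ∂μ n) atTop (𝓝 0))
    (hdL : ∀ᶠ n in atTop, MemLp (fun e => 2 * T n e - ξ n e) 2 (μ n))
    (hTξ : Tendsto (fun n : ℕ => (n : ℝ) * ∫ e, (2 * T n e - ξ n e) ^ 2 ∂μ n) atTop (𝓝 0)) :
    TendstoInMeasure P (fun n ω => ∑ k, g (T n (Z n k ω))) atTop (fun _ => 0) := by
  have e1 : ∀ n e, T n e = (ξ n e + (2 * T n e - ξ n e)) / 2 := fun n e => by ring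
  refine tendstoInMeasure_row_sum_of_abs_le hlaw (ζ := fun n e => g (T n e))
    (φ := fun n e => C * |ξ n e| ^ 3 + C / 2 * (2 * T n e - ξ n e) ^ 2)
    (ψ := fun n e => 16 * ξ n e ^ 4 + 4 * (2 * T n e - ξ n e) ^ 2) ?_ ?_ ?_ ?_ ?_ ?_ ?_
  · filter_upwards [hdL] with n hn
    exact ((integrable_abs_pow_three (hξL n)).const_mul _).add (hn.integrable_sq.const_mul _)
  · filter_upwards [hdL] with n hn
    exact ((integrable_pow_four (hξL n)).const_mul _).add (hn.integrable_sq.const_mul _)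
  · intro n e
    positivity
  · intro n e
    positivity
  · intro n e h
    have h' := abs_half_add_le_of_lt_one h
    have h3 := abs_pow_three_half_add_le h'
    rw [← e1] at h' h3
    refine (hg _ h').trans ((mul_le_mul_of_nonneg_left h3 hC).trans_eq ?_)
    ring
  · have := ((tendsto_mul_integral_abs_pow_three hξL hξ2 hξ4).const_mul C).add
      (hTξ.const_mul (C / 2))
    rw [mul_zero, mul_zero, add_zero] at this
    refine this.congr' ?_
    filter_upwards [hdL] with n hn
    rw [integral_add ((integrable_abs_pow_three (hξL n)).const_mul _)
      (hn.integrable_sq.const_mul _), integral_const_mul, integral_const_mul]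
    ring
  · have := (hξ4.const_mul 16).add (hTξ.const_mul 4)
    rw [mul_zero, mul_zero, add_zero] at this
    refine this.congr' ?_
    filter_upwards [hdL] with n hn
    rw [integral_add ((integrable_pow_four (hξL n)).const_mul _)
      (hn.integrable_sq.const_mul _), integral_const_mul, integral_const_mul]
    ring

lemma tendsto_mul_integral_abs_mul {ξ d : ℕ → E → ℝ} {τ : ℝ} (hξL : ∀ n, MemLp (ξ n) 2 (μ n))
    (hξ2 : Tendsto (fun n : ℕ => (n : ℝ) * ∫ e, ξ n e ^ 2 ∂μ n) atTop (𝓝 τ))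
    (hdL : ∀ᶠ n in atTop, MemLp (d n) 2 (μ n))
    (hd : Tendsto (fun n : ℕ => (n : ℝ) * ∫ e, d n e ^ 2 ∂μ n) atTop (𝓝 0)) :
    Tendsto (fun n : ℕ => (n : ℝ) * ∫ e, |ξ n e * d n e| ∂μ n) atTop (𝓝 0) := by
  refine tendsto_zero_of_forall_le_mul_add_div (fun n => ?_) hξ2 hd (fun n => ?_) ?_
  · exact mul_nonneg n.cast_nonneg (integral_nonneg fun e => abs_nonneg _)
  · exact mul_nonneg n.cast_nonneg (integral_nonneg fun e => sq_nonneg _)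
  · filter_upwards [hdL] with n hn η hη
    have i1 := (hξL n).integrable_sq
    have i2 := hn.integrable_sq
    have : ∫ e, |ξ n e * d n e| ∂μ n ≤ η * ∫ e, ξ n e ^ 2 ∂μ n + (∫ e, d n e ^ 2 ∂μ n) / η := by
      rw [← integral_const_mul, ← integral_div, ← integral_add (i1.const_mul _) (i2.div_const _)]
      exact integral_mono ((hξL n).integrable_mul hn).abs
        ((i1.const_mul _).add (i2.div_const _)) fun e => abs_mul_le_add_div hη _ _
    calc (n : ℝ) * _ ≤ n * (η * ∫ e, ξ n e ^ 2 ∂μ n + (∫ e, d n e ^ 2 ∂μ n) / η) := by gcongr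
      _ = _ := by ring

/-- Le Cam's expansion of a log-likelihood ratio with independent, identically distributed rows:
`1 + T` is the square root of the likelihood ratio of one observation and `ξ` is the score. -/
theorem tendstoInDistribution_sum_log_one_add [∀ n, IsProbabilityMeasure (μ n)]
    (hlaw : ∀ n k, HasLaw (Z n k) (μ n) P)
    (hind : ∀ n, iIndepFun (Z n) P) {ξ T : ℕ → E → ℝ} {τ : ℝ≥0} (hξm : ∀ n, Measurable (ξ n))
    (hTm : ∀ n, Measurable (T n)) (hξL : ∀ n, MemLp (ξ n) 4 (μ n))
    (hξ1 : ∀ n, ∫ e, ξ n e ∂μ n = 0)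
    (hξ2 : Tendsto (fun n : ℕ => (n : ℝ) * ∫ e, ξ n e ^ 2 ∂μ n) atTop (𝓝 τ))
    (hξ4 : Tendsto (fun n : ℕ => (n : ℝ) * ∫ e, ξ n e ^ 4 ∂μ n) atTop (𝓝 0))
    (hTL : ∀ᶠ n in atTop, MemLp (T n) 2 (μ n))
    (hT : ∀ᶠ n in atTop, ∫ e, T n e ∂μ n = -(1 / 2) * ∫ e, T n e ^ 2 ∂μ n)
    (hTξ : Tendsto (fun n : ℕ => (n : ℝ) * ∫ e, (2 * T n e - ξ n e) ^ 2 ∂μ n) atTop (𝓝 0))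
    {Y : Ω' → ℝ} (hY : HasLaw Y (gaussianReal 0 τ) P') :
    TendstoInDistribution (fun n ω => ∑ k, 2 * Real.log (1 + T n (Z n k ω))) atTop
      (fun ω => Y ω - τ / 2) (fun _ => P) P' := by
  have hξL2 : ∀ n, MemLp (ξ n) 2 (μ n) := fun n => (hξL n).mono_exponent (by norm_num)
  have hdL : ∀ᶠ n in atTop, MemLp (fun e => 2 * T n e - ξ n e) 2 (μ n) := by
    filter_upwards [hTL] with n hn
    exact (hn.const_mul 2).sub (hξL2 n)
  have hq := tendsto_mul_integral_abs_mul hξL2 hξ2 hdL hTξ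
  have hφ3 : ∀ᶠ n in atTop, Integrable (fun e => 1 / 2 * |ξ n e * (2 * T n e - ξ n e)|
      + 1 / 4 * (2 * T n e - ξ n e) ^ 2) (μ n) := by
    filter_upwards [hdL] with n hn
    exact (((hξL2 n).integrable_mul hn).abs.const_mul _).add (hn.integrable_sq.const_mul _)
  have hφ3lim : Tendsto (fun n : ℕ => (n : ℝ) * ∫ e, (1 / 2 * |ξ n e * (2 * T n e - ξ n e)|
      + 1 / 4 * (2 * T n e - ξ n e) ^ 2) ∂μ n) atTop (𝓝 0) := by
    have := (hq.const_mul (1 / 2)).add (hTξ.const_mul (1 / 4))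
    rw [mul_zero, mul_zero, add_zero] at this
    refine this.congr' ?_
    filter_upwards [hdL] with n hn
    have i1 : Integrable (fun e => |ξ n e * (2 * T n e - ξ n e)|) (μ n) :=
      ((hξL2 n).integrable_mul hn).abs
    rw [integral_add (i1.const_mul _) (hn.integrable_sq.const_mul _), integral_const_mul,
      integral_const_mul]
    ring
  have hle3 : ∀ n e, |ξ n e ^ 2 / 4 - T n e ^ 2| ≤ 1 / 2 * |ξ n e * (2 * T n e - ξ n e)|
      + 1 / 4 * (2 * T n e - ξ n e) ^ 2 := by
    intro n e
    have : ξ n e ^ 2 / 4 - T n e ^ 2 = -(1 / 2 * (ξ n e * (2 * T n e - ξ n e)))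
      + -(1 / 4 * (2 * T n e - ξ n e) ^ 2) := by ring
    rw [this]
    refine (abs_add_le _ _).trans ?_
    rw [abs_neg, abs_neg, abs_mul, abs_mul (1 / 4 : ℝ), abs_of_nonneg (sq_nonneg (_ : ℝ))]
    norm_num
  have hz3 := tendstoInMeasure_row_sum_of_abs_le hlaw (ζ := fun n e => ξ n e ^ 2 / 4 - T n e ^ 2)
    (ψ := fun _ _ => 0) hφ3 (by simp) (fun n e => by positivity) (fun _ _ => le_rfl)
    (fun n e _ => hle3 n e) hφ3lim (by simp)
  -- the squared Hellinger distances
  have hT2 : Tendsto (fun n : ℕ => (n : ℝ) * ∫ e, T n e ^ 2 ∂μ n) atTop (𝓝 (τ / 4)) := by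
    have h0 : Tendsto (fun n : ℕ => (n : ℝ) * ∫ e, (ξ n e ^ 2 / 4 - T n e ^ 2) ∂μ n) atTop (𝓝 0) := by
      refine squeeze_zero_norm' ?_ hφ3lim
      filter_upwards [hφ3] with n hn
      rw [norm_mul, Real.norm_natCast]
      gcongr
      exact norm_integral_le_of_norm_le hn (ae_of_all _ fun e => hle3 n e)
    have := (hξ2.div_const 4).sub h0
    rw [sub_zero] at this
    refine this.congr' ?_
    filter_upwards [hTL] with n hn
    rw [integral_sub ((hξL2 n).integrable_sq.div_const _) hn.integrable_sq, integral_div]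
    ring
  -- Since `ξ` is centred, the mean is that of `2T`, that is, minus the second moment of `T`. This
  -- yields the first half of the centring `-τ / 2`.
  have hz1 : TendstoInMeasure P (fun n ω => ∑ k, (2 * T n (Z n k ω) - ξ n (Z n k ω))) atTop
      (fun _ => -(τ / 4 : ℝ)) := by
    refine tendstoInMeasure_row_sum hlaw hind (ζ := fun n e => 2 * T n e - ξ n e)
      (fun n => ((hTm n).const_mul 2).sub (hξm n)) hdL hTξ ?_
    refine hT2.neg.congr' ?_
    filter_upwards [hTL, hT] with n hn hn'
    rw [integral_sub ((hn.integrable (by norm_num)).const_mul 2)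
      ((hξL2 n).integrable (by norm_num)), integral_const_mul, hξ1 n, hn']
    ring
  have hz2 : TendstoInMeasure P (fun n ω => ∑ k, -(1 / 4) * ξ n (Z n k ω) ^ 2) atTop
      (fun _ => -(1 / 4) * (τ : ℝ)) := by
    refine tendstoInMeasure_row_sum hlaw hind (ζ := fun n e => -(1 / 4) * ξ n e ^ 2)
      (fun n => ((hξm n).pow_const 2).const_mul _)
      (Eventually.of_forall fun n => (memLp_two_sq (hξL n)).const_mul _) ?_ ?_
    · have := hξ4.const_mul (1 / 16)
      rw [mul_zero] at this
      refine this.congr fun n => ?_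
      have : ∀ e, (-(1 / 4) * ξ n e ^ 2) ^ 2 = 1 / 16 * ξ n e ^ 4 := fun e => by ring
      simp_rw [this, integral_const_mul]
      ring
    · refine (hξ2.const_mul (-(1 / 4))).congr fun n => ?_
      rw [integral_const_mul]
      ring
  have hz4 := tendstoInMeasure_row_sum_comp hlaw (g := fun x => 2 * Real.log (1 + x) - 2 * x + x ^ 2)
    (by norm_num) (fun x hx => abs_two_mul_log_one_add_sub_le hx) hξL hξ2 hξ4 hdL hTξ
  have hmeas : ∀ {g : ℝ × ℝ → ℝ}, Measurable g → ∀ n,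
      AEMeasurable (fun ω => ∑ k, g (ξ n (Z n k ω), T n (Z n k ω))) P := by
    intro g hg n
    refine Finset.aemeasurable_fun_sum _ fun k _ => hg.comp_aemeasurable ?_
    exact ((hξm n).comp_aemeasurable (hlaw n k).aemeasurable).prodMk
      ((hTm n).comp_aemeasurable (hlaw n k).aemeasurable)
  have hclt := tendstoInDistribution_row_sum hlaw hind hξm hξL hξ1 hξ2 hξ4 hY
  -- The terms `ξ`, `2T - ξ`, `-ξ² / 4`, `ξ² / 4 - T²` and the logarithmic remainder add up to `2
  -- log (1 + T)`. The second and third each contribute `-τ / 4`, the last two nothing.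
  have s1 := hclt.add_of_tendstoInMeasure_const hz1 (hmeas (g := fun p => 2 * p.2 - p.1) (by fun_prop))
  have s2 := s1.add_of_tendstoInMeasure_const hz2
    (hmeas (g := fun p => -(1 / 4) * p.1 ^ 2) (by fun_prop))
  have s3 := s2.add_of_tendstoInMeasure_const hz3
    (hmeas (g := fun p => p.1 ^ 2 / 4 - p.2 ^ 2) (by fun_prop))
  have s4 := s3.add_of_tendstoInMeasure_const hz4
    (hmeas (g := fun p => 2 * Real.log (1 + p.2) - 2 * p.2 + p.2 ^ 2) (by fun_prop))
  refine s4.congr (fun n => ae_of_all _ fun ω => ?_) (ae_of_all _ fun ω => ?_)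
  · simp only [Pi.add_apply, ← Finset.sum_add_distrib]
    exact Finset.sum_congr rfl fun k _ => by ring
  · ring

end LocalAsymptoticNormality

/-! ### Hellinger differentiability under marginalization -/

section Marginal

variable {E F : Type*} [MeasurableSpace E] [MeasurableSpace F] {m : Measure E}

lemma lintegral_sq_eq_one_of_withDensity {q : E → ℝ}
    (h : IsProbabilityMeasure (m.withDensity fun e => ENNReal.ofReal (q e ^ 2))) :
    ∫⁻ e, ENNReal.ofReal (q e ^ 2) ∂m = 1 := by
  have := h.measure_univ
  rwa [withDensity_apply _ MeasurableSet.univ, setLIntegral_univ] at this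

lemma memLp_two_of_withDensity_sq {q : E → ℝ} (hq : Measurable q)
    (h : IsProbabilityMeasure (m.withDensity fun e => ENNReal.ofReal (q e ^ 2))) :
    MemLp q 2 m := by
  refine (memLp_two_iff_integrable_sq hq.aestronglyMeasurable).2 ⟨by fun_prop, ?_⟩
  rw [hasFiniteIntegral_iff_ofReal (ae_of_all _ fun e => sq_nonneg (q e)),
    lintegral_sq_eq_one_of_withDensity h]
  exact ENNReal.one_lt_top

lemma integral_sq_eq_one_of_withDensity {q : E → ℝ} (hq : Measurable q)
    (h : IsProbabilityMeasure (m.withDensity fun e => ENNReal.ofReal (q e ^ 2))) :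
    ∫ e, q e ^ 2 ∂m = 1 := by
  rw [integral_eq_lintegral_of_nonneg_ae (ae_of_all _ fun e => sq_nonneg (q e)) (by fun_prop),
    lintegral_sq_eq_one_of_withDensity h, ENNReal.toReal_one]

/-- The affinity with a function of the marginal can only increase under marginalization. -/
lemma integral_mul_comp_le {q : E → ℝ} {R h : F → ℝ} {p : E → F} (hp : Measurable p)
    (hq : Measurable q) (hq0 : ∀ e, 0 ≤ q e) (hR : Measurable R)
    (hR0 : ∀ᵐ y ∂m.map p, 0 < R y) (hh : Measurable h) (hh0 : ∀ y, 0 ≤ h y)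
    (heq : (m.withDensity fun e => ENNReal.ofReal (q e ^ 2)).map p
      = (m.map p).withDensity fun y => ENNReal.ofReal (R y ^ 2))
    (hi : Integrable (fun e => R (p e) * h (p e)) m) :
    ∫ e, q e * h (p e) ∂m ≤ ∫ e, R (p e) * h (p e) ∂m := by
  have hR0' : ∀ᵐ e ∂m, 0 < R (p e) := ae_of_ae_map hp.aemeasurable hR0
  -- With weight `h / R`, the arithmetic-geometric mean gives `q h ≤ q² h / (2R) + R h / 2`. Both
  -- halves have the same integral because `R²` is the density of the image law. This replaces
  -- conditional expectations and Jensen's inequality.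
  have key : ∫⁻ e, ENNReal.ofReal (q e ^ 2) * ENNReal.ofReal (h (p e) / R (p e)) ∂m
      = ∫⁻ e, ENNReal.ofReal (R (p e) * h (p e)) ∂m := by
    have hg : Measurable fun y => ENNReal.ofReal (h y / R y) := by fun_prop
    calc ∫⁻ e, ENNReal.ofReal (q e ^ 2) * ENNReal.ofReal (h (p e) / R (p e)) ∂m
        = ∫⁻ e, ENNReal.ofReal (h (p e) / R (p e))
            ∂(m.withDensity fun e => ENNReal.ofReal (q e ^ 2)) := by
          rw [lintegral_withDensity_eq_lintegral_mul _ (by fun_prop)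
            (show Measurable fun e => ENNReal.ofReal (h (p e) / R (p e)) from hg.comp hp)]
          rfl
      _ = ∫⁻ y, ENNReal.ofReal (h y / R y)
            ∂((m.withDensity fun e => ENNReal.ofReal (q e ^ 2)).map p) :=
          (lintegral_map hg hp).symm
      _ = ∫⁻ y, ENNReal.ofReal (R y ^ 2) * ENNReal.ofReal (h y / R y) ∂m.map p := by
          rw [heq, lintegral_withDensity_eq_lintegral_mul _ (by fun_prop) hg]
          rfl
      _ = ∫⁻ y, ENNReal.ofReal (R y * h y) ∂m.map p := by
          refine lintegral_congr_ae ?_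
          filter_upwards [hR0] with y hy
          rw [← ENNReal.ofReal_mul (sq_nonneg _)]
          congr 1
          field_simp
      _ = _ := lintegral_map (by fun_prop) hp
  have hRh : 0 ≤ᵐ[m] fun e => R (p e) * h (p e) := by
    filter_upwards [hR0'] with e he
    exact mul_nonneg he.le (hh0 _)
  rw [integral_eq_lintegral_of_nonneg_ae
      (ae_of_all _ fun e => mul_nonneg (hq0 e) (hh0 (p e))) (by fun_prop),
    integral_eq_lintegral_of_nonneg_ae hRh (by fun_prop)]
  refine ENNReal.toReal_mono ?_ ?_
  · have := hi.2
    rw [hasFiniteIntegral_iff_ofReal hRh] at this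
    exact this.ne
  · have hle : ∀ᵐ e ∂m, ENNReal.ofReal (q e * h (p e))
        ≤ 2⁻¹ * (ENNReal.ofReal (q e ^ 2) * ENNReal.ofReal (h (p e) / R (p e)))
          + 2⁻¹ * ENNReal.ofReal (R (p e) * h (p e)) := by
      filter_upwards [hR0'] with e he
      have h2 : (2⁻¹ : ℝ≥0∞) = ENNReal.ofReal (1 / 2) := by
        rw [one_div, ENNReal.ofReal_inv_of_pos (by norm_num)]
        norm_num
      rw [← ENNReal.ofReal_mul (sq_nonneg _), h2, ← ENNReal.ofReal_mul (by norm_num),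
        ← ENNReal.ofReal_mul (by norm_num), ← ENNReal.ofReal_add]
      · refine ENNReal.ofReal_le_ofReal ?_
        have : 1 / 2 * (q e ^ 2 * (h (p e) / R (p e))) + 1 / 2 * (R (p e) * h (p e))
            - q e * h (p e) = 1 / 2 * (h (p e) / R (p e)) * (q e - R (p e)) ^ 2 := by
          field_simp
          ring
        have h3 : 0 ≤ 1 / 2 * (h (p e) / R (p e)) * (q e - R (p e)) ^ 2 := by
          have := div_nonneg (hh0 (p e)) he.le
          positivity
        linarith
      · have := div_nonneg (hh0 (p e)) he.le
        positivity
      · have := mul_nonneg he.le (hh0 (p e))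
        positivity
    refine (lintegral_mono_ae hle).trans ?_
    rw [lintegral_add_left (by fun_prop), lintegral_const_mul _ (by fun_prop),
      lintegral_const_mul _ (by fun_prop), key, ← add_mul, ENNReal.inv_two_add_inv_two, one_mul]

variable {q : E → ℝ} {R : F → ℝ} {p : E → F}

lemma isProbabilityMeasure_withDensity_marginal (hp : Measurable p)
    (hq1 : IsProbabilityMeasure (m.withDensity fun e => ENNReal.ofReal (q e ^ 2)))
    (heq : (m.withDensity fun e => ENNReal.ofReal (q e ^ 2)).map p
      = (m.map p).withDensity fun y => ENNReal.ofReal (R y ^ 2)) :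
    IsProbabilityMeasure ((m.map p).withDensity fun y => ENNReal.ofReal (R y ^ 2)) := by
  rw [← heq]
  exact Measure.isProbabilityMeasure_map hp.aemeasurable

/-- Square roots of likelihood ratios of a marginal are at least as close to a function of the
marginal as those of the full experiment. -/
lemma integral_sub_comp_sq_le {h : F → ℝ} (hp : Measurable p)
    (hq : Measurable q) (hq0 : ∀ e, 0 ≤ q e) (hR : Measurable R)
    (hR0 : ∀ᵐ y ∂m.map p, 0 < R y) (hh : Measurable h) (hh0 : ∀ y, 0 ≤ h y)
    (hq1 : IsProbabilityMeasure (m.withDensity fun e => ENNReal.ofReal (q e ^ 2)))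
    (heq : (m.withDensity fun e => ENNReal.ofReal (q e ^ 2)).map p
      = (m.map p).withDensity fun y => ENNReal.ofReal (R y ^ 2))
    (hhL : MemLp (fun e => h (p e)) 2 m) :
    ∫ e, (R (p e) - h (p e)) ^ 2 ∂m ≤ ∫ e, (q e - h (p e)) ^ 2 ∂m := by
  have hR1 := isProbabilityMeasure_withDensity_marginal hp hq1 heq
  have hqL := memLp_two_of_withDensity_sq hq hq1
  have hRL : MemLp (fun e => R (p e)) 2 m :=
    (memLp_two_of_withDensity_sq hR hR1).comp_of_map hp.aemeasurable
  have hR2 : ∫ e, R (p e) ^ 2 ∂m = 1 := by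
    rw [← integral_sq_eq_one_of_withDensity hR hR1, integral_map hp.aemeasurable (by fun_prop)]
  -- Both `R ∘ p` and `q` have unit second moment, so comparing distances to `h ∘ p` amounts to
  -- comparing affinities.
  have hle := integral_mul_comp_le hp hq hq0 hR hR0 hh hh0 heq (hRL.integrable_mul hhL)
  have expand : ∀ {f : E → ℝ}, MemLp f 2 m → ∫ e, (f e - h (p e)) ^ 2 ∂m
      = ∫ e, f e ^ 2 ∂m + ∫ e, h (p e) ^ 2 ∂m - 2 * ∫ e, f e * h (p e) ∂m := by
    intro f hf
    have i3 : Integrable (fun e => f e * h (p e)) m := hf.integrable_mul hhL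
    have i12 : Integrable (fun e => f e ^ 2 + h (p e) ^ 2) m :=
      hf.integrable_sq.add hhL.integrable_sq
    rw [← integral_add hf.integrable_sq hhL.integrable_sq, ← integral_const_mul,
      ← integral_sub i12 (i3.const_mul 2)]
    exact integral_congr_ae (ae_of_all _ fun e => by ring)
  rw [expand hRL, expand hqL, hR2, integral_sq_eq_one_of_withDensity hq hq1]
  linarith

variable [IsProbabilityMeasure m]

/-- Hellinger differentiability is inherited by a marginal that almost determines the score. -/
theorem integral_marginal_score_sq_le {s : E → ℝ} {t : F → ℝ} (hp : Measurable p)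
    (hq : Measurable q) (hq0 : ∀ e, 0 ≤ q e) (hR : Measurable R)
    (hR0 : ∀ᵐ y ∂m.map p, 0 < R y) (ht : Measurable t) (hs : MemLp s 2 m)
    (hst : MemLp (fun e => s e - t (p e)) 2 m)
    (hq1 : IsProbabilityMeasure (m.withDensity fun e => ENNReal.ofReal (q e ^ 2)))
    (heq : (m.withDensity fun e => ENNReal.ofReal (q e ^ 2)).map p
      = (m.map p).withDensity fun y => ENNReal.ofReal (R y ^ 2)) :
    ∫ e, (2 * (R (p e) - 1) - s e) ^ 2 ∂m
      ≤ 15 * ∫ e, (2 * (q e - 1) - s e) ^ 2 ∂m + 12 * ∫ e, (s e - t (p e)) ^ 2 ∂m := by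
  have hR1 := isProbabilityMeasure_withDensity_marginal hp hq1 heq
  have hqL := memLp_two_of_withDensity_sq hq hq1
  have hRL : MemLp (fun e => R (p e)) 2 m :=
    (memLp_two_of_withDensity_sq hR hR1).comp_of_map hp.aemeasurable
  -- The score `t` predicts `1 + t / 2` for the square root of the ratio. The comparison needs a
  -- nonnegative function, and truncating at zero only brings it closer to `q ≥ 0`.
  set h : F → ℝ := fun y => max (1 + t y / 2) 0 with hh
  have hhm : Measurable h := by fun_prop
  have hhL : MemLp (fun e => h (p e)) 2 m := by
    have htL : MemLp (fun e => t (p e)) 2 m := by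
      have := hs.sub hst
      refine this.ae_eq (ae_of_all _ fun e => ?_)
      simp
    have : MemLp (fun e => 1 + t (p e) / 2) 2 m := by
      have := (memLp_const (1 : ℝ) (p := 2) (μ := m)).add (htL.const_mul (1 / 2))
      refine this.ae_eq (ae_of_all _ fun e => ?_)
      simp only [Pi.add_apply]
      ring
    refine this.mono (hhm.comp hp).aestronglyMeasurable (ae_of_all _ fun e => ?_)
    simp only [hh, Real.norm_eq_abs]
    rw [abs_of_nonneg (le_max_right _ _)]
    exact max_le (le_abs_self _) (abs_nonneg _)
  have hmain := integral_sub_comp_sq_le hp hq hq0 hR hR0 hhm (fun y => le_max_right _ _) hq1 heq hhL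
  have hAL : MemLp (fun e => 2 * (q e - 1) - s e) 2 m :=
    ((hqL.sub (memLp_const 1)).const_mul 2).sub hs
  have iA := hAL.integrable_sq
  have iB := hst.integrable_sq
  have iq : Integrable (fun e => (q e - h (p e)) ^ 2) m := (hqL.sub hhL).integrable_sq
  have iR : Integrable (fun e => (R (p e) - h (p e)) ^ 2) m := (hRL.sub hhL).integrable_sq
  have iRq : Integrable (fun e => 12 * (R (p e) - h (p e)) ^ 2 + 12 * (q e - h (p e)) ^ 2) m :=
    (iR.const_mul 12).add (iq.const_mul 12)
  have hqh : ∀ e, (q e - h (p e)) ^ 2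
      ≤ 1 / 2 * (2 * (q e - 1) - s e) ^ 2 + 1 / 2 * (s e - t (p e)) ^ 2 := by
    intro e
    have h1 : (q e - h (p e)) ^ 2 ≤ (q e - (1 + t (p e) / 2)) ^ 2 := by
      simp only [hh]
      rcases le_total 0 (1 + t (p e) / 2) with h0 | h0
      · rw [max_eq_left h0]
      · rw [max_eq_right h0]
        have := hq0 e
        exact pow_le_pow_left₀ (by linarith) (by linarith) 2
    nlinarith [sq_nonneg (2 * (q e - 1) - s e - (s e - t (p e)))]
  have hI : ∫ e, (q e - h (p e)) ^ 2 ∂m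
      ≤ 1 / 2 * ∫ e, (2 * (q e - 1) - s e) ^ 2 ∂m + 1 / 2 * ∫ e, (s e - t (p e)) ^ 2 ∂m := by
    rw [← integral_const_mul, ← integral_const_mul, ← integral_add (iA.const_mul _) (iB.const_mul _)]
    exact integral_mono iq ((iA.const_mul _).add (iB.const_mul _)) hqh
  -- The integrand is the square of `2(R - h) + 2(h - q) + (2(q - 1) - s)`, and `(a + b + c)² ≤ 3(a²
  -- + b² + c²)`. Bounding `R - h` by `q - h` and using `hI` turns `12, 12, 3` into `15, 12`.
  have hfin : ∫ e, (2 * (R (p e) - 1) - s e) ^ 2 ∂m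
      ≤ ∫ e, (12 * (R (p e) - h (p e)) ^ 2 + 12 * (q e - h (p e)) ^ 2
        + 3 * (2 * (q e - 1) - s e) ^ 2) ∂m := by
    refine integral_mono_of_nonneg (ae_of_all _ fun e => sq_nonneg _)
      (iRq.add (iA.const_mul 3)) (ae_of_all _ fun e => ?_)
    simp only
    nlinarith [sq_nonneg (2 * (R (p e) - h (p e)) - 2 * (h (p e) - q e)),
      sq_nonneg (2 * (R (p e) - h (p e)) - (2 * (q e - 1) - s e)),
      sq_nonneg (2 * (h (p e) - q e) - (2 * (q e - 1) - s e))]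
  have e3 : ∫ e, (12 * (R (p e) - h (p e)) ^ 2 + 12 * (q e - h (p e)) ^ 2
        + 3 * (2 * (q e - 1) - s e) ^ 2) ∂m = 12 * ∫ e, (R (p e) - h (p e)) ^ 2 ∂m
        + 12 * ∫ e, (q e - h (p e)) ^ 2 ∂m + 3 * ∫ e, (2 * (q e - 1) - s e) ^ 2 ∂m := by
    rw [← integral_const_mul, ← integral_const_mul, ← integral_const_mul,
      ← integral_add (iR.const_mul 12) (iq.const_mul 12),
      ← integral_add iRq (iA.const_mul 3)]
  rw [e3] at hfin
  linarith

/-- The mean of `√L - 1`, where `L` is a likelihood ratio, is minus half its second moment. -/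
lemma integral_sqrt_sub_one {T : E → ℝ} (hT : MemLp T 2 m) (h1 : ∫ e, (1 + T e) ^ 2 ∂m = 1) :
    ∫ e, T e ∂m = -(1 / 2) * ∫ e, T e ^ 2 ∂m := by
  have i1 : Integrable T m := hT.integrable (by norm_num)
  have : ∫ e, (1 + T e) ^ 2 ∂m = 1 + 2 * ∫ e, T e ∂m + ∫ e, T e ^ 2 ∂m := by
    have e1 : ∫ _ : E, (1 : ℝ) ∂m = 1 := by simp
    nth_rewrite 2 [← e1]
    have i12 : Integrable (fun e => 1 + 2 * T e) m := (integrable_const _).add (i1.const_mul 2)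
    rw [← integral_const_mul, ← integral_add (integrable_const _) (i1.const_mul 2),
      ← integral_add i12 hT.integrable_sq]
    exact integral_congr_ae (ae_of_all _ fun e => by ring)
  linarith

end Marginal

/-! ### The Gaussian location-scale experiment -/

section GaussianShift

lemma memLp_id_stdGaussian (p : ℝ≥0) : MemLp (fun x : ℝ => x) p (gaussianReal 0 1) :=
  memLp_id_gaussianReal p

/-- At zero these derivatives of the moment generating function give the Gaussian moments up to
order four, which the square of a quadratic score involves. -/
lemma iteratedDeriv_exp_half_sq :
    (∀ t : ℝ, iteratedDeriv 1 (fun t : ℝ => Real.exp (t ^ 2 / 2)) t = t * Real.exp (t ^ 2 / 2)) ∧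
    (∀ t : ℝ, iteratedDeriv 2 (fun t : ℝ => Real.exp (t ^ 2 / 2)) t
      = (1 + t ^ 2) * Real.exp (t ^ 2 / 2)) ∧
    (∀ t : ℝ, iteratedDeriv 3 (fun t : ℝ => Real.exp (t ^ 2 / 2)) t
      = (3 * t + t ^ 3) * Real.exp (t ^ 2 / 2)) ∧
    (∀ t : ℝ, iteratedDeriv 4 (fun t : ℝ => Real.exp (t ^ 2 / 2)) t
      = (3 + 6 * t ^ 2 + t ^ 4) * Real.exp (t ^ 2 / 2)) := by
  have he : ∀ t : ℝ, HasDerivAt (fun t : ℝ => Real.exp (t ^ 2 / 2)) (t * Real.exp (t ^ 2 / 2)) t := by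
    intro t
    have := (((hasDerivAt_id t).pow 2).div_const 2).exp
    refine this.congr_deriv ?_
    simp
    ring
  have step : ∀ {p : ℝ → ℝ} {p' t : ℝ}, HasDerivAt p p' t →
      HasDerivAt (fun t : ℝ => p t * Real.exp (t ^ 2 / 2)) ((p' + t * p t) * Real.exp (t ^ 2 / 2)) t := by
    intro p p' t hp
    exact (hp.mul (he t)).congr_deriv (by ring)
  have h1 : ∀ t : ℝ, iteratedDeriv 1 (fun t : ℝ => Real.exp (t ^ 2 / 2)) t
      = t * Real.exp (t ^ 2 / 2) := fun t => by rw [iteratedDeriv_one]; exact (he t).deriv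
  have h2 : ∀ t : ℝ, iteratedDeriv 2 (fun t : ℝ => Real.exp (t ^ 2 / 2)) t
      = (1 + t ^ 2) * Real.exp (t ^ 2 / 2) := fun t => by
    rw [iteratedDeriv_succ, funext h1]
    exact ((step (p := fun t => t) (hasDerivAt_id t)).congr_deriv (by ring)).deriv
  have h3 : ∀ t : ℝ, iteratedDeriv 3 (fun t : ℝ => Real.exp (t ^ 2 / 2)) t
      = (3 * t + t ^ 3) * Real.exp (t ^ 2 / 2) := fun t => by
    rw [iteratedDeriv_succ, funext h2]
    exact ((step (p := fun t => 1 + t ^ 2) ((hasDerivAt_pow 2 t).const_add 1)).congr_deriv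
      (by norm_num; ring)).deriv
  have h4 : ∀ t : ℝ, iteratedDeriv 4 (fun t : ℝ => Real.exp (t ^ 2 / 2)) t
      = (3 + 6 * t ^ 2 + t ^ 4) * Real.exp (t ^ 2 / 2) := fun t => by
    rw [iteratedDeriv_succ, funext h3]
    exact ((step (p := fun t => 3 * t + t ^ 3)
      (((hasDerivAt_id t).const_mul 3).add (hasDerivAt_pow 3 t))).congr_deriv
      (by norm_num; ring)).deriv
  exact ⟨h1, h2, h3, h4⟩

lemma integral_pow_stdGaussian (k : ℕ) :
    ∫ x, x ^ k ∂gaussianReal 0 1 = iteratedDeriv k (fun t : ℝ => Real.exp (t ^ 2 / 2)) 0 := by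
  have h := iteratedDeriv_mgf_zero (X := fun x : ℝ => x) (μ := gaussianReal 0 1)
    (by rw [integrableExpSet_fun_id_gaussianReal, interior_univ]; trivial) k
  rw [mgf_fun_id_gaussianReal] at h
  simpa using h.symm

lemma integral_id_stdGaussian : ∫ x, x ∂gaussianReal 0 1 = 0 := integral_id_gaussianReal

lemma integral_sq_stdGaussian : ∫ x, x ^ 2 ∂gaussianReal 0 1 = 1 := by
  rw [integral_pow_stdGaussian, iteratedDeriv_exp_half_sq.2.1]; simp

lemma integral_pow_three_stdGaussian : ∫ x, x ^ 3 ∂gaussianReal 0 1 = 0 := by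
  rw [integral_pow_stdGaussian, iteratedDeriv_exp_half_sq.2.2.1]; simp

lemma integral_pow_four_stdGaussian : ∫ x, x ^ 4 ∂gaussianReal 0 1 = 3 := by
  rw [integral_pow_stdGaussian, iteratedDeriv_exp_half_sq.2.2.2]; simp

lemma integrable_pow_stdGaussian (k : ℕ) : Integrable (fun x : ℝ => x ^ k) (gaussianReal 0 1) := by
  have h := (memLp_id_stdGaussian k).integrable_norm_pow'
  refine (integrable_norm_iff (by fun_prop)).1 (h.congr (ae_of_all _ fun x => ?_))
  simp

/-- The score of the location-scale Gaussian model at the standard Gaussian law. -/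
noncomputable def gaussianScore (α β x : ℝ) : ℝ := α * x + β * (x ^ 2 - 1)

lemma measurable_gaussianScore (α β : ℝ) : Measurable (gaussianScore α β) := by
  unfold gaussianScore; fun_prop

lemma memLp_four_gaussianScore (α β : ℝ) : MemLp (gaussianScore α β) 4 (gaussianReal 0 1) := by
  have h2 : MemLp (fun x : ℝ => x ^ 2) 4 (gaussianReal 0 1) := by
    refine (integrable_norm_rpow_iff (by fun_prop) (by norm_num) (by norm_num)).1 ?_
    refine (integrable_pow_stdGaussian 8).congr (ae_of_all _ fun x => ?_)
    have e : (4 : ℝ≥0∞).toReal = ((4 : ℕ) : ℝ) := by norm_num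
    change x ^ 8 = ‖x ^ 2‖ ^ (4 : ℝ≥0∞).toReal
    rw [e, Real.rpow_natCast, Real.norm_eq_abs, Even.pow_abs (by decide)]
    ring
  exact ((memLp_id_stdGaussian 4).const_mul α).add ((h2.sub (memLp_const 1)).const_mul β)

lemma integral_gaussianScore (α β : ℝ) : ∫ x, gaussianScore α β x ∂gaussianReal 0 1 = 0 := by
  have i1 : Integrable (fun x : ℝ => x) (gaussianReal 0 1) := by
    simpa using integrable_pow_stdGaussian 1
  have i2 := integrable_pow_stdGaussian 2
  have i3 : Integrable (fun x : ℝ => x ^ 2 - 1) (gaussianReal 0 1) := i2.sub (integrable_const _)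
  unfold gaussianScore
  rw [integral_add (i1.const_mul _) (i3.const_mul _), integral_const_mul, integral_const_mul,
    integral_sub i2 (integrable_const _), integral_id_stdGaussian, integral_sq_stdGaussian]
  simp

lemma integral_gaussianScore_sq (α β : ℝ) :
    ∫ x, gaussianScore α β x ^ 2 ∂gaussianReal 0 1 = α ^ 2 + 2 * β ^ 2 := by
  have i1 : Integrable (fun x : ℝ => -2 * α * β * x) (gaussianReal 0 1) := by
    simpa using (integrable_pow_stdGaussian 1).const_mul (-2 * α * β)
  have i2 := (integrable_pow_stdGaussian 2).const_mul (α ^ 2 - 2 * β ^ 2)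
  have i3 := (integrable_pow_stdGaussian 3).const_mul (2 * α * β)
  have i4 := (integrable_pow_stdGaussian 4).const_mul (β ^ 2)
  have i0 : Integrable (fun _ : ℝ => β ^ 2) (gaussianReal 0 1) := integrable_const _
  have e : ∀ x, gaussianScore α β x ^ 2 = β ^ 2 + (-2 * α * β * x + ((α ^ 2 - 2 * β ^ 2) * x ^ 2
      + (2 * α * β * x ^ 3 + β ^ 2 * x ^ 4))) := fun x => by unfold gaussianScore; ring
  have i34 : Integrable (fun x : ℝ => 2 * α * β * x ^ 3 + β ^ 2 * x ^ 4) (gaussianReal 0 1) :=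
    i3.add i4
  have i234 : Integrable (fun x : ℝ => (α ^ 2 - 2 * β ^ 2) * x ^ 2
      + (2 * α * β * x ^ 3 + β ^ 2 * x ^ 4)) (gaussianReal 0 1) := i2.add i34
  have i1234 : Integrable (fun x : ℝ => -2 * α * β * x + ((α ^ 2 - 2 * β ^ 2) * x ^ 2
      + (2 * α * β * x ^ 3 + β ^ 2 * x ^ 4))) (gaussianReal 0 1) := i1.add i234
  simp_rw [e]
  rw [integral_add i0 i1234, integral_add i1 i234, integral_add i2 i34, integral_add i3 i4]
  rw [integral_const_mul (-2 * α * β), integral_id_stdGaussian]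
  simp only [integral_const_mul, integral_sq_stdGaussian,
    integral_pow_three_stdGaussian, integral_pow_four_stdGaussian, integral_const, smul_eq_mul,
    probReal_univ]
  ring

/-- The log-likelihood ratio of `N(α h, (1 + β h)²)` with respect to `N(0, 1)`. -/
noncomputable def gaussianLogRatio (α β h x : ℝ) : ℝ :=
  -Real.log (1 + β * h) + (x ^ 2 / 2 - (x - α * h) ^ 2 / (2 * (1 + β * h) ^ 2))

lemma measurable_gaussianLogRatio (α β h : ℝ) : Measurable (gaussianLogRatio α β h) := by
  unfold gaussianLogRatio; fun_prop

lemma withDensity_gaussianLogRatio (α : ℝ) {β h : ℝ} (hs : 0 < 1 + β * h) :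
    (gaussianReal 0 1).withDensity
      (fun x => ENNReal.ofReal (Real.exp (gaussianLogRatio α β h x / 2) ^ 2))
      = gaussianReal (α * h) (Real.toNNReal (1 + β * h) ^ 2) := by
  have hv : Real.toNNReal (1 + β * h) ^ 2 ≠ 0 := by
    have := Real.toNNReal_pos.2 hs
    positivity
  have hm := measurable_gaussianLogRatio α β h
  rw [gaussianReal_of_var_ne_zero _ one_ne_zero, gaussianReal_of_var_ne_zero _ hv,
    ← withDensity_mul _ (by fun_prop) (by fun_prop)]
  congr 1
  ext x
  simp only [Pi.mul_apply, gaussianPDF]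
  rw [← ENNReal.ofReal_mul (gaussianPDFReal_nonneg _ _ _)]
  congr 1
  have e1 : Real.exp (gaussianLogRatio α β h x / 2) ^ 2 = Real.exp (gaussianLogRatio α β h x) := by
    rw [← Real.exp_nat_mul]
    congr 1
    push_cast
    ring
  rw [e1, gaussianLogRatio, Real.exp_add, Real.exp_neg, Real.exp_log hs]
  simp only [gaussianPDFReal, NNReal.coe_one, NNReal.coe_pow, Real.coe_toNNReal _ hs.le, mul_one,
    sub_zero]
  rw [Real.sqrt_mul (by positivity) ((1 + β * h) ^ 2), Real.sqrt_sq hs.le, mul_inv]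
  have e2 : Real.exp (-(x - α * h) ^ 2 / (2 * (1 + β * h) ^ 2))
      = Real.exp (-x ^ 2 / 2) * Real.exp (x ^ 2 / 2 - (x - α * h) ^ 2 / (2 * (1 + β * h) ^ 2)) := by
    rw [← Real.exp_add]
    congr 1
    ring
  rw [e2]
  ring

lemma abs_exp_sub_one_le_mul_exp (y : ℝ) : |Real.exp y - 1| ≤ |y| * Real.exp |y| := by
  rcases le_total 0 y with h | h
  · rw [abs_of_nonneg h, abs_of_nonneg (by linarith [Real.add_one_le_exp y])]
    have := Real.add_one_le_exp (-y)
    have h2 : Real.exp (-y) * Real.exp y = 1 := by rw [← Real.exp_add]; simp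
    nlinarith [Real.exp_pos y]
  · have h1 : Real.exp y ≤ 1 := Real.exp_le_one_iff.2 h
    rw [abs_of_nonpos h, abs_of_nonpos (by linarith)]
    have := Real.add_one_le_exp y
    have h2 : 1 ≤ Real.exp (-y) := Real.one_le_exp (by linarith)
    nlinarith

lemma abs_log_one_add_le {y : ℝ} (hy : |y| ≤ 1 / 2) : |Real.log (1 + y)| ≤ 2 * |y| := by
  have h := Real.abs_log_sub_add_sum_range_le (x := -y) (by rw [abs_neg]; linarith) 0
  simp only [Finset.range_zero, Finset.sum_empty, zero_add, sub_neg_eq_add, abs_neg, pow_one] at h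
  refine h.trans ?_
  rw [div_le_iff₀ (by linarith)]
  nlinarith [abs_nonneg y]

/-- The log ratio vanishes at `h = 0` and grows at most quadratically in `x`, while `|β * h| ≤ 1 /
2` keeps the scale away from zero. The linear factor `h` survives the division by `h` in the
difference quotient. -/
lemma abs_gaussianLogRatio_le {α β h : ℝ} (x : ℝ) (h0 : 0 ≤ h) (h1 : h ≤ 1)
    (hβ : |β * h| ≤ 1 / 2) :
    |gaussianLogRatio α β h x| ≤ (7 * |β| + 2 * |α| + 2 * α ^ 2) * h * (1 + x ^ 2) := by
  have hb := abs_le.1 hβ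
  have hs : 1 / 2 ≤ 1 + β * h := by linarith
  have hlog := abs_log_one_add_le hβ
  have hβh : |β * h| = |β| * h := by rw [abs_mul, abs_of_nonneg h0]
  have e : x ^ 2 / 2 - (x - α * h) ^ 2 / (2 * (1 + β * h) ^ 2)
      = (β * h * (2 + β * h) * x ^ 2 + 2 * (α * x) * h - α ^ 2 * h ^ 2)
        / (2 * (1 + β * h) ^ 2) := by
    have h2 : 2 * (1 + β * h) ^ 2 ≠ 0 := by
      have : 1 + β * h ≠ 0 := by linarith
      positivity
    rw [eq_div_iff h2, sub_mul, div_mul_cancel₀ _ h2]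
    ring
  have hnum : |β * h * (2 + β * h) * x ^ 2 + 2 * (α * x) * h - α ^ 2 * h ^ 2|
      ≤ 5 / 2 * (|β| * h) * x ^ 2 + |α| * h * (1 + x ^ 2) + α ^ 2 * h := by
    refine (abs_sub _ _).trans (add_le_add ((abs_add_le _ _).trans (add_le_add ?_ ?_)) ?_)
    · rw [abs_mul, abs_mul, hβh, abs_of_nonneg (sq_nonneg x)]
      have : |2 + β * h| ≤ 5 / 2 := abs_le.2 ⟨by linarith, by linarith⟩
      have h3 : 0 ≤ |β| * h := by positivity
      nlinarith [mul_le_mul_of_nonneg_left this h3, sq_nonneg x]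
    · rw [abs_mul, abs_mul, abs_mul, abs_of_nonneg h0, abs_two]
      have h3 : 0 ≤ |α| * h := by positivity
      have : 2 * |x| ≤ 1 + x ^ 2 := by rw [← sq_abs x]; nlinarith [sq_nonneg (|x| - 1)]
      nlinarith
    · rw [abs_of_nonneg (by positivity)]
      have : h ^ 2 ≤ h := by nlinarith
      exact mul_le_mul_of_nonneg_left this (sq_nonneg α)
  have hden : 1 / 2 ≤ 2 * (1 + β * h) ^ 2 := by nlinarith
  rw [gaussianLogRatio, e]
  refine (abs_add_le _ _).trans ?_
  rw [abs_neg, abs_div, abs_of_pos (by linarith : 0 < 2 * (1 + β * h) ^ 2)]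
  have hdiv : |β * h * (2 + β * h) * x ^ 2 + 2 * (α * x) * h - α ^ 2 * h ^ 2|
      / (2 * (1 + β * h) ^ 2)
      ≤ 2 * (5 / 2 * (|β| * h) * x ^ 2 + |α| * h * (1 + x ^ 2) + α ^ 2 * h) := by
    rw [div_le_iff₀ (by linarith)]
    nlinarith [abs_nonneg (β * h * (2 + β * h) * x ^ 2 + 2 * (α * x) * h - α ^ 2 * h ^ 2)]
  rw [hβh] at hlog
  have g1 : 0 ≤ |β| * h * x ^ 2 := by positivity
  have g2 : 0 ≤ |β| * h := by positivity
  have g3 : 0 ≤ α ^ 2 * h * x ^ 2 := by positivity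
  nlinarith

/-- Twice the square root of a likelihood ratio that equals one has the score as derivative; this is
the pointwise half of Hellinger differentiability. -/
lemma hasDerivAt_exp_gaussianLogRatio (α β x : ℝ) :
    HasDerivAt (fun h => 2 * Real.exp (gaussianLogRatio α β h x / 2)) (gaussianScore α β x) 0 := by
  have hlin : ∀ a b : ℝ, HasDerivAt (fun h : ℝ => b + a * h) a 0 := fun a b => by
    simpa using ((hasDerivAt_id (0 : ℝ)).const_mul a).const_add b
  have hlog : HasDerivAt (fun h : ℝ => Real.log (1 + β * h)) β 0 := by
    have := (hlin β 1).log (by simp)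
    simpa using this
  have hnum : HasDerivAt (fun h : ℝ => (x - α * h) ^ 2) (-2 * α * x) 0 := by
    have := (hlin (-α) x).pow 2
    simp only [neg_mul, ← sub_eq_add_neg, mul_zero] at this
    refine this.congr_deriv ?_
    norm_num
    ring
  have hden : HasDerivAt (fun h : ℝ => 2 * (1 + β * h) ^ 2) (4 * β) 0 := by
    have := ((hlin β 1).pow 2).const_mul 2
    refine this.congr_deriv ?_
    norm_num
    ring
  have hquot := hnum.div hden (by simp)
  have h := ((hlog.neg.add (hquot.const_sub (x ^ 2 / 2))).div_const 2).exp.const_mul 2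
  refine h.congr_deriv ?_
  simp [gaussianScore]
  ring

/-- The exponent `1 / 4` is below the `1 / 2` of the Gaussian density, leaving `exp (-x² / 4)`. -/
lemma integrable_exp_quarter_sq : Integrable (fun x : ℝ => Real.exp (x ^ 2 / 4)) (gaussianReal 0 1) := by
  rw [gaussianReal_of_var_ne_zero _ one_ne_zero,
    integrable_withDensity_iff_integrable_smul' (by fun_prop) (ae_of_all _ fun _ => gaussianPDF_lt_top)]
  have h := (integrable_exp_neg_mul_sq (b := 1 / 4) (by norm_num)).const_mul (√(2 * Real.pi))⁻¹
  refine h.congr (ae_of_all _ fun x => ?_)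
  simp only [toReal_gaussianPDF, gaussianPDFReal, smul_eq_mul, NNReal.coe_one, mul_one, sub_zero,
    mul_assoc, ← Real.exp_add]
  congr 2
  ring

lemma abs_gaussianScore_le (α β x : ℝ) :
    |gaussianScore α β x| ≤ (|α| + |β|) * (1 + x ^ 2) := by
  unfold gaussianScore
  refine (abs_add_le _ _).trans ?_
  rw [abs_mul, abs_mul]
  have h1 : |x| ≤ 1 + x ^ 2 := by rw [← sq_abs x]; nlinarith [sq_nonneg (|x| - 1), abs_nonneg x]
  have h2 : |x ^ 2 - 1| ≤ 1 + x ^ 2 := abs_le.2 ⟨by nlinarith, by nlinarith⟩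
  nlinarith [mul_le_mul_of_nonneg_left h1 (abs_nonneg α),
    mul_le_mul_of_nonneg_left h2 (abs_nonneg β)]

/-- A majorant independent of `h`. The condition `C * h ≤ 1 / 8` makes the exponent at most `(1 +
x²) / 16`; the polynomial factor costs another such exponential. The square of the result is still
integrable. -/
lemma abs_gaussian_remainder_div_le {α β h C : ℝ} (x : ℝ) (h0 : 0 < h)
    (hC : |gaussianLogRatio α β h x| ≤ C * h * (1 + x ^ 2)) (hCh : C * h ≤ 1 / 8) (hC0 : 0 ≤ C) :
    |(2 * (Real.exp (gaussianLogRatio α β h x / 2) - 1) - h * gaussianScore α β x) / h|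
      ≤ 16 * (C + |α| + |β|) * Real.exp ((1 + x ^ 2) / 8) := by
  set y := gaussianLogRatio α β h x with hy
  have hx : 0 ≤ 1 + x ^ 2 := by positivity
  have hhalf : |y / 2| ≤ (1 + x ^ 2) / 16 := by
    rw [abs_div, abs_two]
    nlinarith
  have h1 := abs_exp_sub_one_le_mul_exp (y / 2)
  have h2 : Real.exp |y / 2| ≤ Real.exp ((1 + x ^ 2) / 16) := Real.exp_le_exp.2 hhalf
  have h3 : 1 + x ^ 2 ≤ 16 * Real.exp ((1 + x ^ 2) / 16) := by
    have := Real.add_one_le_exp ((1 + x ^ 2) / 16)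
    linarith
  have h4 : Real.exp ((1 + x ^ 2) / 8)
      = Real.exp ((1 + x ^ 2) / 16) * Real.exp ((1 + x ^ 2) / 16) := by
    rw [← Real.exp_add]; congr 1; ring
  have h5 : 1 ≤ Real.exp ((1 + x ^ 2) / 16) := Real.one_le_exp (by positivity)
  set e := Real.exp ((1 + x ^ 2) / 16) with he
  have hA : |2 * (Real.exp (y / 2) - 1)| ≤ C * h * (1 + x ^ 2) * e := by
    rw [abs_mul, abs_two]
    have : |y / 2| * Real.exp |y / 2| ≤ C * h * (1 + x ^ 2) / 2 * e := by
      refine mul_le_mul ?_ h2 (Real.exp_pos _).le (by positivity)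
      rw [abs_div, abs_two]
      linarith
    linarith
  have hB := abs_gaussianScore_le α β x
  rw [abs_div, abs_of_pos h0, div_le_iff₀ h0]
  calc |2 * (Real.exp (y / 2) - 1) - h * gaussianScore α β x|
      ≤ |2 * (Real.exp (y / 2) - 1)| + |h * gaussianScore α β x| := abs_sub _ _
    _ ≤ C * h * (1 + x ^ 2) * e + h * ((|α| + |β|) * (1 + x ^ 2)) := by
        refine add_le_add hA ?_
        rw [abs_mul, abs_of_pos h0]
        exact mul_le_mul_of_nonneg_left hB h0.le
    _ ≤ C * h * (16 * e) * e + h * ((|α| + |β|) * (16 * e * e)) := by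
        gcongr
        exact h3.trans (le_mul_of_one_le_right (by positivity) h5)
    _ = 16 * (C + |α| + |β|) * Real.exp ((1 + x ^ 2) / 8) * h := by rw [h4]; ring

/-- Hellinger differentiability of the location-scale Gaussian model. -/
theorem tendsto_integral_gaussian_remainder (α β : ℝ) {h : ℕ → ℝ} (hpos : ∀ᶠ n in atTop, 0 < h n)
    (hlim : Tendsto h atTop (𝓝 0)) :
    Tendsto (fun n => ∫ x, ((2 * (Real.exp (gaussianLogRatio α β (h n) x / 2) - 1)
      - h n * gaussianScore α β x) / h n) ^ 2 ∂gaussianReal 0 1) atTop (𝓝 0) := by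
  set C := 7 * |β| + 2 * |α| + 2 * α ^ 2 with hC
  have hC0 : 0 ≤ C := by positivity
  have hev : ∀ {c : ℝ}, 0 < c → ∀ (K : ℝ), ∀ᶠ n in atTop, K * h n ≤ c := fun {c} hc K => by
    have := hlim.const_mul K
    rw [mul_zero] at this
    exact this.eventually_le_const hc
  rw [show 𝓝 (0 : ℝ) = 𝓝 (∫ _x : ℝ, (0 : ℝ) ∂gaussianReal 0 1) by simp]
  refine tendsto_integral_filter_of_dominated_convergence
    (fun x => (16 * (C + |α| + |β|)) ^ 2 * Real.exp (1 / 4) * Real.exp (x ^ 2 / 4)) ?_ ?_ ?_ ?_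
  · refine Eventually.of_forall fun n => Measurable.aestronglyMeasurable ?_
    have := measurable_gaussianLogRatio α β (h n)
    have := measurable_gaussianScore α β
    fun_prop
  · filter_upwards [hpos, hev one_pos 1, hev one_half_pos |β|,
      hev (by norm_num : (0 : ℝ) < 1 / 8) C] with n h1 h2 h3 h4
    refine ae_of_all _ fun x => ?_
    have hb : |β * h n| ≤ 1 / 2 := by rwa [abs_mul, abs_of_pos h1]
    have := abs_gaussian_remainder_div_le x h1
      (abs_gaussianLogRatio_le (α := α) (β := β) x h1.le (by linarith) hb) h4 hC0
    rw [norm_pow, Real.norm_eq_abs]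
    refine (pow_le_pow_left₀ (abs_nonneg _) this 2).trans_eq ?_
    rw [mul_pow, ← Real.exp_nat_mul, mul_assoc _ (Real.exp _), ← Real.exp_add]
    congr 2
    push_cast
    ring
  · exact integrable_exp_quarter_sq.const_mul _
  · refine ae_of_all _ fun x => ?_
    have hd := (hasDerivAt_exp_gaussianLogRatio α β x).tendsto_slope_zero
    have hh : Tendsto h atTop (𝓝[≠] 0) :=
      tendsto_nhdsWithin_iff.2 ⟨hlim, hpos.mono fun n hn => hn.ne'⟩
    have h1 := ((hd.comp hh).sub_const (gaussianScore α β x)).pow 2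
    rw [sub_self, zero_pow two_ne_zero] at h1
    refine h1.congr' ?_
    filter_upwards [hpos] with n hn
    have e0 : gaussianLogRatio α β 0 x = 0 := by simp [gaussianLogRatio]
    simp only [Function.comp_apply, zero_add, smul_eq_mul, e0]
    congr 1
    field_simp
    simp

end GaussianShift

/-! ### The Poisson experiment -/

section Poisson

/-- The Poisson law with rate `r`, as a law on the real line. -/
noncomputable def poissonLaw (r : ℝ≥0) : Measure ℝ := (poissonMeasure r).map (Nat.cast : ℕ → ℝ)

instance isProbabilityMeasure_poissonLaw (r : ℝ≥0) : IsProbabilityMeasure (poissonLaw r) :=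
  Measure.isProbabilityMeasure_map (by fun_prop)

lemma ae_poissonLaw_exists_nat (r : ℝ≥0) : ∀ᵐ (x : ℝ) ∂poissonLaw r, ∃ k : ℕ, x = (k : ℝ) := by
  rw [poissonLaw, ae_map_iff (by fun_prop)]
  · exact ae_of_all _ fun k => ⟨k, rfl⟩
  · exact ((Set.countable_range (Nat.cast : ℕ → ℝ)).measurableSet).congr (by
      ext x; simp [eq_comm])

lemma hasSum_exp_mul_poisson (r : ℝ≥0) (t : ℝ) :
    HasSum (fun k : ℕ => (Real.exp (-r) * r ^ k / k.factorial) * Real.exp (t * k))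
      (Real.exp (r * (Real.exp t - 1))) := by
  have h := NormedSpace.expSeries_div_hasSum_exp (r * Real.exp t : ℝ)
  rw [← Real.exp_eq_exp_ℝ] at h
  have h2 := h.mul_left (Real.exp (-r))
  rw [← Real.exp_add] at h2
  have e1 : (fun k : ℕ => (Real.exp (-r) * r ^ k / k.factorial) * Real.exp (t * k))
      = fun k : ℕ => Real.exp (-r) * ((r * Real.exp t) ^ k / k.factorial) := by
    ext k
    rw [mul_pow, ← Real.exp_nat_mul, mul_comm t]
    ring
  have e2 : (r * (Real.exp t - 1) : ℝ) = -r + r * Real.exp t := by ring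
  rw [e1, e2]
  exact h2

lemma integrable_exp_mul_poissonLaw (r : ℝ≥0) (t : ℝ) :
    Integrable (fun x => Real.exp (t * x)) (poissonLaw r) := by
  rw [poissonLaw, integrable_map_measure (by fun_prop) (by fun_prop),
    integrable_poissonMeasure_iff]
  simpa using (hasSum_exp_mul_poisson r t).summable

lemma mgf_poissonLaw (r : ℝ≥0) :
    mgf (fun x => x) (poissonLaw r) = fun t => Real.exp (r * (Real.exp t - 1)) := by
  ext t
  rw [mgf, poissonLaw, integral_map (by fun_prop) (by fun_prop), integral_poissonMeasure]
  simpa using (hasSum_exp_mul_poisson r t).tsum_eq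

lemma integral_exp_mul_poissonLaw (r : ℝ≥0) (t : ℝ) :
    ∫ x, Real.exp (t * x) ∂poissonLaw r = Real.exp (r * (Real.exp t - 1)) :=
  congrFun (mgf_poissonLaw r) t

lemma mem_interior_integrableExpSet_poissonLaw (r : ℝ≥0) (t : ℝ) :
    t ∈ interior (integrableExpSet (fun x => x) (poissonLaw r)) := by
  have : integrableExpSet (fun x => x) (poissonLaw r) = Set.univ :=
    Set.eq_univ_of_forall fun t => integrable_exp_mul_poissonLaw r t
  rw [this, interior_univ]
  trivial

lemma memLp_id_poissonLaw (r p : ℝ≥0) : MemLp (fun x => x) p (poissonLaw r) :=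
  memLp_of_mem_interior_integrableExpSet (mem_interior_integrableExpSet_poissonLaw r 0) p

lemma hasDerivAt_mgf_poissonLaw (r : ℝ≥0) (t : ℝ) :
    HasDerivAt (fun t => Real.exp (r * (Real.exp t - 1)))
      (r * Real.exp t * Real.exp (r * (Real.exp t - 1))) t := by
  have := (((Real.hasDerivAt_exp t).sub_const 1).const_mul (r : ℝ)).exp
  exact this.congr_deriv (by ring)

lemma integral_mul_exp_mul_poissonLaw (r : ℝ≥0) (t : ℝ) :
    ∫ x, x * Real.exp (t * x) ∂poissonLaw r
      = r * Real.exp t * Real.exp (r * (Real.exp t - 1)) := by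
  have h := hasDerivAt_mgf (mem_interior_integrableExpSet_poissonLaw r t)
  rw [mgf_poissonLaw] at h
  exact h.unique (hasDerivAt_mgf_poissonLaw r t)

lemma integral_id_poissonLaw (r : ℝ≥0) : ∫ x, x ∂poissonLaw r = r := by
  simpa using integral_mul_exp_mul_poissonLaw r 0

lemma integral_sq_poissonLaw (r : ℝ≥0) : ∫ x, x ^ 2 ∂poissonLaw r = r + r ^ 2 := by
  have h := iteratedDeriv_mgf_zero (mem_interior_integrableExpSet_poissonLaw r 0) 2
  rw [mgf_poissonLaw, iteratedDeriv_succ, iteratedDeriv_one,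
    funext fun t => (hasDerivAt_mgf_poissonLaw r t).deriv] at h
  have h2 : HasDerivAt (fun t => r * Real.exp t * Real.exp (r * (Real.exp t - 1)))
      ((r : ℝ) + r ^ 2) 0 := by
    have := ((Real.hasDerivAt_exp 0).const_mul (r : ℝ)).mul (hasDerivAt_mgf_poissonLaw r 0)
    refine this.congr_deriv ?_
    simp
    ring
  rw [h2.deriv] at h
  exact h.symm

lemma integral_sub_sq_poissonLaw (r : ℝ≥0) : ∫ x, (x - r) ^ 2 ∂poissonLaw r = r := by
  have i1 : Integrable (fun x : ℝ => x) (poissonLaw r) :=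
    (memLp_id_poissonLaw r 1).integrable (by norm_num)
  have i2 : Integrable (fun x : ℝ => x ^ 2) (poissonLaw r) := (memLp_id_poissonLaw r 2).integrable_sq
  have i3 : Integrable (fun x : ℝ => x ^ 2 - 2 * r * x) (poissonLaw r) := i2.sub (i1.const_mul _)
  have e : ∀ x : ℝ, (x - r) ^ 2 = x ^ 2 - 2 * r * x + r ^ 2 := fun x => by ring
  simp_rw [e]
  rw [integral_add i3 (integrable_const _), integral_sub i2 (i1.const_mul _), integral_const_mul,
    integral_id_poissonLaw, integral_sq_poissonLaw]
  simp
  ring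

lemma memLp_sub_poissonLaw (r p : ℝ≥0) : MemLp (fun x : ℝ => x - r) p (poissonLaw r) :=
  (memLp_id_poissonLaw r p).sub (memLp_const _)

/-- The fourth central moment of a Poisson law is of the order of its rate. -/
lemma integral_sub_pow_four_poissonLaw_le {r : ℝ≥0} {R : ℝ} (hr : (r : ℝ) ≤ R) :
    ∫ x, (x - r) ^ 4 ∂poissonLaw r ≤ (400 * Real.exp (2 * R) + 8 * R ^ 3) * r := by
  have hr0 : (0 : ℝ) ≤ r := r.2
  have i1 : Integrable (fun x : ℝ => Real.exp x) (poissonLaw r) := by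
    simpa using integrable_exp_mul_poissonLaw r 1
  have i2 : Integrable (fun x : ℝ => 192 * (Real.exp x - 1) + 8 * (r : ℝ) ^ 4) (poissonLaw r) :=
    ((i1.sub (integrable_const _)).const_mul _).add (integrable_const _)
  have h1 : ∫ x, (x - r) ^ 4 ∂poissonLaw r
      ≤ ∫ x, (192 * (Real.exp x - 1) + 8 * (r : ℝ) ^ 4) ∂poissonLaw r := by
    refine integral_mono_of_nonneg (ae_of_all _ fun x => by positivity) i2 ?_
    filter_upwards [ae_poissonLaw_exists_nat r] with x ⟨k, hk⟩
    have hx : 0 ≤ x := by rw [hk]; positivity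
    -- The `-1` is what matters: the mean of `exp x - 1` is of the order of the rate, whereas that
    -- of `exp x` is not small.
    have h4 : x ^ 4 ≤ 24 * (Real.exp x - 1) := by
      have := Real.sum_le_exp_of_nonneg hx 5
      simp [Finset.sum_range_succ, Nat.factorial] at this
      nlinarith [pow_nonneg hx 2, pow_nonneg hx 3]
    have h5 : (x - r) ^ 4 ≤ 8 * (x ^ 4 + (r : ℝ) ^ 4) := by
      have ha : (x - r) ^ 2 ≤ 2 * (x ^ 2 + (r : ℝ) ^ 2) := by nlinarith [sq_nonneg (x + r)]
      have hb : ((x - r) ^ 2) ^ 2 ≤ (2 * (x ^ 2 + (r : ℝ) ^ 2)) ^ 2 :=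
        pow_le_pow_left₀ (sq_nonneg _) ha 2
      nlinarith [sq_nonneg (x ^ 2 - (r : ℝ) ^ 2)]
    linarith
  have h2 : ∫ x, (192 * (Real.exp x - 1) + 8 * (r : ℝ) ^ 4) ∂poissonLaw r
      = 192 * (Real.exp (r * (Real.exp 1 - 1)) - 1) + 8 * (r : ℝ) ^ 4 := by
    have i3 : Integrable (fun x : ℝ => Real.exp x - 1) (poissonLaw r) := i1.sub (integrable_const _)
    rw [integral_add (i3.const_mul _) (integrable_const _), integral_const_mul,
      integral_sub i1 (integrable_const _)]
    have := integral_exp_mul_poissonLaw r 1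
    simp only [one_mul] at this
    simp [this]
  have he : Real.exp 1 - 1 ≤ 2 := by linarith [Real.exp_one_lt_d9]
  have he0 : 0 ≤ Real.exp 1 - 1 := by linarith [Real.add_one_le_exp (1 : ℝ)]
  have h3 : Real.exp (r * (Real.exp 1 - 1)) - 1 ≤ 2 * r * Real.exp (2 * R) := by
    have hy : 0 ≤ (r : ℝ) * (Real.exp 1 - 1) := by positivity
    have h := abs_exp_sub_one_le_mul_exp (r * (Real.exp 1 - 1))
    rw [abs_of_nonneg hy] at h
    refine (le_abs_self _).trans (h.trans ?_)
    have hy2 : (r : ℝ) * (Real.exp 1 - 1) ≤ 2 * r := by nlinarith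
    exact mul_le_mul hy2 (Real.exp_le_exp.2 (by linarith)) (Real.exp_pos _).le (by positivity)
  have h4 : (r : ℝ) ^ 4 ≤ R ^ 3 * r := by
    have := pow_le_pow_left₀ hr0 hr 3
    nlinarith
  rw [h2] at h1
  have h5 : 0 ≤ r * Real.exp (2 * R) := by positivity
  nlinarith

/-- The logarithm of the likelihood ratio of Poisson laws. -/
noncomputable def poissonLogRatio (r r' : ℝ≥0) (x : ℝ) : ℝ := r - r' + Real.log (r' / r) * x

lemma measurable_poissonLogRatio (r r' : ℝ≥0) : Measurable (poissonLogRatio r r') := by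
  unfold poissonLogRatio; fun_prop

lemma withDensity_poissonLogRatio {r r' : ℝ≥0} (hr : r ≠ 0) (hr' : r' ≠ 0) :
    (poissonLaw r).withDensity
      (fun x => ENNReal.ofReal (Real.exp (poissonLogRatio r r' x / 2) ^ 2)) = poissonLaw r' := by
  have hm := measurable_poissonLogRatio r r'
  have hr0 : (0 : ℝ) < r := by positivity
  have hr0' : (0 : ℝ) < r' := by positivity
  have hN : (poissonMeasure r).withDensity
      (fun k => ENNReal.ofReal (Real.exp (poissonLogRatio r r' k / 2) ^ 2)) = poissonMeasure r' := by
    refine Measure.ext_of_singleton fun k => ?_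
    rw [withDensity_apply _ (by simp), Measure.restrict_singleton, lintegral_smul_measure,
      lintegral_dirac, poissonMeasure_singleton, poissonMeasure_singleton, smul_eq_mul,
      ← ENNReal.ofReal_mul (by positivity)]
    congr 1
    have e1 : Real.exp (poissonLogRatio r r' k / 2) ^ 2 = Real.exp (poissonLogRatio r r' k) := by
      rw [← Real.exp_nat_mul]
      congr 1
      push_cast
      ring
    rw [e1, poissonLogRatio, Real.exp_add, mul_comm (Real.log _), Real.exp_nat_mul,
      Real.exp_log (by positivity), div_pow, Real.exp_sub, Real.exp_neg, Real.exp_neg]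
    field_simp
  rw [poissonLaw, poissonLaw, ← hN]
  ext s hs
  rw [withDensity_apply _ hs, setLIntegral_map hs (by fun_prop) (by fun_prop),
    Measure.map_apply (by fun_prop) hs, withDensity_apply _ (by measurability)]

/-- Hellinger differentiability of the Poisson model, with an explicit remainder. -/
theorem integral_poisson_remainder_le {r r' : ℝ≥0} (hr : r ≠ 0) (hr' : r' ≠ 0) {b : ℝ}
    (hb : -1 < b) (hrb : (r' : ℝ) = r * (1 + b) ^ 2) :
    ∫ x, (2 * (Real.exp (poissonLogRatio r r' x / 2) - 1) - ((r' / r : ℝ) - 1) * (x - r)) ^ 2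
      ∂poissonLaw r ≤ r * b ^ 4 + 2 * (b + 2) * r ^ 2 * b ^ 4 := by
  have hr0 : (0 : ℝ) < r := by positivity
  have hb1 : 0 < 1 + b := by linarith
  -- Since `1 + b` is the square root of `r' / r`, the square root of the likelihood ratio is `exp
  -- ((r - r') / 2) * (1 + b) ^ x`, and all integrals that occur are explicit.
  have hκ : (r' / r : ℝ) - 1 = b * (b + 2) := by
    rw [hrb]
    field_simp
    ring
  have hq : ∀ x, Real.exp (poissonLogRatio r r' x / 2)
      = Real.exp ((r - r') / 2) * Real.exp (Real.log (1 + b) * x) := by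
    intro x
    rw [← Real.exp_add, poissonLogRatio]
    congr 1
    have : (r' / r : ℝ) = (1 + b) ^ 2 := by rw [hrb]; field_simp
    rw [this, Real.log_pow]
    push_cast
    ring
  set g : ℝ → ℝ := fun x => Real.exp (poissonLogRatio r r' x / 2) with hg
  have hgm : Measurable g := by
    have := measurable_poissonLogRatio r r'
    fun_prop
  have hprob : IsProbabilityMeasure ((poissonLaw r).withDensity
      fun x => ENNReal.ofReal (g x ^ 2)) := by
    rw [hg, withDensity_poissonLogRatio hr hr']
    infer_instance
  have hgL := memLp_two_of_withDensity_sq hgm hprob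
  have hg2 := integral_sq_eq_one_of_withDensity hgm hprob
  have hsL : MemLp (fun x : ℝ => x - r) 2 (poissonLaw r) := memLp_sub_poissonLaw r 2
  have hs0 : ∫ x, (x - r) ∂poissonLaw r = 0 := by
    rw [integral_sub ((memLp_id_poissonLaw r 1).integrable (by norm_num)) (integrable_const _),
      integral_id_poissonLaw]
    simp
  have hs2 := integral_sub_sq_poissonLaw r
  have hA : Real.exp ((r - r') / 2) * Real.exp (r * b) = Real.exp (-(r * b ^ 2 / 2)) := by
    rw [← Real.exp_add, hrb]
    congr 1
    ring
  have hg1 : ∫ x, g x ∂poissonLaw r = Real.exp (-(r * b ^ 2 / 2)) := by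
    simp only [hg, hq]
    rw [integral_const_mul, integral_exp_mul_poissonLaw, Real.exp_log hb1, ← hA]
    simp
  have hgx : ∫ x, g x * x ∂poissonLaw r = r * (1 + b) * Real.exp (-(r * b ^ 2 / 2)) := by
    have e : ∀ x, g x * x = Real.exp ((r - r') / 2) * (x * Real.exp (Real.log (1 + b) * x)) :=
      fun x => by simp only [hg, hq]; ring
    simp_rw [e]
    rw [integral_const_mul, integral_mul_exp_mul_poissonLaw, Real.exp_log hb1, ← hA]
    simp only [add_sub_cancel_left]
    ring
  have ig : Integrable g (poissonLaw r) := hgL.integrable (by norm_num)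
  have igx : Integrable (fun x => g x * x) (poissonLaw r) :=
    hgL.integrable_mul (show MemLp (fun x : ℝ => x) 2 (poissonLaw r) from memLp_id_poissonLaw r 2)
  have is1 : Integrable (fun x : ℝ => x - r) (poissonLaw r) := hsL.integrable (by norm_num)
  have hgs : ∫ x, g x * (x - r) ∂poissonLaw r = r * b * Real.exp (-(r * b ^ 2 / 2)) := by
    have e : ∀ x, g x * (x - r) = g x * x - r * g x := fun x => by ring
    simp_rw [e]
    rw [integral_sub igx (ig.const_mul _), integral_const_mul, hg1, hgx]
    ring
  set κ := (r' / r : ℝ) - 1 with hκ'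
  have igs : Integrable (fun x => g x * (x - r)) (poissonLaw r) := hgL.integrable_mul hsL
  have expand : ∫ x, (2 * (g x - 1) - κ * (x - r)) ^ 2 ∂poissonLaw r
      = 4 * ∫ x, g x ^ 2 ∂poissonLaw r + κ ^ 2 * ∫ x, (x - r) ^ 2 ∂poissonLaw r
        - 8 * ∫ x, g x ∂poissonLaw r - 4 * κ * ∫ x, g x * (x - r) ∂poissonLaw r
        + 4 * κ * ∫ x, (x - r) ∂poissonLaw r + 4 := by
    have j1 : Integrable (fun x => 4 * g x ^ 2 + κ ^ 2 * (x - r) ^ 2) (poissonLaw r) :=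
      (hgL.integrable_sq.const_mul _).add (hsL.integrable_sq.const_mul _)
    have j2 : Integrable (fun x => 4 * g x ^ 2 + κ ^ 2 * (x - r) ^ 2 - 8 * g x) (poissonLaw r) :=
      j1.sub (ig.const_mul _)
    have j3 : Integrable (fun x => 4 * g x ^ 2 + κ ^ 2 * (x - r) ^ 2 - 8 * g x
        - 4 * κ * (g x * (x - r))) (poissonLaw r) := j2.sub (igs.const_mul _)
    have j4 : Integrable (fun x => 4 * g x ^ 2 + κ ^ 2 * (x - r) ^ 2 - 8 * g x
        - 4 * κ * (g x * (x - r)) + 4 * κ * (x - r)) (poissonLaw r) := j3.add (is1.const_mul _)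
    have e : ∀ x, (2 * (g x - 1) - κ * (x - r)) ^ 2 = 4 * g x ^ 2 + κ ^ 2 * (x - r) ^ 2 - 8 * g x
        - 4 * κ * (g x * (x - r)) + 4 * κ * (x - r) + 4 := fun x => by ring
    simp_rw [e]
    rw [integral_add j4 (integrable_const _), integral_add j3 (is1.const_mul _),
      integral_sub j2 (igs.const_mul _), integral_sub j1 (ig.const_mul _),
      integral_add (hgL.integrable_sq.const_mul _) (hsL.integrable_sq.const_mul _)]
    simp only [integral_const_mul, integral_const, probReal_univ, smul_eq_mul, one_mul]
  rw [expand, hg2, hs2, hg1, hgs, hs0, hκ]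
  set e := Real.exp (-(r * b ^ 2 / 2)) with he
  have he1 : 1 - r * b ^ 2 / 2 ≤ e := by
    have := Real.add_one_le_exp (-(r * b ^ 2 / 2))
    linarith
  have hpos : 0 ≤ (r : ℝ) * b ^ 2 * (b + 2) := by
    have : 0 ≤ b + 2 := by linarith
    positivity
  -- After `e ≥ 1 - r b² / 2`, the coefficient of `r b²` is `(b + 2)² + 4 - 4(b + 2) = b²`. This
  -- cancellation leaves only fourth powers of `b`.
  nlinarith [mul_le_mul_of_nonneg_left he1 hpos]

end Poisson

/-! ### Products of two experiments -/

section Product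

variable {E F : Type*} [MeasurableSpace E] [MeasurableSpace F] {m₁ : Measure E} {m₂ : Measure F}

lemma prod_withDensity_sq_mul [SFinite m₁] [SFinite m₂] {q₁ : E → ℝ} {q₂ : F → ℝ}
    (h₁ : Measurable q₁) (h₂ : Measurable q₂) :
    (m₁.prod m₂).withDensity (fun e => ENNReal.ofReal ((q₁ e.1 * q₂ e.2) ^ 2))
      = (m₁.withDensity fun x => ENNReal.ofReal (q₁ x ^ 2)).prod
        (m₂.withDensity fun y => ENNReal.ofReal (q₂ y ^ 2)) := by
  rw [prod_withDensity (by fun_prop) (by fun_prop)]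
  congr 1
  ext e
  rw [mul_pow, ENNReal.ofReal_mul (sq_nonneg _)]

lemma memLp_comp_fst [SFinite m₁] [IsProbabilityMeasure m₂] {f : E → ℝ} {p : ℝ≥0∞} (hf : MemLp f p m₁) :
    MemLp (fun e : E × F => f e.1) p (m₁.prod m₂) :=
  hf.comp_measurePreserving measurePreserving_fst

variable [IsProbabilityMeasure m₁] [IsProbabilityMeasure m₂]

lemma memLp_comp_snd {f : F → ℝ} {p : ℝ≥0∞} (hf : MemLp f p m₂) :
    MemLp (fun e : E × F => f e.2) p (m₁.prod m₂) :=
  hf.comp_measurePreserving measurePreserving_snd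

lemma integral_comp_fst {f : E → ℝ} : ∫ e, f e.1 ∂m₁.prod m₂ = ∫ x, f x ∂m₁ := by
  simp [integral_fun_fst]

lemma integral_comp_snd {f : F → ℝ} : ∫ e, f e.2 ∂m₁.prod m₂ = ∫ y, f y ∂m₂ := by
  simp [integral_fun_snd]

lemma four_mul_integral_sub_one_sq_le {q s : E → ℝ} (hq : MemLp q 2 m₁) (hs : MemLp s 2 m₁) :
    4 * ∫ x, (q x - 1) ^ 2 ∂m₁
      ≤ 2 * ∫ x, (2 * (q x - 1) - s x) ^ 2 ∂m₁ + 2 * ∫ x, s x ^ 2 ∂m₁ := by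
  have hq1 : MemLp (fun x => q x - 1) 2 m₁ := hq.sub (memLp_const 1)
  have iA : Integrable (fun x => (2 * (q x - 1) - s x) ^ 2) m₁ :=
    ((hq1.const_mul 2).sub hs).integrable_sq
  have is := hs.integrable_sq
  rw [← integral_const_mul, ← integral_const_mul, ← integral_const_mul,
    ← integral_add (iA.const_mul _) (is.const_mul _)]
  refine integral_mono (hq1.integrable_sq.const_mul _) ((iA.const_mul _).add (is.const_mul _))
    fun x => ?_
  simp only
  nlinarith [sq_nonneg (2 * (q x - 1) - s x - s x)]

/-- Hellinger differentiability of product experiments. -/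
theorem integral_prod_remainder_le {q₁ s₁ : E → ℝ} {q₂ s₂ : F → ℝ} (hq₁ : MemLp q₁ 2 m₁)
    (hs₁ : MemLp s₁ 2 m₁) (hq₂ : MemLp q₂ 2 m₂) (hs₂ : MemLp s₂ 2 m₂) :
    ∫ e, (2 * (q₁ e.1 * q₂ e.2 - 1) - (s₁ e.1 + s₂ e.2)) ^ 2 ∂m₁.prod m₂
      ≤ 3 * ∫ x, (2 * (q₁ x - 1) - s₁ x) ^ 2 ∂m₁ + 3 * ∫ y, (2 * (q₂ y - 1) - s₂ y) ^ 2 ∂m₂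
        + 3 * ((∫ x, (2 * (q₁ x - 1) - s₁ x) ^ 2 ∂m₁ + ∫ x, s₁ x ^ 2 ∂m₁)
          * (∫ y, (2 * (q₂ y - 1) - s₂ y) ^ 2 ∂m₂ + ∫ y, s₂ y ^ 2 ∂m₂)) := by
  have hq₁1 : MemLp (fun x => q₁ x - 1) 2 m₁ := hq₁.sub (memLp_const 1)
  have hq₂1 : MemLp (fun x => q₂ x - 1) 2 m₂ := hq₂.sub (memLp_const 1)
  have hA₁ : MemLp (fun x => 2 * (q₁ x - 1) - s₁ x) 2 m₁ := (hq₁1.const_mul 2).sub hs₁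
  have hA₂ : MemLp (fun x => 2 * (q₂ x - 1) - s₂ x) 2 m₂ := (hq₂1.const_mul 2).sub hs₂
  have i₁ : Integrable (fun e : E × F => (2 * (q₁ e.1 - 1) - s₁ e.1) ^ 2) (m₁.prod m₂) :=
    (memLp_comp_fst hA₁).integrable_sq
  have i₂ : Integrable (fun e : E × F => (2 * (q₂ e.2 - 1) - s₂ e.2) ^ 2) (m₁.prod m₂) :=
    (memLp_comp_snd hA₂).integrable_sq
  have i₃ : Integrable (fun e : E × F => (q₁ e.1 - 1) ^ 2 * (q₂ e.2 - 1) ^ 2) (m₁.prod m₂) :=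
    hq₁1.integrable_sq.mul_prod hq₂1.integrable_sq
  have i₁₂ : Integrable (fun e : E × F => 3 * (2 * (q₁ e.1 - 1) - s₁ e.1) ^ 2
      + 3 * (2 * (q₂ e.2 - 1) - s₂ e.2) ^ 2) (m₁.prod m₂) := (i₁.const_mul 3).add (i₂.const_mul 3)
  have h1 : ∫ e, (2 * (q₁ e.1 * q₂ e.2 - 1) - (s₁ e.1 + s₂ e.2)) ^ 2 ∂m₁.prod m₂
      ≤ ∫ e, (3 * (2 * (q₁ e.1 - 1) - s₁ e.1) ^ 2 + 3 * (2 * (q₂ e.2 - 1) - s₂ e.2) ^ 2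
        + 12 * ((q₁ e.1 - 1) ^ 2 * (q₂ e.2 - 1) ^ 2)) ∂m₁.prod m₂ := by
    refine integral_mono_of_nonneg (ae_of_all _ fun e => sq_nonneg _)
      (i₁₂.add (i₃.const_mul 12)) (ae_of_all _ fun e => ?_)
    -- Besides the two remainders there is only the product of `q₁ - 1` and `q₂ - 1`. By
    -- independence its second moment is the product of two small ones.
    have e1 : 2 * (q₁ e.1 * q₂ e.2 - 1) - (s₁ e.1 + s₂ e.2) = (2 * (q₁ e.1 - 1) - s₁ e.1)
        + (2 * (q₂ e.2 - 1) - s₂ e.2) + 2 * ((q₁ e.1 - 1) * (q₂ e.2 - 1)) := by ring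
    simp only
    rw [e1, ← mul_pow]
    generalize 2 * (q₁ e.1 - 1) - s₁ e.1 = A
    generalize 2 * (q₂ e.2 - 1) - s₂ e.2 = B
    generalize (q₁ e.1 - 1) * (q₂ e.2 - 1) = C
    nlinarith [sq_nonneg (A - B), sq_nonneg (A - 2 * C), sq_nonneg (B - 2 * C)]
  rw [integral_add i₁₂ (i₃.const_mul 12), integral_add (i₁.const_mul 3) (i₂.const_mul 3),
    integral_const_mul, integral_const_mul, integral_const_mul,
    integral_comp_fst (f := fun x => (2 * (q₁ x - 1) - s₁ x) ^ 2),
    integral_comp_snd (f := fun y => (2 * (q₂ y - 1) - s₂ y) ^ 2),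
    integral_prod_mul (fun x => (q₁ x - 1) ^ 2) (fun y => (q₂ y - 1) ^ 2)] at h1
  have h2 := four_mul_integral_sub_one_sq_le hq₁ hs₁
  have h3 := four_mul_integral_sub_one_sq_le hq₂ hs₂
  have n1 : 0 ≤ ∫ x, (q₁ x - 1) ^ 2 ∂m₁ := integral_nonneg fun _ => sq_nonneg _
  have n2 : 0 ≤ ∫ x, (q₂ x - 1) ^ 2 ∂m₂ := integral_nonneg fun _ => sq_nonneg _
  have h4 := mul_le_mul h2 h3 (by positivity) ((by positivity : (0 : ℝ) ≤ _).trans h2)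
  nlinarith

lemma integral_add_prod {s₁ : E → ℝ} {s₂ : F → ℝ} (hs₁ : Integrable s₁ m₁) (hs₂ : Integrable s₂ m₂) :
    ∫ e, (s₁ e.1 + s₂ e.2) ∂m₁.prod m₂ = ∫ x, s₁ x ∂m₁ + ∫ y, s₂ y ∂m₂ := by
  rw [integral_add (hs₁.comp_fst m₂) (hs₂.comp_snd m₁), integral_comp_fst, integral_comp_snd]

lemma integral_add_sq_prod {s₁ : E → ℝ} {s₂ : F → ℝ} (hs₁ : MemLp s₁ 2 m₁) (hs₂ : MemLp s₂ 2 m₂)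
    (h₁ : ∫ x, s₁ x ∂m₁ = 0) :
    ∫ e, (s₁ e.1 + s₂ e.2) ^ 2 ∂m₁.prod m₂ = ∫ x, s₁ x ^ 2 ∂m₁ + ∫ y, s₂ y ^ 2 ∂m₂ := by
  have i₁ : Integrable (fun e : E × F => s₁ e.1 ^ 2) (m₁.prod m₂) := (memLp_comp_fst hs₁).integrable_sq
  have i₂ : Integrable (fun e : E × F => s₂ e.2 ^ 2) (m₁.prod m₂) := (memLp_comp_snd hs₂).integrable_sq
  have i₃ : Integrable (fun e : E × F => s₁ e.1 * s₂ e.2) (m₁.prod m₂) :=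
    (hs₁.integrable (by norm_num)).mul_prod (hs₂.integrable (by norm_num))
  have i₁₂ : Integrable (fun e : E × F => s₁ e.1 ^ 2 + s₂ e.2 ^ 2) (m₁.prod m₂) := i₁.add i₂
  have e : ∀ e : E × F, (s₁ e.1 + s₂ e.2) ^ 2 = s₁ e.1 ^ 2 + s₂ e.2 ^ 2 + 2 * (s₁ e.1 * s₂ e.2) :=
    fun e => by ring
  simp_rw [e]
  rw [integral_add i₁₂ (i₃.const_mul 2), integral_add i₁ i₂, integral_const_mul,
    integral_prod_mul s₁ s₂, h₁, integral_comp_fst (f := fun x => s₁ x ^ 2),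
    integral_comp_snd (f := fun y => s₂ y ^ 2)]
  ring

lemma integral_add_pow_four_prod_le {s₁ : E → ℝ} {s₂ : F → ℝ} (hs₁ : MemLp s₁ 4 m₁)
    (hs₂ : MemLp s₂ 4 m₂) :
    ∫ e, (s₁ e.1 + s₂ e.2) ^ 4 ∂m₁.prod m₂ ≤ 8 * ∫ x, s₁ x ^ 4 ∂m₁ + 8 * ∫ y, s₂ y ^ 4 ∂m₂ := by
  have i₁ : Integrable (fun e : E × F => s₁ e.1 ^ 4) (m₁.prod m₂) :=
    integrable_pow_four (memLp_comp_fst hs₁)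
  have i₂ : Integrable (fun e : E × F => s₂ e.2 ^ 4) (m₁.prod m₂) :=
    integrable_pow_four (memLp_comp_snd hs₂)
  rw [← integral_comp_fst (m₁ := m₁) (m₂ := m₂) (f := fun x => s₁ x ^ 4),
    ← integral_comp_snd (m₁ := m₁) (m₂ := m₂) (f := fun y => s₂ y ^ 4), ← integral_const_mul,
    ← integral_const_mul, ← integral_add (i₁.const_mul 8) (i₂.const_mul 8)]
  refine integral_mono_of_nonneg (ae_of_all _ fun e => by positivity)
    ((i₁.const_mul 8).add (i₂.const_mul 8)) (ae_of_all _ fun e => ?_)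
  simp only
  generalize s₁ e.1 = x
  generalize s₂ e.2 = y
  have ha : (x + y) ^ 2 ≤ 2 * (x ^ 2 + y ^ 2) := by nlinarith [sq_nonneg (x - y)]
  have hb : ((x + y) ^ 2) ^ 2 ≤ (2 * (x ^ 2 + y ^ 2)) ^ 2 := pow_le_pow_left₀ (sq_nonneg _) ha 2
  nlinarith [sq_nonneg (x ^ 2 - y ^ 2)]

end Product

/-! ### Recovering the number of jumps by rounding -/

section Rounding

/-- The part of the score which is affected when the number of jumps is estimated by rounding:
the error is of high order in the size of the continuous part `d` of the increment. -/
lemma abs_rounding_error_le {α β a σ u c x d e : ℝ} (hσ : 0 < σ) (hu : 0 < u) (hu1 : u ≤ 1)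
    (hd : d = a * u ^ 2 + σ * u * x) (he : e = (round d : ℝ) / (σ * u)) :
    |α * e + β * (2 * x * e - e ^ 2) - c / u * round d|
      ≤ (4 * |α| / σ + |β| * (8 + 8 * |a|) / σ ^ 2 + 4 * |c|) * (2 * |d| ^ 3 / u ^ 2) := by
  have hσu : 0 < σ * u := by positivity
  -- If `d` rounds to zero there is no error. Otherwise `|d| ≥ 1 / 2`, so lower powers of `|d|` can
  -- be raised to the cube at the cost of a constant. As `d` is of order `u`, the squared error is
  -- then of order `(u³ / u²)² = u²`.
  by_cases h0 : round d = 0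
  · rw [h0] at he ⊢
    simp only [Int.cast_zero, zero_div] at he
    simp only [he, Int.cast_zero, mul_zero, sub_zero]
    norm_num
    positivity
  have hround := abs_sub_round d
  have hone : (1 : ℝ) ≤ |(round d : ℝ)| := by
    rw [← Int.cast_abs]
    exact_mod_cast Int.one_le_abs h0
  have htri : |(round d : ℝ)| ≤ |d| + 1 / 2 := by
    have := abs_sub_abs_le_abs_sub (round d : ℝ) d
    rw [abs_sub_comm] at this
    linarith
  have hdhalf : 1 / 2 ≤ |d| := by linarith
  have hρ : |(round d : ℝ)| ≤ 2 * |d| := by linarith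
  have hd1 : |d| ≤ 2 * |d| ^ 2 := by nlinarith
  have hd2 : |d| ^ 2 ≤ 2 * |d| ^ 3 := by nlinarith [sq_nonneg |d|]
  have hinv : 1 / u ≤ 1 / u ^ 2 := by
    apply one_div_le_one_div_of_le (by positivity)
    nlinarith
  have habs_e : |e| = |(round d : ℝ)| / (σ * u) := by rw [he, abs_div, abs_of_pos hσu]
  have he1 : |e| ≤ 4 / σ * (|d| ^ 2 / u ^ 2) := by
    rw [habs_e]
    calc |(round d : ℝ)| / (σ * u) = |(round d : ℝ)| / σ * (1 / u) := by field_simp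
      _ ≤ (4 * |d| ^ 2) / σ * (1 / u ^ 2) := by
          gcongr
          linarith
      _ = _ := by ring
  have hxe : |2 * x * e - e ^ 2| ≤ (8 + 8 * |a|) / σ ^ 2 * (|d| ^ 2 / u ^ 2) := by
    have hx : 2 * x * e - e ^ 2 = (round d : ℝ) * (2 * (d - a * u ^ 2) - round d) / (σ * u) ^ 2 := by
      rw [he, hd]
      field_simp
      ring
    have h1 : |2 * (d - a * u ^ 2) - round d| ≤ (4 + 4 * |a|) * |d| := by
      have h2 : |a * u ^ 2| ≤ |a| * (2 * |d|) := by
        rw [abs_mul, abs_of_nonneg (sq_nonneg u)]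
        refine mul_le_mul_of_nonneg_left ?_ (abs_nonneg a)
        nlinarith
      have e1 : 2 * (d - a * u ^ 2) - round d = 2 * d - 2 * (a * u ^ 2) - round d := by ring
      rw [e1]
      refine (abs_sub _ _).trans ?_
      refine (add_le_add_left (abs_sub _ _) _).trans ?_
      rw [abs_mul, abs_mul, abs_two]
      nlinarith
    rw [hx, abs_div, abs_mul, abs_of_nonneg (sq_nonneg (σ * u))]
    calc |(round d : ℝ)| * |2 * (d - a * u ^ 2) - round d| / (σ * u) ^ 2
        ≤ (2 * |d|) * ((4 + 4 * |a|) * |d|) / (σ * u) ^ 2 := by gcongr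
      _ = _ := by field_simp; ring
  have hcρ : |c / u * round d| ≤ 4 * |c| * (|d| ^ 2 / u ^ 2) := by
    rw [abs_mul, abs_div, abs_of_pos hu]
    calc |c| / u * |(round d : ℝ)| = |c| * |(round d : ℝ)| * (1 / u) := by ring
      _ ≤ |c| * (4 * |d| ^ 2) * (1 / u ^ 2) := by
          gcongr
          linarith
      _ = _ := by ring
  calc |α * e + β * (2 * x * e - e ^ 2) - c / u * round d|
      ≤ |α| * |e| + |β| * |2 * x * e - e ^ 2| + |c / u * round d| := by
        refine (abs_sub _ _).trans (add_le_add ((abs_add_le _ _).trans ?_) le_rfl)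
        rw [abs_mul, abs_mul]
    _ ≤ |α| * (4 / σ * (|d| ^ 2 / u ^ 2)) + |β| * ((8 + 8 * |a|) / σ ^ 2 * (|d| ^ 2 / u ^ 2))
        + 4 * |c| * (|d| ^ 2 / u ^ 2) := by gcongr
    _ = (4 * |α| / σ + |β| * (8 + 8 * |a|) / σ ^ 2 + 4 * |c|) * (|d| ^ 2 / u ^ 2) := by ring
    _ ≤ _ := by gcongr

lemma pow_six_add_le {a σ u x : ℝ} (hu : 0 < u) (hu1 : u ≤ 1) :
    (a * u ^ 2 + σ * u * x) ^ 6 ≤ 32 * u ^ 6 * (a ^ 6 + σ ^ 6 * x ^ 6) := by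
  have h6 : ∀ y z : ℝ, (y + z) ^ 6 ≤ 32 * (y ^ 6 + z ^ 6) := by
    intro y z
    have ha : (y + z) ^ 2 ≤ 2 * (y ^ 2 + z ^ 2) := by nlinarith [sq_nonneg (y - z)]
    have hb : ((y + z) ^ 2) ^ 3 ≤ (2 * (y ^ 2 + z ^ 2)) ^ 3 := pow_le_pow_left₀ (sq_nonneg _) ha 3
    nlinarith [mul_nonneg (add_nonneg (sq_nonneg y) (sq_nonneg z)) (sq_nonneg (y ^ 2 - z ^ 2))]
  have e : a * u ^ 2 + σ * u * x = u * (a * u + σ * x) := by ring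
  rw [e, mul_pow]
  have h := h6 (a * u) (σ * x)
  have hu6 : u ^ 6 ≤ 1 := pow_le_one₀ hu.le hu1
  have ha6 : 0 ≤ a ^ 6 := by positivity
  rw [mul_pow, mul_pow] at h
  have hu0 : 0 ≤ u ^ 6 := by positivity
  calc u ^ 6 * (a * u + σ * x) ^ 6 ≤ u ^ 6 * (32 * (a ^ 6 * u ^ 6 + σ ^ 6 * x ^ 6)) := by gcongr
    _ ≤ u ^ 6 * (32 * (a ^ 6 * 1 + σ ^ 6 * x ^ 6)) := by gcongr
    _ = _ := by ring

/-- The increment of the process over a time interval of length `u²`, as a function of its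
normalized Brownian part and its number of jumps. -/
def incrementMap (a σ u : ℝ) (e : ℝ × ℝ) : ℝ := a * u ^ 2 + σ * u * e.1 + e.2

lemma measurable_incrementMap (a σ u : ℝ) : Measurable (incrementMap a σ u) := by
  unfold incrementMap; fun_prop

/-- The score of one observation of the Brownian part and of the number of jumps. -/
noncomputable def fullScore (α β h κ r : ℝ) (e : ℝ × ℝ) : ℝ :=
  h * gaussianScore α β e.1 + κ * (e.2 - r)

lemma measurable_fullScore (α β h κ r : ℝ) : Measurable (fullScore α β h κ r) := by
  have := measurable_gaussianScore α β
  unfold fullScore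
  fun_prop

/-- The score with the number of jumps replaced by its estimate from the increment. -/
noncomputable def roundedScore (α β h κ r a σ u y : ℝ) : ℝ :=
  fullScore α β h κ r ((y - round y - a * u ^ 2) / (σ * u), round y)

lemma measurable_roundedScore (α β h κ r a σ u : ℝ) :
    Measurable (roundedScore α β h κ r a σ u) := by
  have hr : Measurable fun y : ℝ => (round y : ℝ) := by
    have : (fun y : ℝ => (round y : ℝ)) = fun y => ((⌊y + 1 / 2⌋ : ℤ) : ℝ) := by
      ext y; rw [round_eq]
    rw [this]
    fun_prop
  exact (measurable_fullScore α β h κ r).comp (by fun_prop)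

/-- Rounding commutes with adding the integer `k`, so the misestimate of the number of jumps is
`round d`, with `d` the continuous part, whatever `k` is. The coefficient `h * c / u` is `c / √(n
Δ_n)` when `h = 1 / √n` and `u = √Δ_n`. -/
lemma fullScore_sub_roundedScore_sq_le {α β h r a σ u c x : ℝ} (k : ℕ) (hσ : 0 < σ) (hu : 0 < u)
    (hu1 : u ≤ 1) :
    (fullScore α β h (h * c / u) r (x, k)
        - roundedScore α β h (h * c / u) r a σ u (incrementMap a σ u (x, k))) ^ 2
      ≤ 128 * (4 * |α| / σ + |β| * (8 + 8 * |a|) / σ ^ 2 + 4 * |c|) ^ 2 * h ^ 2 * u ^ 2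
        * (a ^ 6 + σ ^ 6 * x ^ 6) := by
  set d := a * u ^ 2 + σ * u * x with hd
  set C := 4 * |α| / σ + |β| * (8 + 8 * |a|) / σ ^ 2 + 4 * |c| with hC
  have hround : (round (incrementMap a σ u (x, k)) : ℝ) = round d + k := by
    simp only [incrementMap, ← hd]
    rw [round_add_natCast]
    push_cast
    ring
  have hdiff : fullScore α β h (h * c / u) r (x, k)
        - roundedScore α β h (h * c / u) r a σ u (incrementMap a σ u (x, k))
      = h * (α * ((round d : ℝ) / (σ * u)) + β * (2 * x * ((round d : ℝ) / (σ * u))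
        - ((round d : ℝ) / (σ * u)) ^ 2) - c / u * round d) := by
    rw [roundedScore, hround]
    have e1 : (incrementMap a σ u (x, k) - ((round d : ℝ) + k) - a * u ^ 2) / (σ * u)
        = x - (round d : ℝ) / (σ * u) := by
      simp only [incrementMap]
      field_simp
      ring
    rw [e1]
    simp only [fullScore, gaussianScore]
    ring
  have hb := abs_rounding_error_le (α := α) (β := β) (c := c) hσ hu hu1 hd rfl
  rw [hdiff, mul_pow, ← sq_abs (α * _ + _ - _)]
  have h6 : d ^ 6 ≤ 32 * u ^ 6 * (a ^ 6 + σ ^ 6 * x ^ 6) := pow_six_add_le hu hu1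
  calc h ^ 2 * |_| ^ 2 ≤ h ^ 2 * (C * (2 * |d| ^ 3 / u ^ 2)) ^ 2 := by gcongr
    _ = h ^ 2 * (4 * C ^ 2 * |d| ^ 6 / u ^ 4) := by ring
    _ = h ^ 2 * (4 * C ^ 2 * d ^ 6 / u ^ 4) := by rw [Even.pow_abs (by decide)]
    _ ≤ h ^ 2 * (4 * C ^ 2 * (32 * u ^ 6 * (a ^ 6 + σ ^ 6 * x ^ 6)) / u ^ 4) := by gcongr
    _ = _ := by field_simp; ring

/-- The point is the factor `h² u²`: with `n h² = 1` and `u² = Δ_n`, the sum over a row is `O(Δ_n)`.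
This is where `Δ_n → 0` enters. -/
lemma memLp_integral_fullScore_sub_roundedScore {α β h a σ u c : ℝ} (r : ℝ≥0) (hσ : 0 < σ)
    (hu : 0 < u) (hu1 : u ≤ 1) :
    MemLp (fun e => fullScore α β h (h * c / u) r e
        - roundedScore α β h (h * c / u) r a σ u (incrementMap a σ u e)) 2
        ((gaussianReal 0 1).prod (poissonLaw r)) ∧
    ∫ e, (fullScore α β h (h * c / u) r e
        - roundedScore α β h (h * c / u) r a σ u (incrementMap a σ u e)) ^ 2
        ∂(gaussianReal 0 1).prod (poissonLaw r)
      ≤ 128 * (4 * |α| / σ + |β| * (8 + 8 * |a|) / σ ^ 2 + 4 * |c|) ^ 2 * h ^ 2 * u ^ 2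
        * (a ^ 6 + σ ^ 6 * ∫ x, x ^ 6 ∂gaussianReal 0 1) := by
  set K := 128 * (4 * |α| / σ + |β| * (8 + 8 * |a|) / σ ^ 2 + 4 * |c|) ^ 2 * h ^ 2 * u ^ 2 with hK
  have hle : ∀ᵐ e ∂(gaussianReal 0 1).prod (poissonLaw r), (fullScore α β h (h * c / u) r e
        - roundedScore α β h (h * c / u) r a σ u (incrementMap a σ u e)) ^ 2
      ≤ K * (a ^ 6 + σ ^ 6 * e.1 ^ 6) := by
    have hsnd : ∀ᵐ e ∂(gaussianReal 0 1).prod (poissonLaw r), ∃ k : ℕ, e.2 = (k : ℝ) :=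
      (measurePreserving_snd (μ := gaussianReal 0 1) (ν := poissonLaw r)).quasiMeasurePreserving.ae
        (ae_poissonLaw_exists_nat r)
    filter_upwards [hsnd] with e ⟨k, hk⟩
    have := fullScore_sub_roundedScore_sq_le (α := α) (β := β) (h := h) (r := r) (a := a) (c := c)
      (x := e.1) k hσ hu hu1
    rw [← hk] at this
    exact this
  have i0 : Integrable (fun x : ℝ => a ^ 6 + σ ^ 6 * x ^ 6) (gaussianReal 0 1) :=
    (integrable_const _).add ((integrable_pow_stdGaussian 6).const_mul _)
  have i1 : Integrable (fun e : ℝ × ℝ => K * (a ^ 6 + σ ^ 6 * e.1 ^ 6))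
      ((gaussianReal 0 1).prod (poissonLaw r)) := (i0.comp_fst _).const_mul _
  have hm : Measurable (fun e => fullScore α β h (h * c / u) r e
        - roundedScore α β h (h * c / u) r a σ u (incrementMap a σ u e)) :=
    (measurable_fullScore _ _ _ _ _).sub
      ((measurable_roundedScore _ _ _ _ _ _ _ _).comp (measurable_incrementMap a σ u))
  constructor
  · refine (memLp_two_iff_integrable_sq hm.aestronglyMeasurable).2
      (i1.mono' (hm.pow_const 2).aestronglyMeasurable ?_)
    filter_upwards [hle] with e he
    rwa [Real.norm_eq_abs, abs_of_nonneg (sq_nonneg _)]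
  · refine (integral_mono_of_nonneg (ae_of_all _ fun _ => sq_nonneg _) i1 hle).trans_eq ?_
    rw [integral_const_mul, integral_comp_fst (f := fun x : ℝ => a ^ 6 + σ ^ 6 * x ^ 6),
      integral_add (integrable_const _) ((integrable_pow_stdGaussian 6).const_mul _),
      integral_const_mul]
    simp

end Rounding

/-! ### Densities of product measures -/

section ProductDensity

lemma map_withDensity_comp {α β : Type*} [MeasurableSpace α] [MeasurableSpace β] {m : Measure α}
    {φ : α → β} (hφ : Measurable φ) {g : β → ℝ≥0∞} (hg : Measurable g) :
    (m.withDensity fun z => g (φ z)).map φ = (m.map φ).withDensity g := by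
  ext s hs
  rw [Measure.map_apply hφ hs, withDensity_apply _ (hφ hs), withDensity_apply _ hs,
    setLIntegral_map hs hg hφ]

lemma pi_withDensity {E : Type*} [MeasurableSpace E] (m : Measure E) [SigmaFinite m] {f : E → ℝ≥0∞}
    (hf : Measurable f) [SigmaFinite (m.withDensity f)] (n : ℕ) :
    Measure.pi (fun _ : Fin n => m.withDensity f)
      = (Measure.pi fun _ : Fin n => m).withDensity fun z => ∏ i, f (z i) := by
  induction n with
  | zero =>
    simp [Measure.pi_of_empty (fun _ : Fin 0 => m.withDensity f) finZeroElim,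
      Measure.pi_of_empty (fun _ : Fin 0 => m) finZeroElim]
  | succ n ih =>
    have h1 := (measurePreserving_piFinSuccAbove (fun _ : Fin (n + 1) => m.withDensity f) 0).symm
    have h2 := (measurePreserving_piFinSuccAbove (fun _ : Fin (n + 1) => m) 0).symm
    have hg : Measurable fun z : Fin (n + 1) → E => ∏ i, f (z i) := by fun_prop
    have hg' : Measurable fun z : Fin n → E => ∏ i, f (z i) := by fun_prop
    rw [← h1.map_eq, ih, prod_withDensity hf hg', ← h2.map_eq,
      ← map_withDensity_comp h2.measurable hg]
    congr 2
    ext z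
    simp [MeasurableEquiv.piFinSuccAbove, Fin.prod_univ_succ, Fin.insertNthEquiv]

end ProductDensity

/-! ### Paths and their increments -/

section Path

/-- The path with initial value `x` and increments `z`. -/
def path (x : ℝ) {n : ℕ} (z : Fin n → ℝ) (k : Fin (n + 1)) : ℝ :=
  x + ∑ i : Fin n, if (i : ℕ) < k then z i else 0

lemma path_zero (x : ℝ) {n : ℕ} (z : Fin n → ℝ) : path x z 0 = x := by simp [path]

lemma path_succ (x : ℝ) {n : ℕ} (z : Fin n → ℝ) (k : Fin n) :
    path x z k.succ = path x z k.castSucc + z k := by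
  have h : ∀ i : Fin n, (if (i : ℕ) < k.succ then z i else 0)
      = (if (i : ℕ) < k.castSucc then z i else 0) + if i = k then z i else 0 := by
    intro i
    simp only [Fin.val_succ, Fin.val_castSucc, Fin.ext_iff]
    split_ifs <;> first | omega | simp
  rw [path, path, Finset.sum_congr rfl fun i _ => h i, Finset.sum_add_distrib]
  simp [add_assoc]

lemma eq_path_of_increments {x : ℝ} {n : ℕ} {y : Fin (n + 1) → ℝ} (h0 : y 0 = x) :
    y = path x fun k : Fin n => y k.succ - y k.castSucc := by
  funext k
  induction k using Fin.induction with
  | zero => rw [path_zero, h0]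
  | succ k ih => rw [path_succ, ← ih]; ring

lemma measurable_path (x : ℝ) (n : ℕ) : Measurable (path x : (Fin n → ℝ) → Fin (n + 1) → ℝ) := by
  refine measurable_pi_lambda _ fun k => measurable_const.add
    (Finset.measurable_sum _ fun i _ => ?_)
  split_ifs
  · exact measurable_pi_apply i
  · exact measurable_const

/-- The path measure of Lebesgue distributed increments is the reference measure. -/
lemma map_path_volume (x : ℝ) (n : ℕ) :
    (Measure.pi fun _ : Fin n => (volume : Measure ℝ)).map (path x) = refMeasure n x := by
  have : ∀ k : Fin (n + 1), SigmaFinite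
      ((fun k : Fin (n + 1) => if k = 0 then Measure.dirac x else volume) k : Measure ℝ) := by
    intro k
    dsimp only
    split_ifs <;> infer_instance
  have h := (measurePreserving_piFinSuccAbove
    (fun k : Fin (n + 1) => if k = 0 then Measure.dirac x else (volume : Measure ℝ)) 0).symm
  have h' := h.map_eq
  simp only [Fin.zero_succAbove, if_true, Fin.succ_ne_zero, if_false] at h'
  rw [refMeasure, ← h', Measure.dirac_prod]
  -- Cumulative summation is a unipotent triangular map, so it preserves Lebesgue measure, and so
  -- does the translation by `x`.
  let M : Matrix (Fin n) (Fin n) ℝ := fun j i => if i ≤ j then 1 else 0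
  have hdet : M.det = 1 := by
    rw [Matrix.det_of_isLowerTriangular]
    · simp [M]
    · intro i j hij
      have : i < j := hij
      simp [M, this]
  have hL : (volume : Measure (Fin n → ℝ)).map (Matrix.toLin' M) = volume := by
    rw [Real.map_matrix_volume_pi_eq_smul_volume_pi (by simp [hdet]), hdet]
    simp
  have hLm : Measurable (Matrix.toLin' M) := (Matrix.toLin' M).continuous_of_finiteDimensional.measurable
  have hT : (volume : Measure (Fin n → ℝ)).map (fun z => (fun _ => x) + z) = volume :=
    (measurePreserving_add_left volume _).map_eq
  have hLT : (volume : Measure (Fin n → ℝ)).map (fun z => (fun _ => x) + Matrix.toLin' M z)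
      = volume := by
    conv_rhs => rw [← hT, ← hL]
    rw [Measure.map_map (by fun_prop) hLm]
    rfl
  rw [← volume_pi]
  conv_rhs => rw [← hLT]
  have hTL : Measurable fun z => (fun _ => x) + Matrix.toLin' M z := measurable_const.add hLm
  rw [Measure.map_map measurable_prodMk_left hTL,
    Measure.map_map h.measurable (measurable_prodMk_left.comp hTL)]
  congr 1
  funext z k
  refine Fin.cases ?_ (fun j => ?_) k
  · simp [MeasurableEquiv.piFinSuccAbove, Fin.insertNthEquiv, path_zero]
  · simp [MeasurableEquiv.piFinSuccAbove, Fin.insertNthEquiv, path]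
    simp [M, Matrix.mulVec, dotProduct]

end Path

/-! ### Equivalence of the increment law and Lebesgue measure -/

section IncrementLaw

/-- The law of an increment of the process over a time interval of length `δ`. -/
noncomputable def incrementLaw (θ σ lam : ℝ) (δ : ℝ≥0) : Measure ℝ :=
  ((gaussianReal 0 1).prod (poissonLaw (lam.toNNReal * δ))).map (incrementMap (θ - lam) σ √δ)

instance (θ σ lam : ℝ) (δ : ℝ≥0) : IsProbabilityMeasure (incrementLaw θ σ lam δ) :=
  Measure.isProbabilityMeasure_map (measurable_incrementMap _ _ _).aemeasurable

lemma map_affine_stdGaussian (d : ℝ) {s : ℝ} (hs : 0 ≤ s) :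
    (gaussianReal 0 1).map (fun x => d + s * x) = gaussianReal d (s.toNNReal ^ 2) := by
  have h := gaussianReal_const_add (gaussianReal_const_mul
    (HasLaw.id (μ := gaussianReal 0 1)) s) d
  have h' := h.map_eq
  simp only [id, mul_zero, zero_add, mul_one] at h'
  rw [h']
  congr 1
  ext
  simp [hs]

/-- Given the number of jumps, an increment is a nondegenerate Gaussian variable. Both absolute
continuity statements are read off these fibres. -/
lemma gaussianReal_incrementMap_section (a : ℝ) {σ u : ℝ} (hσ : 0 < σ) (hu : 0 < u) (y : ℝ)
    {s : Set ℝ} (hs : MeasurableSet s) :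
    gaussianReal 0 1 ((fun x => (x, y)) ⁻¹' (incrementMap a σ u ⁻¹' s))
      = gaussianReal (a * u ^ 2 + y) ((σ * u).toNNReal ^ 2) s := by
  rw [← map_affine_stdGaussian _ (by positivity), Measure.map_apply (by fun_prop) hs]
  congr 1
  ext x
  simp only [Set.mem_preimage, incrementMap]
  rw [add_right_comm]

variable {σ : ℝ} {δ : ℝ≥0}

lemma incrementLaw_absolutelyContinuous (θ lam : ℝ) (hσ : 0 < σ) (hδ : 0 < δ) :
    incrementLaw θ σ lam δ ≪ volume := by
  have hu : 0 < √(δ : ℝ) := Real.sqrt_pos.2 hδ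
  have hm := measurable_incrementMap (θ - lam) σ √δ
  have hv : (σ * √δ).toNNReal ^ 2 ≠ 0 := by
    have : 0 < (σ * √δ).toNNReal := Real.toNNReal_pos.2 (by positivity)
    positivity
  refine Measure.AbsolutelyContinuous.mk fun s hs h => ?_
  rw [incrementLaw, Measure.map_apply hm hs, Measure.prod_apply_symm (hm hs)]
  simp_rw [gaussianReal_incrementMap_section _ hσ hu _ hs]
  simp [gaussianReal_absolutelyContinuous _ hv h]

/-- A null set of the mixture is null for almost every Gaussian component, hence for at least one,
and one suffices. -/
lemma absolutelyContinuous_incrementLaw (θ lam : ℝ) (hσ : 0 < σ) (hδ : 0 < δ) :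
    volume ≪ incrementLaw θ σ lam δ := by
  have hu : 0 < √(δ : ℝ) := Real.sqrt_pos.2 hδ
  have hm := measurable_incrementMap (θ - lam) σ √δ
  have hv : (σ * √δ).toNNReal ^ 2 ≠ 0 := by
    have : 0 < (σ * √δ).toNNReal := Real.toNNReal_pos.2 (by positivity)
    positivity
  refine Measure.AbsolutelyContinuous.mk fun s hs h => ?_
  rw [incrementLaw, Measure.map_apply hm hs, Measure.prod_apply_symm (hm hs),
    lintegral_eq_zero_iff (measurable_measure_prodMk_right (hm hs))] at h
  obtain ⟨y, hy⟩ := h.exists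
  dsimp only at hy
  rw [gaussianReal_incrementMap_section _ hσ hu _ hs] at hy
  exact gaussianReal_absolutelyContinuous' _ hv hy

end IncrementLaw

/-! ### Independence of pairs -/

section Independence

variable {Ω E F : Type*} [MeasurableSpace Ω] [MeasurableSpace E] [MeasurableSpace F]
  {P : Measure Ω} [IsProbabilityMeasure P]

/-- The joint law is a product of two product measures; regrouping the coordinates into pairs turns
it into the product of the laws of the pairs. -/
lemma iIndepFun_prodMk {n : ℕ} {X : Fin n → Ω → E} {Y : Fin n → Ω → F}
    (hXm : ∀ k, AEMeasurable (X k) P) (hYm : ∀ k, AEMeasurable (Y k) P)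
    (hX : iIndepFun X P) (hY : iIndepFun Y P)
    (hXY : IndepFun (fun ω k => X k ω) (fun ω k => Y k ω) P) :
    iIndepFun (fun k ω => (X k ω, Y k ω)) P := by
  have hX' : AEMeasurable (fun ω k => X k ω) P := aemeasurable_pi_lambda _ hXm
  have hY' : AEMeasurable (fun ω k => Y k ω) P := aemeasurable_pi_lambda _ hYm
  have hpX : ∀ k, IsProbabilityMeasure (P.map (X k)) :=
    fun k => Measure.isProbabilityMeasure_map (hXm k)
  have hpY : ∀ k, IsProbabilityMeasure (P.map (Y k)) :=
    fun k => Measure.isProbabilityMeasure_map (hYm k)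
  have hpair : ∀ k, P.map (fun ω => (X k ω, Y k ω)) = (P.map (X k)).prod (P.map (Y k)) := fun k =>
    (indepFun_iff_map_prod_eq_prod_map_map (hXm k) (hYm k)).1
      (hXY.comp (measurable_pi_apply k) (measurable_pi_apply k))
  rw [iIndepFun_iff_map_fun_eq_pi_map fun k => (hXm k).prodMk (hYm k)]
  simp_rw [hpair]
  rw [← (measurePreserving_arrowProdEquivProdArrow E F (Fin n) (fun k => P.map (X k))
    (fun k => P.map (Y k))).symm.map_eq, ← (iIndepFun_iff_map_fun_eq_pi_map hXm).1 hX,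
    ← (iIndepFun_iff_map_fun_eq_pi_map hYm).1 hY,
    ← (indepFun_iff_map_prod_eq_prod_map_map hX' hY').1 hXY,
    AEMeasurable.map_map_of_aemeasurable (MeasurableEquiv.measurable _).aemeasurable
      (hX'.prodMk hY')]
  rfl

end Independence

/-! ### The hidden Brownian and Poisson increments -/

section Noise

variable {Ω : Type*} [MeasurableSpace Ω] {P : Measure Ω} {B M : ℝ≥0 → Ω → ℝ} {r δ : ℝ≥0}

/-- The normalized Brownian increment and the number of jumps over the `k`-th time interval. -/
noncomputable def noise (B M : ℝ≥0 → Ω → ℝ) (δ : ℝ≥0) (k : ℕ) (ω : Ω) : ℝ × ℝ :=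
  ((√δ)⁻¹ * (B ((k + 1 : ℕ) * δ) ω - B (k * δ) ω), M ((k + 1 : ℕ) * δ) ω - M (k * δ) ω)

lemma hasLaw_noise_fst (hB : IsBrownianReal B P) (hδ : 0 < δ) (k : ℕ) :
    HasLaw (fun ω => (noise B M δ k ω).1) (gaussianReal 0 1) P := by
  have h := gaussianReal_const_mul (hB.hasLaw_sub ((k + 1 : ℕ) * δ) (k * δ)) (√δ)⁻¹
  refine ⟨h.aemeasurable, h.map_eq.trans ?_⟩
  have hδ' : (0 : ℝ) < δ := hδ
  rw [mul_zero]
  congr 1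
  ext
  change ((√(δ : ℝ))⁻¹) ^ 2 * |(((k + 1 : ℕ) * δ : ℝ≥0) : ℝ) - ((k * δ : ℝ≥0) : ℝ)| = 1
  push_cast
  rw [show ((k : ℝ) + 1) * δ - k * δ = δ by ring, abs_of_pos hδ', inv_pow, Real.sq_sqrt hδ'.le,
    inv_mul_cancel₀ hδ'.ne']

lemma hasLaw_noise_snd (hM : IsPoissonProcess r M P) (δ : ℝ≥0) (k : ℕ) :
    HasLaw (fun ω => (noise B M δ k ω).2) (poissonLaw (r * δ)) P := by
  have h := hM.increments_law (k * δ) ((k + 1 : ℕ) * δ) (by gcongr; simp)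
  have e : ((k + 1 : ℕ) * δ - k * δ : ℝ≥0) = δ := by
    push_cast
    rw [add_mul, one_mul, add_tsub_cancel_left]
  rw [e] at h
  exact h

lemma monotone_natCast_mul (δ : ℝ≥0) : Monotone fun k : ℕ => (k * δ : ℝ≥0) := by
  intro i j h
  dsimp only
  gcongr

lemma indepFun_noise (hBM : IndepFun (fun ω t => B t ω) (fun ω t => M t ω) P) (δ : ℝ≥0) (n : ℕ) :
    IndepFun (fun ω (k : Fin n) => (noise B M δ k ω).1) (fun ω (k : Fin n) => (noise B M δ k ω).2)
      P :=
  hBM.comp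
    (φ := fun (b : ℝ≥0 → ℝ) (k : Fin n) => (√(δ : ℝ))⁻¹ * (b (((k : ℕ) + 1 : ℕ) * δ) - b ((k : ℕ) * δ)))
    (ψ := fun (b : ℝ≥0 → ℝ) (k : Fin n) => b (((k : ℕ) + 1 : ℕ) * δ) - b ((k : ℕ) * δ))
    (by fun_prop) (by fun_prop)

variable [IsProbabilityMeasure P]

lemma iIndepFun_noise (hB : IsBrownianReal B P) (hM : IsPoissonProcess r M P)
    (hBM : IndepFun (fun ω t => B t ω) (fun ω t => M t ω) P) (hδ : 0 < δ) (n : ℕ) :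
    iIndepFun (fun k : Fin n => noise B M δ k) P :=
  iIndepFun_prodMk (fun k => (hasLaw_noise_fst (M := M) hB hδ k).aemeasurable)
    (fun k => (hasLaw_noise_snd (B := B) hM δ k).aemeasurable)
    (((hB.hasIndepIncrements.nat (monotone_natCast_mul δ)).comp (fun _ y => (√δ)⁻¹ * y)
      (fun _ => by fun_prop)).precomp Fin.val_injective)
    ((hM.indep_increments.nat (monotone_natCast_mul δ)).precomp Fin.val_injective)
    (indepFun_noise hBM δ n)

lemma hasLaw_noise (hB : IsBrownianReal B P) (hM : IsPoissonProcess r M P)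
    (hBM : IndepFun (fun ω t => B t ω) (fun ω t => M t ω) P) (hδ : 0 < δ) (k : ℕ) :
    HasLaw (noise B M δ k) ((gaussianReal 0 1).prod (poissonLaw (r * δ))) P := by
  have h₁ := hasLaw_noise_fst (M := M) hB hδ k
  have h₂ := hasLaw_noise_snd (B := B) hM δ k
  refine ⟨h₁.aemeasurable.prodMk h₂.aemeasurable, ?_⟩
  rw [← h₁.map_eq, ← h₂.map_eq]
  -- A row of length `k + 1` is used, so that interval `k` is its last index.
  exact (indepFun_iff_map_prod_eq_prod_map_map h₁.aemeasurable h₂.aemeasurable).1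
    ((indepFun_noise hBM δ (k + 1)).comp (measurable_pi_apply (Fin.last k))
      (measurable_pi_apply (Fin.last k)))

end Noise

/-! ### Density of the observation and factorization of the likelihood -/

section Observation

variable {Ω : Type*} [MeasurableSpace Ω] {P : Measure Ω}
  {B : ℝ≥0 → Ω → ℝ} {N : ℝ → ℝ≥0 → Ω → ℝ} {x θ σ lam : ℝ} {δ : ℝ≥0} {n : ℕ}

/-- The identity is only almost sure because `B` and `N` are only almost surely zero at time zero.
-/
lemma observation_ae_eq (hB : IsBrownianReal B P)
    (hN : IsPoissonProcess lam.toNNReal (N lam) P) (x θ σ : ℝ) (n : ℕ) (δ : ℝ≥0) (hδ : 0 < δ) :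
    observation B N x θ σ lam n δ
      =ᵐ[P] fun ω => path x fun k : Fin n => incrementMap (θ - lam) σ √δ (noise B (N lam) δ k ω) := by
  filter_upwards [hB.eval_zero_ae_eq_zero, hN.start_zero] with ω h₁ h₂
  have h0 : observation B N x θ σ lam n δ ω 0 = x := by simp [observation, process, h₁, h₂]
  rw [eq_path_of_increments h0]
  congr 1
  funext k
  have hs : √(δ : ℝ) ≠ 0 := (Real.sqrt_pos.2 hδ).ne'
  simp only [observation, process, incrementMap, noise, Fin.val_succ, Fin.val_castSucc,
    Real.sq_sqrt (NNReal.coe_nonneg δ)]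
  push_cast
  rw [mul_assoc σ, mul_inv_cancel_left₀ hs]
  ring

/-- The density of an increment over a time interval of length `δ`. -/
noncomputable def incrementDensity (θ σ lam : ℝ) (δ : ℝ≥0) : ℝ → ℝ≥0∞ :=
  (incrementLaw θ σ lam δ).rnDeriv volume

lemma measurable_incrementDensity (θ σ lam : ℝ) (δ : ℝ≥0) :
    Measurable (incrementDensity θ σ lam δ) := Measure.measurable_rnDeriv _ _

lemma withDensity_incrementDensity (θ lam : ℝ) (hσ : 0 < σ) (hδ : 0 < δ) :
    volume.withDensity (incrementDensity θ σ lam δ) = incrementLaw θ σ lam δ :=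
  Measure.withDensity_rnDeriv_eq _ _ (incrementLaw_absolutelyContinuous θ lam hσ hδ)

lemma ae_incrementDensity (θ lam : ℝ) (hσ : 0 < σ) (hδ : 0 < δ) :
    ∀ᵐ y, 0 < incrementDensity θ σ lam δ y ∧ incrementDensity θ σ lam δ y ≠ ∞ :=
  (Measure.rnDeriv_pos' (absolutelyContinuous_incrementLaw θ lam hσ hδ)).and
    (Measure.rnDeriv_ne_top _ _)

/-- The density of a path whose increments are independent with density `incrementDensity`. -/
noncomputable def pathDensity (θ σ lam : ℝ) (δ : ℝ≥0) (n : ℕ) (y : Fin (n + 1) → ℝ) : ℝ≥0∞ :=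
  ∏ k : Fin n, incrementDensity θ σ lam δ (y k.succ - y k.castSucc)

lemma measurable_pathDensity (θ σ lam : ℝ) (δ : ℝ≥0) (n : ℕ) :
    Measurable (pathDensity θ σ lam δ n) := by
  have := measurable_incrementDensity θ σ lam δ
  unfold pathDensity
  fun_prop

lemma pathDensity_path (θ σ lam : ℝ) (δ : ℝ≥0) (x : ℝ) (z : Fin n → ℝ) :
    pathDensity θ σ lam δ n (path x z) = ∏ k, incrementDensity θ σ lam δ (z k) := by
  simp [pathDensity, path_succ]

lemma ae_pathDensity_pos (x θ lam : ℝ) (hσ : 0 < σ) (hδ : 0 < δ) (n : ℕ) :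
    ∀ᵐ y ∂refMeasure n x, 0 < pathDensity θ σ lam δ n y := by
  rw [← map_path_volume, ae_map_iff (measurable_path x n).aemeasurable
    (measurableSet_lt measurable_const (measurable_pathDensity θ σ lam δ n))]
  have h : ∀ k : Fin n, ∀ᵐ z ∂Measure.pi fun _ : Fin n => (volume : Measure ℝ),
      0 < incrementDensity θ σ lam δ (z k) := fun k =>
    (Measure.quasiMeasurePreserving_eval (fun _ : Fin n => (volume : Measure ℝ)) k).ae
      ((ae_incrementDensity θ lam hσ hδ).mono fun _ h => h.1)
  filter_upwards [ae_all_iff.2 h] with z hz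
  rw [pathDensity_path, pos_iff_ne_zero, Finset.prod_ne_zero_iff]
  exact fun k _ => (hz k).ne'

variable [IsProbabilityMeasure P]

lemma aemeasurable_observation (hB : IsBrownianReal B P)
    (hN : IsPoissonProcess lam.toNNReal (N lam) P)
    (hBN : IndepFun (fun ω t => B t ω) (fun ω t => N lam t ω) P) (x θ σ : ℝ) (n : ℕ)
    (hδ : 0 < δ) :
    AEMeasurable (observation B N x θ σ lam n δ) P :=
  ((measurable_path x n).comp_aemeasurable (aemeasurable_pi_lambda _ fun k : Fin n =>
    (measurable_incrementMap _ _ _).comp_aemeasurable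
      (hasLaw_noise hB hN hBN hδ k).aemeasurable)).congr
    (observation_ae_eq hB hN x θ σ n δ hδ).symm

/-- Independent increments have a product density, and `path x` carries Lebesgue measure to the
reference measure, so the density of the path is that product evaluated at its increments. -/
lemma map_observation (hB : IsBrownianReal B P) (hN : IsPoissonProcess lam.toNNReal (N lam) P)
    (hBN : IndepFun (fun ω t => B t ω) (fun ω t => N lam t ω) P) (x θ : ℝ) (hσ : 0 < σ) (n : ℕ)
    (hδ : 0 < δ) :
    P.map (observation B N x θ σ lam n δ)
      = (refMeasure n x).withDensity (pathDensity θ σ lam δ n) := by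
  have hm := measurable_incrementMap (θ - lam) σ √δ
  have hlaw : ∀ k : Fin n, HasLaw (fun ω => incrementMap (θ - lam) σ √δ (noise B (N lam) δ k ω))
      (incrementLaw θ σ lam δ) P := fun k =>
    HasLaw.comp ⟨hm.aemeasurable, rfl⟩ (hasLaw_noise hB hN hBN hδ k)
  have hind : iIndepFun (fun (k : Fin n) ω => incrementMap (θ - lam) σ √δ (noise B (N lam) δ k ω))
      P := (iIndepFun_noise hB hN hBN hδ n).comp (fun _ => incrementMap (θ - lam) σ √δ) fun _ => hm
  have hwd := withDensity_incrementDensity θ lam hσ hδ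
  have : SigmaFinite (volume.withDensity (incrementDensity θ σ lam δ)) := by
    rw [hwd]; infer_instance
  rw [Measure.map_congr (observation_ae_eq hB hN x θ σ n δ hδ), ← map_path_volume,
    ← map_withDensity_comp (measurable_path x n) (measurable_pathDensity θ σ lam δ n)]
  simp_rw [pathDensity_path]
  rw [← pi_withDensity volume (measurable_incrementDensity θ σ lam δ), hwd]
  have hpi := (iIndepFun_iff_map_fun_eq_pi_map fun k => (hlaw k).aemeasurable).1 hind
  simp_rw [(hlaw _).map_eq] at hpi
  rw [← hpi, AEMeasurable.map_map_of_aemeasurable (measurable_path x n).aemeasurable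
    (aemeasurable_pi_lambda _ fun k => (hlaw k).aemeasurable)]
  rfl

lemma hasPDF_observation (hB : IsBrownianReal B P) (hN : IsPoissonProcess lam.toNNReal (N lam) P)
    (hBN : IndepFun (fun ω t => B t ω) (fun ω t => N lam t ω) P) (x θ : ℝ) (hσ : 0 < σ) (n : ℕ)
    (hδ : 0 < δ) :
    HasPDF (observation B N x θ σ lam n δ) P (refMeasure n x) :=
  hasPDF_of_map_eq_withDensity (aemeasurable_observation hB hN hBN x θ σ n hδ) _
    (measurable_pathDensity θ σ lam δ n).aemeasurable (map_observation hB hN hBN x θ hσ n hδ)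

lemma density_ae_eq (hB : IsBrownianReal B P) (hN : IsPoissonProcess lam.toNNReal (N lam) P)
    (hBN : IndepFun (fun ω t => B t ω) (fun ω t => N lam t ω) P) (x θ : ℝ) (hσ : 0 < σ) (n : ℕ)
    (hδ : 0 < δ) :
    density P B N x n δ θ σ lam =ᵐ[refMeasure n x] pathDensity θ σ lam δ n := by
  have := hasPDF_observation hB hN hBN x θ hσ n hδ
  exact (pdf.eq_of_map_eq_withDensity _ (measurable_pathDensity θ σ lam δ n).aemeasurable).1
    (map_observation hB hN hBN x θ hσ n hδ)

lemma ae_density_pos (hB : IsBrownianReal B P) (hN : IsPoissonProcess lam.toNNReal (N lam) P)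
    (hBN : IndepFun (fun ω t => B t ω) (fun ω t => N lam t ω) P) (x θ : ℝ) (hσ : 0 < σ) (n : ℕ)
    (hδ : 0 < δ) :
    ∀ᵐ y ∂refMeasure n x, 0 < density P B N x n δ θ σ lam y := by
  filter_upwards [density_ae_eq hB hN hBN x θ hσ n hδ, ae_pathDensity_pos x θ lam hσ hδ n]
    with y h₁ h₂
  rwa [h₁]

lemma aemeasurable_logLikelihoodRatio (hB : IsBrownianReal B P)
    (hN : IsPoissonProcess lam.toNNReal (N lam) P)
    (hBN : IndepFun (fun ω t => B t ω) (fun ω t => N lam t ω) P) (x θ' σ' lam' θ σ : ℝ) (n : ℕ)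
    (hδ : 0 < δ) :
    AEMeasurable (logLikelihoodRatio P B N x n δ θ' σ' lam' θ σ lam) P := by
  have ho := aemeasurable_observation hB hN hBN x θ σ n hδ
  have hd : ∀ θ σ lam, Measurable (density P B N x n δ θ σ lam) := fun _ _ _ => measurable_pdf _ _ _
  exact (((hd θ' σ' lam').comp_aemeasurable ho).ennreal_toReal.div
    ((hd θ σ lam).comp_aemeasurable ho).ennreal_toReal).log

/-- The square root of the likelihood ratio of an increment. -/
noncomputable def sqrtRatio (θ' σ' lam' θ σ lam : ℝ) (δ : ℝ≥0) (y : ℝ) : ℝ :=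
  √((incrementDensity θ' σ' lam' δ y).toReal / (incrementDensity θ σ lam δ y).toReal)

lemma measurable_sqrtRatio (θ' σ' lam' θ σ lam : ℝ) (δ : ℝ≥0) :
    Measurable (sqrtRatio θ' σ' lam' θ σ lam δ) :=
  ((measurable_incrementDensity _ _ _ _).ennreal_toReal.div
    (measurable_incrementDensity _ _ _ _).ennreal_toReal).sqrt

lemma ae_sqrtRatio_pos {σ' : ℝ} (θ' lam' θ lam : ℝ) (hσ' : 0 < σ') (hσ : 0 < σ) (hδ : 0 < δ) :
    ∀ᵐ y, 0 < sqrtRatio θ' σ' lam' θ σ lam δ y := by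
  filter_upwards [ae_incrementDensity θ lam hσ hδ, ae_incrementDensity θ' lam' hσ' hδ]
    with y h₁ h₂
  exact Real.sqrt_pos.2 (div_pos (ENNReal.toReal_pos h₂.1.ne' h₂.2)
    (ENNReal.toReal_pos h₁.1.ne' h₁.2))

lemma incrementLaw_withDensity_sqrtRatio {σ' : ℝ} (θ' lam' θ lam : ℝ) (hσ' : 0 < σ') (hσ : 0 < σ)
    (hδ : 0 < δ) :
    (incrementLaw θ σ lam δ).withDensity
        (fun y => ENNReal.ofReal (sqrtRatio θ' σ' lam' θ σ lam δ y ^ 2))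
      = incrementLaw θ' σ' lam' δ := by
  rw [← withDensity_incrementDensity θ lam hσ hδ, ← withDensity_incrementDensity θ' lam' hσ' hδ,
    ← withDensity_mul _ (measurable_incrementDensity _ _ _ _)
      ((measurable_sqrtRatio _ _ _ _ _ _ _).pow_const 2).ennreal_ofReal]
  refine withDensity_congr_ae ?_
  filter_upwards [ae_incrementDensity θ lam hσ hδ, ae_incrementDensity θ' lam' hσ' hδ]
    with y h₁ h₂
  have hpos := ENNReal.toReal_pos h₁.1.ne' h₁.2
  rw [Pi.mul_apply, sqrtRatio, Real.sq_sqrt (by positivity)]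
  conv_lhs => rw [← ENNReal.ofReal_toReal h₁.2]
  rw [← ENNReal.ofReal_mul ENNReal.toReal_nonneg, ENNReal.toReal_ofReal ENNReal.toReal_nonneg,
    mul_div_cancel₀ _ hpos.ne', ENNReal.ofReal_toReal h₂.2]

/-- Both densities agree with products almost everywhere for the reference measure, hence at almost
every observation. The process of intensity `lam'` matters only through its law, so no joint law of
`N lam` and `N lam'` is involved. -/
lemma logLikelihoodRatio_ae_eq (hB : IsBrownianReal B P) {θ' σ' lam' : ℝ}
    (hN : IsPoissonProcess lam.toNNReal (N lam) P)
    (hBN : IndepFun (fun ω t => B t ω) (fun ω t => N lam t ω) P)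
    (hN' : IsPoissonProcess lam'.toNNReal (N lam') P)
    (hBN' : IndepFun (fun ω t => B t ω) (fun ω t => N lam' t ω) P) (x : ℝ) (hσ : 0 < σ)
    (hσ' : 0 < σ') (n : ℕ) (hδ : 0 < δ) :
    ∀ᵐ ω ∂P, logLikelihoodRatio P B N x n δ θ' σ' lam' θ σ lam ω
      = ∑ k : Fin n, 2 * Real.log (1 + (sqrtRatio θ' σ' lam' θ σ lam δ
          (incrementMap (θ - lam) σ √δ (noise B (N lam) δ k ω)) - 1)) := by
  have hpdf := hasPDF_observation hB hN hBN x θ hσ n hδ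
  have hac : P.map (observation B N x θ σ lam n δ) ≪ refMeasure n x := HasPDF.absolutelyContinuous
  have ho := aemeasurable_observation hB hN hBN x θ σ n hδ
  have h₁ := ae_of_ae_map ho (hac.ae_le (density_ae_eq hB hN hBN x θ hσ n hδ))
  have h₂ := ae_of_ae_map ho (hac.ae_le (density_ae_eq hB hN' hBN' x θ' hσ' n hδ))
  have hinc : ∀ k : Fin n, ∀ᵐ ω ∂P,
      (0 < incrementDensity θ σ lam δ (incrementMap (θ - lam) σ √δ (noise B (N lam) δ k ω)) ∧
        incrementDensity θ σ lam δ (incrementMap (θ - lam) σ √δ (noise B (N lam) δ k ω)) ≠ ∞) ∧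
      (0 < incrementDensity θ' σ' lam' δ (incrementMap (θ - lam) σ √δ (noise B (N lam) δ k ω)) ∧
        incrementDensity θ' σ' lam' δ (incrementMap (θ - lam) σ √δ (noise B (N lam) δ k ω))
          ≠ ∞) := by
    intro k
    have hl : HasLaw (fun ω => incrementMap (θ - lam) σ √δ (noise B (N lam) δ k ω))
        (incrementLaw θ σ lam δ) P :=
      HasLaw.comp ⟨(measurable_incrementMap _ _ _).aemeasurable, rfl⟩
        (hasLaw_noise hB hN hBN hδ k)
    refine ae_of_ae_map (p := fun y =>
      (0 < incrementDensity θ σ lam δ y ∧ incrementDensity θ σ lam δ y ≠ ∞) ∧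
        0 < incrementDensity θ' σ' lam' δ y ∧ incrementDensity θ' σ' lam' δ y ≠ ∞)
      hl.aemeasurable ?_
    rw [hl.map_eq]
    exact (incrementLaw_absolutelyContinuous θ lam hσ hδ).ae_le
      ((ae_incrementDensity θ lam hσ hδ).and (ae_incrementDensity θ' lam' hσ' hδ))
  filter_upwards [h₁, h₂, ae_all_iff.2 hinc, observation_ae_eq hB hN x θ σ n δ hδ]
    with ω e₁ e₂ h e
  rw [logLikelihoodRatio, e₁, e₂, e, pathDensity_path, pathDensity_path, ENNReal.toReal_prod,
    ENNReal.toReal_prod, ← Finset.prod_div_distrib, Real.log_prod]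
  · refine Finset.sum_congr rfl fun k _ => ?_
    rw [add_sub_cancel, sqrtRatio, Real.log_sqrt (by positivity)]
    ring
  · intro k _
    exact (div_pos (ENNReal.toReal_pos (h k).2.1.ne' (h k).2.2)
      (ENNReal.toReal_pos (h k).1.1.ne' (h k).1.2)).ne'

end Observation

/-! ### The likelihood ratio of the complete experiment -/

section FullRatio

/-- The square root of the likelihood ratio of the Brownian part and the number of jumps. -/
noncomputable def fullRatio (α β h : ℝ) (r r' : ℝ≥0) (e : ℝ × ℝ) : ℝ :=
  Real.exp (gaussianLogRatio α β h e.1 / 2) * Real.exp (poissonLogRatio r r' e.2 / 2)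

lemma measurable_fullRatio (α β h : ℝ) (r r' : ℝ≥0) : Measurable (fullRatio α β h r r') := by
  have h₁ := measurable_gaussianLogRatio α β h
  have h₂ := measurable_poissonLogRatio r r'
  unfold fullRatio
  fun_prop

lemma withDensity_fullRatio (α : ℝ) {β h : ℝ} {r r' : ℝ≥0} (hs : 0 < 1 + β * h) (hr : r ≠ 0)
    (hr' : r' ≠ 0) :
    ((gaussianReal 0 1).prod (poissonLaw r)).withDensity
        (fun e => ENNReal.ofReal (fullRatio α β h r r' e ^ 2))
      = (gaussianReal (α * h) (Real.toNNReal (1 + β * h) ^ 2)).prod (poissonLaw r') := by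
  have h₁ := measurable_gaussianLogRatio α β h
  have h₂ := measurable_poissonLogRatio r r'
  unfold fullRatio
  rw [prod_withDensity_sq_mul (q₁ := fun x => Real.exp (gaussianLogRatio α β h x / 2))
    (q₂ := fun y => Real.exp (poissonLogRatio r r' y / 2)) (by fun_prop) (by fun_prop),
    withDensity_gaussianLogRatio α hs, withDensity_poissonLogRatio hr hr']

/-- The increments have the law of the changed parameters after the change of measure. -/
lemma map_withDensity_fullRatio {α β h θ σ lam θ' σ' lam' : ℝ} {δ : ℝ≥0} (hs : 0 < 1 + β * h)
    (hlam : 0 < lam) (hlam' : 0 < lam') (hδ : 0 < δ) (hσ' : σ' = σ * (1 + β * h))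
    (hdrift : (θ' - lam') * √δ = (θ - lam) * √δ + σ * (α * h)) :
    (((gaussianReal 0 1).prod (poissonLaw (lam.toNNReal * δ))).withDensity
        (fun e => ENNReal.ofReal
          (fullRatio α β h (lam.toNNReal * δ) (lam'.toNNReal * δ) e ^ 2))).map
        (incrementMap (θ - lam) σ √δ)
      = incrementLaw θ' σ' lam' δ := by
  have hr : lam.toNNReal * δ ≠ 0 := (mul_pos (Real.toNNReal_pos.2 hlam) hδ).ne'
  have hr' : lam'.toNNReal * δ ≠ 0 := (mul_pos (Real.toNNReal_pos.2 hlam') hδ).ne'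
  rw [withDensity_fullRatio α hs hr hr', ← map_affine_stdGaussian (α * h) hs.le, incrementLaw]
  conv_lhs => rw [← Measure.map_id (μ := poissonLaw (lam'.toNNReal * δ))]
  rw [Measure.map_prod_map _ _ (by fun_prop) measurable_id,
    Measure.map_map (measurable_incrementMap _ _ _) (by fun_prop)]
  congr 1
  ext e
  simp only [Function.comp_apply, incrementMap, Prod.map, id, hσ']
  -- The drift enters as `(θ' - lam') * √δ ^ 2`, so `hdrift` is needed once more times `√δ`.
  linear_combination (-√(δ : ℝ)) * hdrift

end FullRatio

/-! ### Asymptotics of the complete experiment -/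

section Limits

lemma eventually_natCast_mul_sq_inv_sqrt : ∀ᶠ n : ℕ in atTop, (n : ℝ) * ((√(n : ℝ))⁻¹) ^ 2 = 1 := by
  filter_upwards [eventually_gt_atTop 0] with n hn
  have : (0 : ℝ) < n := by exact_mod_cast hn
  rw [inv_pow, Real.sq_sqrt this.le, mul_inv_cancel₀ this.ne']

lemma tendsto_inv_sqrt_natCast : Tendsto (fun n : ℕ => (√(n : ℝ))⁻¹) atTop (𝓝 0) :=
  (Real.tendsto_sqrt_atTop.comp tendsto_natCast_atTop_atTop).inv_tendsto_atTop

lemma memLp_two_gaussianScore (α β h : ℝ) :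
    MemLp (fun x => h * gaussianScore α β x) 2 (gaussianReal 0 1) :=
  ((memLp_four_gaussianScore α β).mono_exponent (by norm_num)).const_mul h

lemma memLp_two_poissonScore (κ : ℝ) (r : ℝ≥0) :
    MemLp (fun x : ℝ => κ * (x - r)) 2 (poissonLaw r) :=
  (show MemLp (fun x : ℝ => x - r) 2 (poissonLaw r) from
    mod_cast memLp_sub_poissonLaw r 2).const_mul κ

lemma memLp_four_poissonScore (κ : ℝ) (r : ℝ≥0) :
    MemLp (fun x : ℝ => κ * (x - r)) 4 (poissonLaw r) :=
  (show MemLp (fun x : ℝ => x - r) 4 (poissonLaw r) from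
    mod_cast memLp_sub_poissonLaw r 4).const_mul κ

lemma integral_sq_gaussianScore_mul (α β h : ℝ) :
    ∫ x, (h * gaussianScore α β x) ^ 2 ∂gaussianReal 0 1 = h ^ 2 * (α ^ 2 + 2 * β ^ 2) := by
  simp_rw [mul_pow]
  rw [integral_const_mul, integral_gaussianScore_sq]

lemma integral_sq_poissonScore (κ : ℝ) (r : ℝ≥0) :
    ∫ x, (κ * (x - r)) ^ 2 ∂poissonLaw r = κ ^ 2 * r := by
  simp_rw [mul_pow]
  rw [integral_const_mul, integral_sub_sq_poissonLaw]

lemma memLp_four_fullScore (α β h κ : ℝ) (r : ℝ≥0) :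
    MemLp (fullScore α β h κ r) 4 ((gaussianReal 0 1).prod (poissonLaw r)) :=
  (memLp_comp_fst ((memLp_four_gaussianScore α β).const_mul h)).add
    (memLp_comp_snd (memLp_four_poissonScore κ r))

lemma integral_fullScore (α β h κ : ℝ) (r : ℝ≥0) :
    ∫ e, fullScore α β h κ r e ∂(gaussianReal 0 1).prod (poissonLaw r) = 0 := by
  have i₂ : Integrable (fun x : ℝ => x) (poissonLaw r) :=
    (memLp_id_poissonLaw r 1).integrable (by norm_num)
  refine (integral_add_prod ((memLp_two_gaussianScore α β h).integrable (by norm_num))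
    ((memLp_two_poissonScore κ r).integrable (by norm_num))).trans ?_
  rw [integral_const_mul, integral_const_mul, integral_gaussianScore,
    integral_sub i₂ (integrable_const _), integral_id_poissonLaw]
  simp

variable {α β p R : ℝ} {κ : ℕ → ℝ} {r r' : ℕ → ℝ≥0}

/-- The cross term vanishes because the scores are independent and centred, and `n h² = 1` makes the
Gaussian contribution constant. -/
lemma tendsto_integral_fullScore_sq
    (hp : Tendsto (fun n : ℕ => (n : ℝ) * (κ n ^ 2 * r n)) atTop (𝓝 p)) :
    Tendsto (fun n : ℕ => (n : ℝ) * ∫ e, fullScore α β (√(n : ℝ))⁻¹ (κ n) (r n) e ^ 2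
      ∂(gaussianReal 0 1).prod (poissonLaw (r n))) atTop (𝓝 (α ^ 2 + 2 * β ^ 2 + p)) := by
  refine (tendsto_const_nhds.add hp).congr' ?_
  filter_upwards [eventually_natCast_mul_sq_inv_sqrt] with n hn
  have h := integral_add_sq_prod (memLp_two_gaussianScore α β (√(n : ℝ))⁻¹)
    (memLp_two_poissonScore (κ n) (r n)) (by rw [integral_const_mul, integral_gaussianScore, mul_zero])
  rw [integral_sq_gaussianScore_mul, integral_sq_poissonScore] at h
  unfold fullScore
  rw [h]
  linear_combination (-(α ^ 2 + 2 * β ^ 2)) * hn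

/-- The Gaussian part contributes `n h⁴ = 1 / n`. For bounded rates the fourth central Poisson
moment is `O(r)`, so the Poisson part contributes `O((n κ² r) κ²)`. -/
lemma tendsto_integral_fullScore_pow_four (hR : ∀ n, (r n : ℝ) ≤ R) (hκ : Tendsto κ atTop (𝓝 0))
    (hp : Tendsto (fun n : ℕ => (n : ℝ) * (κ n ^ 2 * r n)) atTop (𝓝 p)) :
    Tendsto (fun n : ℕ => (n : ℝ) * ∫ e, fullScore α β (√(n : ℝ))⁻¹ (κ n) (r n) e ^ 4
      ∂(gaussianReal 0 1).prod (poissonLaw (r n))) atTop (𝓝 0) := by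
  set M := ∫ x, gaussianScore α β x ^ 4 ∂gaussianReal 0 1 with hM
  set C := 400 * Real.exp (2 * R) + 8 * R ^ 3 with hC
  have hlim : Tendsto (fun n : ℕ => 8 * M * ((√(n : ℝ))⁻¹) ^ 2
      + 8 * C * ((n : ℝ) * (κ n ^ 2 * r n)) * κ n ^ 2) atTop (𝓝 0) := by
    have := ((tendsto_inv_sqrt_natCast.pow 2).const_mul (8 * M)).add
      ((hp.const_mul (8 * C)).mul (hκ.pow 2))
    simpa using this
  refine squeeze_zero' (Eventually.of_forall fun n => ?_) ?_ hlim
  · exact mul_nonneg (Nat.cast_nonneg n) (integral_nonneg fun _ => by positivity)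
  filter_upwards [eventually_natCast_mul_sq_inv_sqrt] with n hn
  have h := integral_add_pow_four_prod_le
    ((memLp_four_gaussianScore α β).const_mul (√(n : ℝ))⁻¹) (memLp_four_poissonScore (κ n) (r n))
  simp only [mul_pow _ _ 4] at h
  rw [integral_const_mul, integral_const_mul, ← hM] at h
  have h4 := integral_sub_pow_four_poissonLaw_le (hR n)
  rw [← hC] at h4
  have hn0 : (0 : ℝ) ≤ n := Nat.cast_nonneg n
  calc (n : ℝ) * ∫ e, fullScore α β (√(n : ℝ))⁻¹ (κ n) (r n) e ^ 4
        ∂(gaussianReal 0 1).prod (poissonLaw (r n))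
      ≤ n * (8 * (((√(n : ℝ))⁻¹) ^ 4 * M) + 8 * (κ n ^ 4 * (C * r n))) := by
        gcongr
        refine h.trans ?_
        gcongr
    _ = 8 * M * (((√(n : ℝ))⁻¹) ^ 2 * (n * ((√(n : ℝ))⁻¹) ^ 2))
        + 8 * C * ((n : ℝ) * (κ n ^ 2 * r n)) * κ n ^ 2 := by ring
    _ = _ := by rw [hn]; ring

/-- With `b = √(1 + κ) - 1` one has `|b| ≤ |κ|`, so the explicit bound is `O((n κ² r) κ²)`. -/
lemma tendsto_integral_poisson_remainder (hr : ∀ n, r n ≠ 0)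
    (hr' : ∀ᶠ n in atTop, (r' n : ℝ) = r n * (1 + κ n)) (hR : ∀ n, (r n : ℝ) ≤ R)
    (hκ : Tendsto κ atTop (𝓝 0))
    (hp : Tendsto (fun n : ℕ => (n : ℝ) * (κ n ^ 2 * r n)) atTop (𝓝 p)) :
    Tendsto (fun n : ℕ => (n : ℝ) * ∫ x, (2 * (Real.exp (poissonLogRatio (r n) (r' n) x / 2) - 1)
      - κ n * (x - r n)) ^ 2 ∂poissonLaw (r n)) atTop (𝓝 0) := by
  have hlim : Tendsto (fun n : ℕ => (n : ℝ) * (κ n ^ 2 * r n) * ((1 + 6 * R) * κ n ^ 2))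
      atTop (𝓝 0) := by
    simpa using hp.mul ((hκ.pow 2).const_mul (1 + 6 * R))
  refine squeeze_zero' (Eventually.of_forall fun n => ?_) ?_ hlim
  · exact mul_nonneg (Nat.cast_nonneg n) (integral_nonneg fun _ => by positivity)
  have hsmall : ∀ᶠ n in atTop, -1 < κ n ∧ κ n < 1 :=
    (hκ.eventually (lt_mem_nhds (by norm_num))).and (hκ.eventually (gt_mem_nhds (by norm_num)))
  filter_upwards [hr', hsmall] with n hn ⟨hκ1, hκ2⟩
  have hrpos : (0 : ℝ) < r n := by
    have := pos_iff_ne_zero.2 (hr n)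
    exact_mod_cast this
  have hr'0 : r' n ≠ 0 := by
    have h0 : (0 : ℝ) < r' n := by
      rw [hn]
      exact mul_pos hrpos (by linarith)
    exact fun h => h0.ne' (by rw [h]; rfl)
  set b := √(1 + κ n) - 1 with hb
  have hbsq : (1 + b) ^ 2 = 1 + κ n := by
    rw [hb, add_sub_cancel, Real.sq_sqrt (by linarith)]
  have hb0 : -1 < b := by
    have := Real.sqrt_pos.2 (show 0 < 1 + κ n by linarith)
    linarith
  have hb1 : b ≤ 1 := by nlinarith
  have hbκ : b ^ 2 ≤ κ n ^ 2 := by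
    have e : κ n = b * (b + 2) := by linarith [hbsq, show (1 + b) ^ 2 = 1 + b * (b + 2) by ring]
    rw [e, mul_pow]
    exact le_mul_of_one_le_right (sq_nonneg _) (by nlinarith)
  have hb4 : b ^ 4 ≤ κ n ^ 4 := by
    calc b ^ 4 = (b ^ 2) ^ 2 := by ring
      _ ≤ (κ n ^ 2) ^ 2 := by gcongr
      _ = _ := by ring
  have h := integral_poisson_remainder_le (hr n) hr'0 hb0 (by rw [hn, hbsq])
  rw [hn, mul_div_cancel_left₀ _ hrpos.ne', add_sub_cancel_left] at h
  have hRn := hR n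
  calc (n : ℝ) * ∫ x, (2 * (Real.exp (poissonLogRatio (r n) (r' n) x / 2) - 1)
        - κ n * (x - r n)) ^ 2 ∂poissonLaw (r n)
      ≤ n * ((r n : ℝ) * b ^ 4 + 2 * (b + 2) * (r n : ℝ) ^ 2 * b ^ 4) := by gcongr
    _ = n * ((r n : ℝ) * b ^ 4 * (1 + 2 * (b + 2) * r n)) := by ring
    _ ≤ n * ((r n : ℝ) * κ n ^ 4 * (1 + 2 * (1 + 2) * R)) := by
        have : 0 ≤ b + 2 := by linarith
        gcongr
    _ = _ := by ring

/-- The two separate remainders vanish after multiplication by `n`; the cross term is `n` times a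
product of two quantities of order `1 / n`. -/
lemma tendsto_integral_fullRatio_remainder (hr : ∀ n, r n ≠ 0)
    (hr' : ∀ᶠ n in atTop, (r' n : ℝ) = r n * (1 + κ n)) (hR : ∀ n, (r n : ℝ) ≤ R)
    (hκ : Tendsto κ atTop (𝓝 0))
    (hp : Tendsto (fun n : ℕ => (n : ℝ) * (κ n ^ 2 * r n)) atTop (𝓝 p)) :
    Tendsto (fun n : ℕ => (n : ℝ) * ∫ e, (2 * (fullRatio α β (√(n : ℝ))⁻¹ (r n) (r' n) e - 1)
      - fullScore α β (√(n : ℝ))⁻¹ (κ n) (r n) e) ^ 2 ∂(gaussianReal 0 1).prod (poissonLaw (r n)))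
      atTop (𝓝 0) := by
  set h : ℕ → ℝ := fun n => (√(n : ℝ))⁻¹ with hh
  have hhlim : Tendsto h atTop (𝓝 0) := tendsto_inv_sqrt_natCast
  have hhpos : ∀ᶠ n in atTop, 0 < h n := by
    filter_upwards [eventually_gt_atTop 0] with n hn
    have : (0 : ℝ) < n := by exact_mod_cast hn
    positivity
  set ε : ℕ → ℝ := fun n => ∫ x, ((2 * (Real.exp (gaussianLogRatio α β (h n) x / 2) - 1)
    - h n * gaussianScore α β x) / h n) ^ 2 ∂gaussianReal 0 1 with hε
  have hεlim : Tendsto ε atTop (𝓝 0) := tendsto_integral_gaussian_remainder α β hhpos hhlim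
  set a : ℕ → ℝ := fun n => ∫ x, (2 * (Real.exp (poissonLogRatio (r n) (r' n) x / 2) - 1)
    - κ n * (x - r n)) ^ 2 ∂poissonLaw (r n) with ha
  have halim : Tendsto (fun n : ℕ => (n : ℝ) * a n) atTop (𝓝 0) :=
    tendsto_integral_poisson_remainder hr hr' hR hκ hp
  have hlim : Tendsto (fun n : ℕ => 3 * ε n + 3 * ((n : ℝ) * a n)
      + 3 * ((ε n + (α ^ 2 + 2 * β ^ 2)) * (((n : ℝ) * a n + n * (κ n ^ 2 * r n)) * h n ^ 2)))
      atTop (𝓝 0) := by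
    have := ((hεlim.const_mul 3).add (halim.const_mul 3)).add
      (((hεlim.add_const (α ^ 2 + 2 * β ^ 2)).mul ((halim.add hp).mul (hhlim.pow 2))).const_mul 3)
    simpa using this
  refine squeeze_zero' (Eventually.of_forall fun n => ?_) ?_ hlim
  · exact mul_nonneg (Nat.cast_nonneg n) (integral_nonneg fun _ => by positivity)
  have hβ : ∀ᶠ n in atTop, 0 < 1 + β * h n := by
    have : Tendsto (fun n => 1 + β * h n) atTop (𝓝 (1 + β * 0)) := (hhlim.const_mul β).const_add 1
    exact this.eventually (lt_mem_nhds (by norm_num))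
  have hκ1 : ∀ᶠ n in atTop, -1 < κ n := hκ.eventually (lt_mem_nhds (by norm_num))
  filter_upwards [eventually_natCast_mul_sq_inv_sqrt, hhpos, hβ, hr', hκ1] with n hn hpos hβn hrn hκn
  have hr'0 : r' n ≠ 0 := by
    have hrpos : (0 : ℝ) < r n := by exact_mod_cast pos_iff_ne_zero.2 (hr n)
    have h0 : (0 : ℝ) < r' n := by
      rw [hrn]
      exact mul_pos hrpos (by linarith)
    exact fun h => h0.ne' (by rw [h]; rfl)
  have hm₁ := measurable_gaussianLogRatio α β (h n)
  have hm₂ := measurable_poissonLogRatio (r n) (r' n)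
  have hq₁ : MemLp (fun x => Real.exp (gaussianLogRatio α β (h n) x / 2)) 2 (gaussianReal 0 1) :=
    memLp_two_of_withDensity_sq (by fun_prop) (by
      rw [withDensity_gaussianLogRatio α hβn]; infer_instance)
  have hq₂ : MemLp (fun x => Real.exp (poissonLogRatio (r n) (r' n) x / 2)) 2 (poissonLaw (r n)) :=
    memLp_two_of_withDensity_sq (by fun_prop) (by
      rw [withDensity_poissonLogRatio (hr n) hr'0]; infer_instance)
  have hle := integral_prod_remainder_le hq₁ (memLp_two_gaussianScore α β (h n)) hq₂
    (memLp_two_poissonScore (κ n) (r n))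
  have ha₁ : ∫ x, (2 * (Real.exp (gaussianLogRatio α β (h n) x / 2) - 1)
      - h n * gaussianScore α β x) ^ 2 ∂gaussianReal 0 1 = h n ^ 2 * ε n := by
    rw [hε]
    simp only [div_pow]
    rw [integral_div]
    field_simp
  rw [ha₁, integral_sq_gaussianScore_mul, integral_sq_poissonScore] at hle
  have hn0 : (0 : ℝ) ≤ n := Nat.cast_nonneg n
  refine (mul_le_mul_of_nonneg_left hle hn0).trans_eq ?_
  change _ * h n ^ 2 = 1 at hn
  change (n : ℝ) * (3 * (h n ^ 2 * ε n) + 3 * a n + 3 * ((h n ^ 2 * ε n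
    + h n ^ 2 * (α ^ 2 + 2 * β ^ 2)) * (a n + κ n ^ 2 * r n))) = _
  linear_combination (3 * ε n) * hn

end Limits

/-! ### Fisher information and the Gaussian limit -/

section GaussianLimit

/-- Completing the square: the information is diagonal in the shift, the scale and the relative
intensity of the complete experiment. Positivity and the limiting variance are both read off here.
-/
lemma dotProduct_fisherInfo {σ lam : ℝ} (hσ : 0 < σ) (hlam : 0 < lam) (z : Fin 3 → ℝ) :
    z ⬝ᵥ (fisherInfo σ lam *ᵥ z)
      = ((z 0 - z 2) / σ) ^ 2 + 2 * (z 1 / σ) ^ 2 + lam * (z 2 / lam) ^ 2 := by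
  simp only [fisherInfo, dotProduct, Matrix.mulVec, Fin.sum_univ_three, Matrix.smul_apply,
    Matrix.of_apply, Matrix.cons_val', Matrix.cons_val_zero, Matrix.cons_val_one,
    Matrix.cons_val, smul_eq_mul]
  field_simp
  ring

lemma posSemidef_fisherInfo {σ lam : ℝ} (hσ : 0 < σ) (hlam : 0 < lam) :
    (fisherInfo σ lam).PosSemidef := by
  refine Matrix.PosSemidef.of_dotProduct_mulVec_nonneg ?_ fun z => ?_
  · ext i j
    fin_cases i <;> fin_cases j <;> simp [fisherInfo]
  · rw [star_trivial, dotProduct_fisherInfo hσ hlam]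
    positivity

lemma hasLaw_dotProduct_multivariateGaussian {ι : Type*} [Fintype ι] [DecidableEq ι]
    {S : Matrix ι ι ℝ} (hS : S.PosSemidef) (z : ι → ℝ) {τ : ℝ≥0} (hτ : z ⬝ᵥ (S *ᵥ z) = τ) :
    HasLaw (fun G : EuclideanSpace ℝ ι => z ⬝ᵥ G.ofLp) (gaussianReal 0 τ)
      (multivariateGaussian 0 S) := by
  have hm : Measurable fun G : EuclideanSpace ℝ ι => z ⬝ᵥ G.ofLp := by
    unfold dotProduct
    fun_prop
  have := Measure.isProbabilityMeasure_map (μ := multivariateGaussian 0 S) hm.aemeasurable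
  refine ⟨hm.aemeasurable, Measure.ext_of_charFun ?_⟩
  ext t
  have h := charFun_multivariateGaussian (μ := 0) hS (t • WithLp.toLp 2 z)
  rw [charFun_apply] at h
  rw [charFun_apply, integral_map hm.aemeasurable (by fun_prop), charFun_gaussianReal]
  refine (integral_congr_ae (ae_of_all _ fun G => ?_)).trans (h.trans ?_)
  · simp [inner_smul_right, EuclideanSpace.inner_eq_star_dotProduct]
  · simp only [inner_zero_right, Complex.ofReal_zero, mul_zero, zero_mul, WithLp.ofLp_smul,
      Matrix.mulVec_smul, dotProduct_smul, smul_dotProduct, hτ, smul_eq_mul]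
    push_cast
    ring_nf

end GaussianLimit

/-! ### From the complete experiment to the increments -/

section LAN

/-- The local parameters are admissible only for large `n`, so the product formula is available only
eventually, while measurability is required for every `n`. -/
lemma tendstoInDistribution_congr_eventually {Ω Ω' : Type*} [MeasurableSpace Ω] [MeasurableSpace Ω']
    {P : Measure Ω} [IsProbabilityMeasure P] {P' : Measure Ω'} [IsProbabilityMeasure P']
    {X Y : ℕ → Ω → ℝ} {Z : Ω' → ℝ}
    (h : TendstoInDistribution X atTop Z (fun _ => P) P') (hY : ∀ n, AEMeasurable (Y n) P)
    (hXY : ∀ᶠ n in atTop, X n =ᵐ[P] Y n) :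
    TendstoInDistribution Y atTop Z (fun _ => P) P' :=
  ⟨hY, h.aemeasurable_limit, h.tendsto.congr' (hXY.mono fun _ hn =>
    Subtype.ext (Measure.map_congr hn))⟩

variable {θ σ lam θ' σ' lam' : ℝ} {δ : ℝ≥0}

lemma isProbabilityMeasure_withDensity_sqrtRatio (hσ : 0 < σ) (hσ' : 0 < σ') (hδ : 0 < δ) :
    IsProbabilityMeasure ((incrementLaw θ σ lam δ).withDensity
      fun y => ENNReal.ofReal (sqrtRatio θ' σ' lam' θ σ lam δ y ^ 2)) := by
  rw [incrementLaw_withDensity_sqrtRatio θ' lam' θ lam hσ' hσ hδ]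
  infer_instance

lemma memLp_sqrtRatio_sub_one (hσ : 0 < σ) (hσ' : 0 < σ') (hδ : 0 < δ) :
    MemLp (fun e => sqrtRatio θ' σ' lam' θ σ lam δ (incrementMap (θ - lam) σ √δ e) - 1) 2
      ((gaussianReal 0 1).prod (poissonLaw (lam.toNNReal * δ))) :=
  ((memLp_two_of_withDensity_sq (measurable_sqrtRatio _ _ _ _ _ _ _)
    (isProbabilityMeasure_withDensity_sqrtRatio hσ hσ' hδ)).comp_of_map
      (measurable_incrementMap _ _ _).aemeasurable).sub (memLp_const 1)

lemma integral_sqrtRatio_sub_one (hσ : 0 < σ) (hσ' : 0 < σ') (hδ : 0 < δ) :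
    ∫ e, (sqrtRatio θ' σ' lam' θ σ lam δ (incrementMap (θ - lam) σ √δ e) - 1)
        ∂(gaussianReal 0 1).prod (poissonLaw (lam.toNNReal * δ))
      = -(1 / 2) * ∫ e, (sqrtRatio θ' σ' lam' θ σ lam δ (incrementMap (θ - lam) σ √δ e) - 1) ^ 2
        ∂(gaussianReal 0 1).prod (poissonLaw (lam.toNNReal * δ)) := by
  refine integral_sqrt_sub_one (memLp_sqrtRatio_sub_one hσ hσ' hδ) ?_
  have hm := measurable_sqrtRatio θ' σ' lam' θ σ lam δ
  have h := integral_sq_eq_one_of_withDensity hm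
    (isProbabilityMeasure_withDensity_sqrtRatio (θ := θ) (lam := lam) hσ hσ' hδ)
  rw [incrementLaw, integral_map (measurable_incrementMap _ _ _).aemeasurable (by fun_prop)] at h
  simpa using h

/-- The square root of the likelihood ratio of an increment is expanded with the score of the
unobserved Brownian part and number of jumps. -/
lemma integral_sqrtRatio_remainder_le {α β h c : ℝ} (hσ : 0 < σ) (hlam : 0 < lam)
    (hlam' : 0 < lam') (hδ : 0 < δ) (hδ1 : δ ≤ 1) (hs : 0 < 1 + β * h)
    (hσ' : σ' = σ * (1 + β * h))
    (hdrift : (θ' - lam') * √δ = (θ - lam) * √δ + σ * (α * h)) :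
    ∫ e, (2 * (sqrtRatio θ' σ' lam' θ σ lam δ (incrementMap (θ - lam) σ √δ e) - 1)
        - fullScore α β h (h * c / √δ) (lam.toNNReal * δ : ℝ≥0) e) ^ 2
        ∂(gaussianReal 0 1).prod (poissonLaw (lam.toNNReal * δ))
      ≤ 15 * ∫ e, (2 * (fullRatio α β h (lam.toNNReal * δ) (lam'.toNNReal * δ) e - 1)
          - fullScore α β h (h * c / √δ) (lam.toNNReal * δ : ℝ≥0) e) ^ 2
          ∂(gaussianReal 0 1).prod (poissonLaw (lam.toNNReal * δ))
        + 12 * (128 * (4 * |α| / σ + |β| * (8 + 8 * |θ - lam|) / σ ^ 2 + 4 * |c|) ^ 2 * h ^ 2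
          * √δ ^ 2 * ((θ - lam) ^ 6 + σ ^ 6 * ∫ x, x ^ 6 ∂gaussianReal 0 1)) := by
  have hσ'0 : 0 < σ' := by rw [hσ']; positivity
  have hu : 0 < √(δ : ℝ) := Real.sqrt_pos.2 hδ
  have hu1 : √(δ : ℝ) ≤ 1 := Real.sqrt_le_iff.2 ⟨zero_le_one, by simpa using hδ1⟩
  have hr : lam.toNNReal * δ ≠ 0 := (mul_pos (Real.toNNReal_pos.2 hlam) hδ).ne'
  have hr' : lam'.toNNReal * δ ≠ 0 := (mul_pos (Real.toNNReal_pos.2 hlam') hδ).ne'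
  obtain ⟨hmem, hint⟩ := memLp_integral_fullScore_sub_roundedScore (α := α) (β := β) (h := h)
    (a := θ - lam) (c := c) (lam.toNNReal * δ) hσ hu hu1
  refine (integral_marginal_score_sq_le (measurable_incrementMap _ _ _)
    (measurable_fullRatio α β h (lam.toNNReal * δ) (lam'.toNNReal * δ))
    (fun e => by unfold fullRatio; positivity) (measurable_sqrtRatio θ' σ' lam' θ σ lam δ) ?_
    (measurable_roundedScore α β h (h * c / √δ) (lam.toNNReal * δ : ℝ≥0) (θ - lam) σ √δ)
    ((memLp_four_fullScore α β h _ _).mono_exponent (by norm_num)) hmem ?_ ?_).trans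
    (by gcongr)
  · exact (incrementLaw_absolutelyContinuous θ lam hσ hδ).ae_le
      (ae_sqrtRatio_pos θ' lam' θ lam hσ'0 hσ hδ)
  · rw [withDensity_fullRatio α hs hr hr']
    infer_instance
  · rw [map_withDensity_fullRatio hs hlam hlam' hδ hσ' hdrift]
    exact (incrementLaw_withDensity_sqrtRatio θ' lam' θ lam hσ'0 hσ hδ).symm

end LAN

/-! ### Local asymptotic normality in normalized parameters -/

section LocalAsymptoticNormality

variable {Ω : Type*} [MeasurableSpace Ω] {P : Measure Ω} [IsProbabilityMeasure P]
  {B : ℝ≥0 → Ω → ℝ} {N : ℝ → ℝ≥0 → Ω → ℝ} {Δ : ℕ → ℝ≥0}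

/-- The relative change of intensity is `c / √(n Δ_n)`; it vanishes because the expected number of
jumps diverges. -/
lemma tendsto_localJumpParameter (hnΔ : Tendsto (fun n : ℕ => (n : ℝ) * (Δ n : ℝ)) atTop atTop)
    (c : ℝ) :
    Tendsto (fun n : ℕ => (√(n : ℝ))⁻¹ * c / √(Δ n : ℝ)) atTop (𝓝 0) := by
  have h : Tendsto (fun n : ℕ => c * (√((n : ℝ) * (Δ n : ℝ)))⁻¹) atTop (𝓝 (c * 0)) :=
    ((Real.tendsto_sqrt_atTop.comp hnΔ).inv_tendsto_atTop).const_mul c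
  rw [mul_zero] at h
  refine h.congr fun n => ?_
  rw [Real.sqrt_mul (Nat.cast_nonneg n), mul_inv, div_eq_mul_inv]
  ring

/-- The squared relative change `c² / (n Δ_n)` meets the Poisson variance `lam * Δ_n`, so the sum
over a row is constant for `n > 0`. -/
lemma tendsto_localJumpInformation (hΔ_pos : ∀ n, 0 < Δ n) {lam : ℝ} (hlam : 0 < lam) (c : ℝ) :
    Tendsto (fun n : ℕ => (n : ℝ) * (((√(n : ℝ))⁻¹ * c / √(Δ n : ℝ)) ^ 2
      * (lam.toNNReal * Δ n : ℝ≥0))) atTop (𝓝 (lam * c ^ 2)) := by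
  refine tendsto_const_nhds.congr' ?_
  filter_upwards [eventually_gt_atTop 0] with n hn
  have hn' : (0 : ℝ) < n := by exact_mod_cast hn
  have hΔ' : (0 : ℝ) < Δ n := hΔ_pos n
  rw [div_pow, mul_pow, inv_pow, Real.sq_sqrt hn'.le, Real.sq_sqrt hΔ'.le, NNReal.coe_mul,
    Real.coe_toNNReal _ hlam.le]
  field_simp

/-- Local asymptotic normality in terms of the normalized local parameters. -/
theorem tendstoInDistribution_sum_log_sqrtRatio (hB : IsBrownianReal B P)
    (hΔ_pos : ∀ n, 0 < Δ n) (hΔ_le : ∀ n, Δ n ≤ 1)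
    (hnΔ : Tendsto (fun n : ℕ => (n : ℝ) * (Δ n : ℝ)) atTop atTop)
    (hΔ : Tendsto Δ atTop (𝓝 0)) {θ σ lam : ℝ} (hσ : 0 < σ) (hlam : 0 < lam)
    (hN : IsPoissonProcess lam.toNNReal (N lam) P)
    (hBN : IndepFun (fun ω t => B t ω) (fun ω t => N lam t ω) P)
    {θ' σ' lam' : ℕ → ℝ} {α β c : ℝ} (hσ' : ∀ n : ℕ, σ' n = σ * (1 + β * (√(n : ℝ))⁻¹))
    (hlam' : ∀ n : ℕ, lam' n = lam * (1 + (√(n : ℝ))⁻¹ * c / √(Δ n)))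
    (hdrift : ∀ n : ℕ, (θ' n - lam' n) * √(Δ n) = (θ - lam) * √(Δ n) + σ * (α * (√(n : ℝ))⁻¹))
    {τ : ℝ≥0} (hτ : (τ : ℝ) = α ^ 2 + 2 * β ^ 2 + lam * c ^ 2)
    {Ω' : Type*} [MeasurableSpace Ω'] {P' : Measure Ω'} [IsProbabilityMeasure P'] {Y : Ω' → ℝ}
    (hY : HasLaw Y (gaussianReal 0 τ) P') :
    TendstoInDistribution (fun (n : ℕ) ω => ∑ k : Fin n, 2 * Real.log (1 +
        (sqrtRatio (θ' n) (σ' n) (lam' n) θ σ lam (Δ n)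
          (incrementMap (θ - lam) σ √(Δ n) (noise B (N lam) (Δ n) k ω)) - 1)))
      atTop (fun ω => Y ω - τ / 2) (fun _ => P) P' := by
  set h : ℕ → ℝ := fun n => (√(n : ℝ))⁻¹ with hh
  set κ : ℕ → ℝ := fun n => h n * c / √(Δ n : ℝ) with hκ
  set r : ℕ → ℝ≥0 := fun n => lam.toNNReal * Δ n with hr
  have hκlim : Tendsto κ atTop (𝓝 0) := tendsto_localJumpParameter hnΔ c
  have hp : Tendsto (fun n : ℕ => (n : ℝ) * (κ n ^ 2 * r n)) atTop (𝓝 (lam * c ^ 2)) :=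
    tendsto_localJumpInformation hΔ_pos hlam c
  have hr0 : ∀ n, r n ≠ 0 := fun n => (mul_pos (Real.toNNReal_pos.2 hlam) (hΔ_pos n)).ne'
  have hrR : ∀ n, (r n : ℝ) ≤ lam := by
    intro n
    rw [hr, NNReal.coe_mul, Real.coe_toNNReal _ hlam.le]
    exact mul_le_of_le_one_right hlam.le (by exact_mod_cast hΔ_le n)
  have hs : ∀ᶠ n in atTop, 0 < 1 + β * h n := by
    have : Tendsto (fun n => 1 + β * h n) atTop (𝓝 (1 + β * 0)) :=
      (tendsto_inv_sqrt_natCast.const_mul β).const_add 1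
    exact this.eventually (lt_mem_nhds (by norm_num))
  have hlam'0 : ∀ᶠ n in atTop, 0 < lam' n := by
    filter_upwards [hκlim.eventually (lt_mem_nhds (show (-1 : ℝ) < 0 by norm_num))] with n hn
    rw [hlam']
    exact mul_pos hlam (by linarith)
  have hσ'0 : ∀ᶠ n in atTop, 0 < σ' n := hs.mono fun n hn => by
    rw [hσ']
    exact mul_pos hσ hn
  have hr' : ∀ᶠ n in atTop, (((lam' n).toNNReal * Δ n : ℝ≥0) : ℝ) = r n * (1 + κ n) := by
    filter_upwards [hlam'0] with n hn
    rw [hr, NNReal.coe_mul, NNReal.coe_mul, Real.coe_toNNReal _ hn.le, Real.coe_toNNReal _ hlam.le,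
      hlam']
    ring
  -- The rows consist of the hidden pairs. On them `T` depends on the increment only, while `ξ` is
  -- the complete score, which the increment does not determine.
  refine tendstoInDistribution_sum_log_one_add
    (Z := fun n k => noise B (N lam) (Δ n) k)
    (μ := fun n => (gaussianReal 0 1).prod (poissonLaw (r n)))
    (ξ := fun n => fullScore α β (h n) (κ n) (r n))
    (T := fun n e => sqrtRatio (θ' n) (σ' n) (lam' n) θ σ lam (Δ n)
      (incrementMap (θ - lam) σ √(Δ n) e) - 1)
    (fun n k => hasLaw_noise hB hN hBN (hΔ_pos n) k)
    (fun n => iIndepFun_noise hB hN hBN (hΔ_pos n) n)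
    (fun n => measurable_fullScore _ _ _ _ _)
    (fun n => ((measurable_sqrtRatio _ _ _ _ _ _ _).comp
      (measurable_incrementMap _ _ _)).sub_const 1)
    (fun n => memLp_four_fullScore _ _ _ _ _) (fun n => integral_fullScore _ _ _ _ _)
    ?_ (tendsto_integral_fullScore_pow_four hrR hκlim hp) ?_ ?_ ?_ hY
  · rw [hτ]
    exact tendsto_integral_fullScore_sq hp
  · filter_upwards [hσ'0] with n hn using memLp_sqrtRatio_sub_one hσ hn (hΔ_pos n)
  · filter_upwards [hσ'0] with n hn using integral_sqrtRatio_sub_one hσ hn (hΔ_pos n)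
  set C := 128 * (4 * |α| / σ + |β| * (8 + 8 * |θ - lam|) / σ ^ 2 + 4 * |c|) ^ 2
    * ((θ - lam) ^ 6 + σ ^ 6 * ∫ x, x ^ 6 ∂gaussianReal 0 1) with hC
  have hΔ' : Tendsto (fun n => (Δ n : ℝ)) atTop (𝓝 0) := by
    simpa using NNReal.tendsto_coe.2 hΔ
  have hlim : Tendsto (fun n : ℕ => 15 * ((n : ℝ) * ∫ e, (2 * (fullRatio α β (h n) (r n)
      ((lam' n).toNNReal * Δ n) e - 1) - fullScore α β (h n) (κ n) (r n) e) ^ 2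
      ∂(gaussianReal 0 1).prod (poissonLaw (r n))) + 12 * (C * Δ n)) atTop (𝓝 0) := by
    have := ((tendsto_integral_fullRatio_remainder (α := α) (β := β) hr0 hr' hrR hκlim hp).const_mul
      15).add ((hΔ'.const_mul C).const_mul 12)
    simpa using this
  refine squeeze_zero' (Eventually.of_forall fun n => ?_) ?_ hlim
  · exact mul_nonneg (Nat.cast_nonneg n) (integral_nonneg fun _ => by positivity)
  filter_upwards [eventually_natCast_mul_sq_inv_sqrt, hs, hlam'0] with n hn hsn hlamn
  have hle := integral_sqrtRatio_remainder_le (α := α) (c := c) hσ hlam hlamn (hΔ_pos n) (hΔ_le n)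
    hsn (hσ' n) (hdrift n)
  rw [Real.sq_sqrt (NNReal.coe_nonneg (Δ n))] at hle
  refine (mul_le_mul_of_nonneg_left hle (Nat.cast_nonneg n)).trans_eq ?_
  change _ * h n ^ 2 = 1 at hn
  linear_combination (12 * C * Δ n) * hn

end LocalAsymptoticNormality

end LinearJump

/-! ### The theorem in the original parameters -/

theorem theorem1 {Ω : Type*} [MeasurableSpace Ω] (P : Measure Ω) [IsProbabilityMeasure P]
    (B : ℝ≥0 → Ω → ℝ) (hB : IsBrownianReal B P)
    (N : ℝ → ℝ≥0 → Ω → ℝ)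
    (hN : ∀ lam : ℝ, 0 < lam → LinearJump.IsPoissonProcess lam.toNNReal (N lam) P)
    (hBN : ∀ lam : ℝ, 0 < lam →
      IndepFun (fun ω (t : ℝ≥0) => B t ω) (fun ω (t : ℝ≥0) => N lam t ω) P)
    (x : ℝ) (Δ : ℕ → ℝ≥0) (hΔ_pos : ∀ n, 0 < Δ n) (hΔ_le : ∀ n, Δ n ≤ 1)
    (hnΔ : Tendsto (fun n : ℕ => (n : ℝ) * (Δ n : ℝ)) atTop atTop)
    (hΔ : Tendsto Δ atTop (𝓝 0)) :
    -- the observations have densities, and these are positive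
    (∀ θ σ lam : ℝ, 0 < σ → 0 < lam → ∀ n : ℕ,
      HasPDF (LinearJump.observation B N x θ σ lam n (Δ n)) P (LinearJump.refMeasure n x) ∧
      ∀ᵐ y ∂(LinearJump.refMeasure n x),
        0 < LinearJump.density P B N x n (Δ n) θ σ lam y) ∧
    -- the LAN property
    (∀ θ σ lam : ℝ, 0 < σ → 0 < lam →
      (LinearJump.fisherInfo σ lam).PosSemidef ∧
      ∀ u v w : ℝ,
        TendstoInDistribution
          (fun (n : ℕ) (ω : Ω) =>
            LinearJump.logLikelihoodRatio P B N x n (Δ n)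
              (θ + u / √((n : ℝ) * (Δ n : ℝ)))
              (σ + v / √(n : ℝ))
              (lam + w / √((n : ℝ) * (Δ n : ℝ)))
              θ σ lam ω)
          atTop
          (fun G : EuclideanSpace ℝ (Fin 3) =>
            ![u, v, w] ⬝ᵥ G.ofLp
              - 1 / 2 * (![u, v, w] ⬝ᵥ (LinearJump.fisherInfo σ lam *ᵥ ![u, v, w])))
          (fun _ => P)
          (multivariateGaussian 0 (LinearJump.fisherInfo σ lam))) := by
  refine ⟨fun θ σ lam hσ hlam n => ⟨LinearJump.hasPDF_observation hB (hN lam hlam) (hBN lam hlam) x θ hσ n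
    (hΔ_pos n), LinearJump.ae_density_pos hB (hN lam hlam) (hBN lam hlam) x θ hσ n (hΔ_pos n)⟩,
    fun θ σ lam hσ hlam => ⟨LinearJump.posSemidef_fisherInfo hσ hlam, fun u v w => ?_⟩⟩
  have hz := LinearJump.dotProduct_fisherInfo hσ hlam ![u, v, w]
  simp only [Matrix.cons_val] at hz
  have hnn : 0 ≤ ![u, v, w] ⬝ᵥ (LinearJump.fisherInfo σ lam *ᵥ ![u, v, w]) := by
    rw [hz]
    positivity
  set τ : ℝ≥0 := ⟨_, hnn⟩ with hτ
  have hτ' : ![u, v, w] ⬝ᵥ (LinearJump.fisherInfo σ lam *ᵥ ![u, v, w]) = τ := rfl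
  have hsqrt : ∀ n : ℕ, √((n : ℝ) * (Δ n : ℝ)) = √(n : ℝ) * √(Δ n : ℝ) :=
    fun n => Real.sqrt_mul (Nat.cast_nonneg n) _
  have hlamn : ∀ n : ℕ, lam + w / √((n : ℝ) * (Δ n : ℝ))
      = lam * (1 + (√(n : ℝ))⁻¹ * (w / lam) / √(Δ n : ℝ)) := by
    intro n
    rw [hsqrt, div_eq_mul_inv, mul_inv, div_eq_mul_inv _ √(Δ n : ℝ)]
    field_simp
  have hσn : ∀ n : ℕ, σ + v / √(n : ℝ) = σ * (1 + v / σ * (√(n : ℝ))⁻¹) := by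
    intro n
    rw [div_eq_mul_inv]
    field_simp
  -- The drift of the continuous part is `θ - lam`, so it moves by `u - w` in units of `1 / √(n
  -- Δ_n)`; this explains `α = (u - w) / σ`. The other local parameters are `v / σ` and `w / lam`.
  have hlimit := LinearJump.tendstoInDistribution_sum_log_sqrtRatio (N := N) (θ := θ) hB hΔ_pos
    hΔ_le hnΔ hΔ hσ hlam (hN lam hlam) (hBN lam hlam) (α := (u - w) / σ)
    (θ' := fun n => θ + u / √((n : ℝ) * (Δ n : ℝ))) hσn hlamn (fun n => by
      have hδ : √(Δ n : ℝ) ≠ 0 := (Real.sqrt_pos.2 (hΔ_pos n)).ne'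
      rw [hsqrt, div_eq_mul_inv, div_eq_mul_inv, mul_inv]
      field_simp
      ring) (τ := τ) (by rw [← hτ', hz])
    (LinearJump.hasLaw_dotProduct_multivariateGaussian (LinearJump.posSemidef_fisherInfo hσ hlam)
      ![u, v, w] hτ')
  have hpos : ∀ᶠ n : ℕ in atTop, 0 < σ + v / √(n : ℝ) := by
    have := (LinearJump.tendsto_inv_sqrt_natCast.const_mul v).const_add σ
    rw [mul_zero, add_zero] at this
    filter_upwards [this.eventually (lt_mem_nhds hσ)] with n hn
    rwa [div_eq_mul_inv]
  have hpos' : ∀ᶠ n : ℕ in atTop, 0 < lam + w / √((n : ℝ) * (Δ n : ℝ)) := by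
    have := ((Real.tendsto_sqrt_atTop.comp hnΔ).inv_tendsto_atTop.const_mul w).const_add lam
    rw [mul_zero, add_zero] at this
    filter_upwards [this.eventually (lt_mem_nhds hlam)] with n hn
    rwa [div_eq_mul_inv]
  have hfun : (fun G : EuclideanSpace ℝ (Fin 3) => ![u, v, w] ⬝ᵥ G.ofLp
      - 1 / 2 * (![u, v, w] ⬝ᵥ (LinearJump.fisherInfo σ lam *ᵥ ![u, v, w])))
      = fun G => ![u, v, w] ⬝ᵥ G.ofLp - τ / 2 := by
    ext G
    rw [hτ']
    ring
  rw [hfun]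
  refine LinearJump.tendstoInDistribution_congr_eventually hlimit (fun n =>
    LinearJump.aemeasurable_logLikelihoodRatio hB (hN lam hlam) (hBN lam hlam) x _ _ _ θ σ n
      (hΔ_pos n)) ?_
  filter_upwards [hpos, hpos'] with n h₁ h₂
  exact (LinearJump.logLikelihoodRatio_ae_eq hB (hN lam hlam) (hBN lam hlam) (hN _ h₂) (hBN _ h₂) x
    hσ h₁ n (hΔ_pos n)).mono fun ω hω => hω.symm
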